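/- Let $\mu>0$, $3\lambda+2\mu>0$, $\omega>0$, $k_p=\omega/\sqrt{\lambda+2\mu}$, $k_s=\omega/\sqrt{\mu}$, and let $d,d^\perp\in\mathbb S^2\subset\mathbb R^3$ with $d\cdot d^\perp=0$. Let $D\subset\mathbb R^3$ be a nonempty bounded open set such that $\mathbb R^3\setminus\overline D$ is connected, and for $\mathbf a\in\mathbb R^3$ put $D_{\mathbf a}=\mathbf a+D$. Consider the incident plane wave $$u^{in}(x)=\alpha\, d\, e^{ik_p x\cdot d}+\beta\, d^\perp e^{ik_s x\cdot d},\qquad \alpha,\beta\in\mathbb C,\quad \alpha\beta=0,\quad (\alpha,\beta)\neq(0,0),$$ that is, a nonzero pure pressure or pure shear wave. For a rigid body $B$ (here $B=D$ or $B=D_{\mathbf a}$), a scattered field $u^{sc}=u^{sc}(\cdot\,;B)\in C^2(\mathbb R^3\setminus\overline B)^3$ is a field such that the total field $u=u^{in}+u^{sc}$ is of class $H^1$ on bounded parts of $\mathbb R^3\setminus\overline B$ and satisfies $$\mu\Delta u+(\lambda+\mu)\,\mathrm{grad}\,\mathrm{div}\,u+\omega^2u=0\ \text{ in }\mathbb R^3\setminus\overline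 B,$$ $$u=0\ \text{ on }\partial B\ \ (\text{i.e. }\chi u\in H^1_0(\mathbb R^3\setminus\overline B)^3\text{ for all }\chi\in C_c^\infty(\mathbb R^3)),$$ and such that $u^{sc}_p=-k_p^{-2}\,\mathrm{grad}\,\mathrm{div}\,u^{sc}$ and $u^{sc}_s=k_s^{-2}\,\mathrm{curl}\,\mathrm{curl}\,u^{sc}$ satisfy the radiation conditions $$r\Big(\frac{\partial u^{sc}_p}{\partial r}-ik_pu^{sc}_p\Big)\to0,\qquad r\Big(\frac{\partial u^{sc}_s}{\partial r}-ik_su^{sc}_s\Big)\to0\qquad(r=|x|\to\infty)$$ uniformly in all directions. The P-part $u_p^\infty(\cdot\,;B)$ and the S-part $u_s^\infty(\cdot\,;B)$ of the far-field pattern are the functions $\mathbb S^2\to\mathbb C^3$ determined by $$u^{sc}(x)=\frac{e^{ik_p|x|}}{4\pi(\lambda+\mu)|x|}\,u_p^\infty(\hat x;B)+\frac{e^{ik_s|x|}}{4\pi\mu|x|}\,u_s^\infty(\hat x;B)+\mathcal O(|x|^{-2}),\qquad |x|\to\infty,\quad \hat x=x/|x|.$$ If $u_p^\infty(\hat x;D_{\mathbf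 a})=u_p^\infty(\hat x;D)$ for all $\hat x\in\mathbb S^2$, or $u_s^\infty(\hat x;D_{\mathbf a})=u_s^\infty(\hat x;D)$ for all $\hat x\in\mathbb S^2$, then $\mathbf a=0$. -/

import Mathlib

open scoped ContDiff Topology Asymptotics

namespace ElasticScattering

noncomputable section

/-- Physical space `ℝ³` with its Euclidean structure. -/
abbrev Space := EuclideanSpace ℝ (Fin 3)

/-- Complex displacement vectors, `ℂ³`. -/
abbrev CVec := EuclideanSpace ℂ (Fin 3)

/-- A real vector regarded as a complex vector. -/
def toCVec (v : Space) : CVec := WithLp.toLp 2 (fun i => (v i : ℂ))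

/-- The compressional wave number `k_p = om / √(λ + 2μ)`. -/
def kP (lam mu om : ℝ) : ℝ := om / Real.sqrt (lam + 2 * mu)

/-- The shear wave number `k_s = om / √μ`. -/
def kS (mu om : ℝ) : ℝ := om / Real.sqrt mu

/-- The partial derivative `∂ⱼ uᵢ` at `x`. -/
def pderiv (u : Space → CVec) (j i : Fin 3) (x : Space) : ℂ :=
  (fderiv ℝ u x (EuclideanSpace.single j 1)) i

/-- The gradient of a complex scalar field. -/
def grad (f : Space → ℂ) (x : Space) : CVec :=
  WithLp.toLp 2 (fun i => fderiv ℝ f x (EuclideanSpace.single i 1))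

/-- The divergence of a complex vector field. -/
def div (u : Space → CVec) (x : Space) : ℂ := ∑ i, pderiv u i i x

/-- The curl of a complex vector field. -/
def curl (u : Space → CVec) (x : Space) : CVec :=
  !₂[pderiv u 1 2 x - pderiv u 2 1 x,
     pderiv u 2 0 x - pderiv u 0 2 x,
     pderiv u 0 1 x - pderiv u 1 0 x]

/-- The Lamé operator `Δ* u = μ Δ u + (λ + μ) grad div u`. -/
def lameOp (lam mu : ℝ) (u : Space → CVec) (x : Space) : CVec :=
  mu • Laplacian.laplacian u x + (lam + mu) • grad (div u) x

/-- The incident plane wave `α d e^{i k_p x·d} + β d^⊥ e^{i k_s x·d}`. -/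
def incident (lam mu om : ℝ) (α β : ℂ) (d dp : Space) (x : Space) : CVec :=
  (α * Complex.exp (Complex.I * (kP lam mu om * inner ℝ x d : ℝ))) • toCVec d +
    (β * Complex.exp (Complex.I * (kS mu om * inner ℝ x d : ℝ))) • toCVec dp

/-- The pressure (longitudinal) part `-k_p⁻² grad div u`. -/
def pressurePart (lam mu om : ℝ) (u : Space → CVec) (x : Space) : CVec :=
  (-(1 / kP lam mu om ^ 2)) • grad (div u) x

/-- The shear (transversal) part `k_s⁻² curl curl u`. -/
def shearPart (mu om : ℝ) (u : Space → CVec) (x : Space) : CVec :=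
  (1 / kS mu om ^ 2) • curl (curl u) x

/-- The radial derivative `∂v/∂r` at `x ≠ 0`. -/
def radialDeriv (v : Space → CVec) (x : Space) : CVec :=
  fderiv ℝ v x (‖x‖⁻¹ • x)

/-- The radiation condition `r (∂v/∂r - i k v) → 0` as `r = |x| → ∞`, uniformly in all
directions. -/
def IsRadiating (k : ℝ) (v : Space → CVec) : Prop :=
  Filter.Tendsto (fun x : Space => ‖x‖ • (radialDeriv v x - (Complex.I * (k : ℂ)) • v x))
    (Bornology.cobounded Space) (𝓝 0)

/-- For a field `u` that is continuously differentiable in the open set `Ω`: membership in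
`H¹₀(Ω)`, the closure of `C_c^∞(Ω)³` in the norm of `H¹(Ω)³`. -/
def MemH10 (Ω : Set Space) (u : Space → CVec) : Prop :=
  ∀ ε : ENNReal, 0 < ε → ∃ φ : Space → CVec,
    ContDiff ℝ ∞ φ ∧ HasCompactSupport φ ∧ tsupport φ ⊆ Ω ∧
    MeasureTheory.eLpNorm (fun x => u x - φ x) 2 (MeasureTheory.volume.restrict Ω) ≤ ε ∧
    MeasureTheory.eLpNorm (fun x => fderiv ℝ u x - fderiv ℝ φ x) 2
      (MeasureTheory.volume.restrict Ω) ≤ ε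

/-- The condition that `u` is of class `H¹` on bounded subsets of `Ω` (up to the boundary) and
has zero trace on `∂Ω`: every smooth cut-off `χ u` lies in `H¹₀(Ω)`. -/
def HasZeroTrace (Ω : Set Space) (u : Space → CVec) : Prop :=
  ∀ χ : Space → ℝ, ContDiff ℝ ∞ χ → HasCompactSupport χ → MemH10 Ω (fun x => χ x • u x)

/-- `usc` is the scattered field for the rigid body `D` and the incident plane wave with data
`α, β, d, dp, om`. Only the values of `usc` in the exterior `ℝ³ \ D̄` matter. -/
structure IsScatteredField (lam mu om : ℝ) (α β : ℂ) (d dp : Space) (D : Set Space)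
    (usc : Space → CVec) : Prop where
  contDiffOn : ContDiffOn ℝ 2 usc (closure D)ᶜ
  /-- The total field solves the reduced Navier equation in the exterior. -/
  navier : ∀ x ∈ (closure D)ᶜ,
    lameOp lam mu (fun y => incident lam mu om α β d dp y + usc y) x +
      om ^ 2 • (incident lam mu om α β d dp x + usc x) = 0
  /-- The total field vanishes on the boundary of the rigid body. -/
  dirichlet : HasZeroTrace (closure D)ᶜ (fun y => incident lam mu om α β d dp y + usc y)
  radiating_p : IsRadiating (kP lam mu om) (pressurePart lam mu om usc)
  radiating_s : IsRadiating (kS mu om) (shearPart mu om usc)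

/-- `up` and `us` are (on the unit sphere) the P-part and the S-part of the far-field pattern of
`usc`:
`usc(x) = e^{i k_p |x|}/(4π(λ+μ)|x|) up(x̂) + e^{i k_s |x|}/(4πμ|x|) us(x̂) + O(|x|⁻²)`
as `|x| → ∞`, where `x̂ = x/|x|`. As `k_p ≠ k_s`, this determines `up` and `us` on the
sphere. -/
def IsFarFieldPattern (lam mu om : ℝ) (usc up us : Space → CVec) : Prop :=
  (fun x : Space => usc x -
      ((Complex.exp (Complex.I * (kP lam mu om * ‖x‖ : ℝ)) /
          ((4 * Real.pi * (lam + mu) * ‖x‖ : ℝ) : ℂ)) • up (‖x‖⁻¹ • x) +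
        (Complex.exp (Complex.I * (kS mu om * ‖x‖ : ℝ)) /
          ((4 * Real.pi * mu * ‖x‖ : ℝ) : ℂ)) • us (‖x‖⁻¹ • x)))
    =O[Bornology.cobounded Space] (fun x : Space => 1 / ‖x‖ ^ 2)

end

end ElasticScattering

open ElasticScattering

/-!
# A single far-field part locates a translated rigid elastic body

Let `u`, `uₐ` be the fields scattered from `D` and from `a + D`. The incident plane wave satisfies
`uin(x + a) = c uin(x)` with a constant `c` of modulus one, so `uₐ(x + a) - c u(x)` is a radiating
solution of the Navier equation with vanishing trace on `∂D`, and vanishes by uniqueness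
(`Scattering.translate`). On the level of patterns a translation is a multiplication by a phase
(`HasPattern.translate`); hence equality of, say, the P-parts `p` of both patterns gives
`p(θ) (e^{i k a·θ} - c) = 0` on the sphere. If `p` is not identically zero, the phase is constant on
a piece of the sphere, which forces `a = 0` (`eq_zero_of_mul_phase_eq`).

It remains to exclude that one part of the pattern vanishes identically. By Rellich's lemma the
corresponding part of the scattered field is then zero.
* If this part is of the type of the incident wave, the energy balance of the total field far away
  involves only the other part of the scattered field, since a plane wave has no net flux through
  spheres. So that part vanishes too (`Scattering.eq_zero_of_pattern_p`,
  `Scattering.eq_zero_of_pattern_s`).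
* If it is of the other type, the scattered field solves a Helmholtz equation in each component. Its
  part orthogonal to the polarization `b` of the incident wave is radiating with vanishing trace,
  hence zero, so the scattered field has the form `b f`; as it is curl-free or divergence-free, `f`
  is constant along a direction, and being radiating it vanishes in a half space
  (`Scattering.eq_zero_of_pattern_ps`, `Scattering.eq_zero_of_pattern_sp`).

In both cases the scattered field vanishes in the whole exterior by unique continuation, and the
incident wave itself would have vanishing trace on `∂D`, which is impossible
(`not_hasZeroTrace_planeWave`).

The tools for the Helmholtz equation are derived for continuous weak solutions (`WeakHelm`) from one
source: the moments of a solution against homogeneous polynomials over concentric spheres satisfy a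
radial ordinary differential equation (`WeakHelm.moment_ode`). With the Stone-Weierstrass theorem
this gives unique continuation, Rellich's lemma and the mean value property, and the latter gives
interior regularity. As the trace condition is formulated in `H¹₀` without regularity of `∂D`, the
energy balance is obtained by testing the equation with approximations of the field
(`HasZeroTrace.integral_flux_eq_zero`). The elastic energy flux splits into those of the pressure
part and of the shear part, up to a field without flux (`PSDecomp.integral_current`), and the
radiation conditions turn a vanishing flux into the decay that Rellich's lemma requires
(`Radiates.eq_zero_of_flux`).
-/

namespace ElasticScattering

noncomputable section

open MeasureTheory Set Filter Metric

/-! ### Partial derivatives and integration by parts -/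

/-- The `i`-th partial derivative of a field on `ℝ³`. -/
def pd {F : Type*} [NormedAddCommGroup F] [NormedSpace ℝ F] (i : Fin 3) (f : Space → F)
    (x : Space) : F :=
  fderiv ℝ f x (EuclideanSpace.single i 1)

/-- The Laplacian as the sum of the second partial derivatives. -/
def lap {F : Type*} [NormedAddCommGroup F] [NormedSpace ℝ F] (f : Space → F) (x : Space) : F :=
  ∑ i, pd i (pd i f) x

section Calculus

variable {F : Type*} [NormedAddCommGroup F] [NormedSpace ℝ F]

lemma pd_congr {f g : Space → F} {x : Space} (h : f =ᶠ[𝓝 x] g) (i : Fin 3) :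
    pd i f x = pd i g x := by
  simp only [pd, h.fderiv_eq]

lemma eventuallyEq_pd {f g : Space → F} {x : Space} (h : f =ᶠ[𝓝 x] g) (i : Fin 3) :
    pd i f =ᶠ[𝓝 x] pd i g := by
  filter_upwards [h.eventuallyEq_nhds] with y hy using pd_congr hy i

lemma lap_congr {f g : Space → F} {x : Space} (h : f =ᶠ[𝓝 x] g) : lap f x = lap g x := by
  simp only [lap]
  exact Finset.sum_congr rfl fun i _ => pd_congr (eventuallyEq_pd h i) i

lemma pd_add {f g : Space → F} {x : Space} (hf : DifferentiableAt ℝ f x)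
    (hg : DifferentiableAt ℝ g x) (i : Fin 3) :
    pd i (fun y => f y + g y) x = pd i f x + pd i g x := by
  simp [pd, fderiv_fun_add hf hg]

lemma pd_sub {f g : Space → F} {x : Space} (hf : DifferentiableAt ℝ f x)
    (hg : DifferentiableAt ℝ g x) (i : Fin 3) :
    pd i (fun y => f y - g y) x = pd i f x - pd i g x := by
  simp [pd, fderiv_fun_sub hf hg]

lemma pd_sum {ι : Type*} {s : Finset ι} {f : ι → Space → F} {x : Space}
    (hf : ∀ j ∈ s, DifferentiableAt ℝ (f j) x) (i : Fin 3) :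
    pd i (fun y => ∑ j ∈ s, f j y) x = ∑ j ∈ s, pd i (f j) x := by
  simp [pd, fderiv_fun_sum hf]

lemma pd_mul {f g : Space → ℂ} {x : Space} (hf : DifferentiableAt ℝ f x)
    (hg : DifferentiableAt ℝ g x) (i : Fin 3) :
    pd i (fun y => f y * g y) x = pd i f x * g x + f x * pd i g x := by
  simp [pd, fderiv_fun_mul hf hg]; ring

lemma pd_const_mul {f : Space → ℂ} {x : Space} (hf : DifferentiableAt ℝ f x) (c : ℂ) (i : Fin 3) :
    pd i (fun y => c * f y) x = c * pd i f x := by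
  simp [pd, fderiv_const_mul hf]

@[simp] lemma pd_const (c : F) (i : Fin 3) (x : Space) : pd i (fun _ => c) x = 0 := by
  simp [pd]

lemma pd_conj {f : Space → ℂ} {x : Space} (i : Fin 3) (hf : DifferentiableAt ℝ f x) :
    pd i (fun y => (starRingEnd ℂ) (f y)) x = (starRingEnd ℂ) (pd i f x) := by
  have := (Complex.conjCLE.toContinuousLinearMap.hasFDerivAt.comp x hf.hasFDerivAt).fderiv
  simp only [pd]
  change fderiv ℝ (⇑Complex.conjCLE.toContinuousLinearMap ∘ f) x _ = _
  rw [this]; simp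

/-- Partial derivatives of `C²` functions commute. -/
lemma pd_comm {f : Space → F} {x : Space} (hf : ContDiffAt ℝ 2 f x) (i j : Fin 3) :
    pd i (pd j f) x = pd j (pd i f) x := by
  have hd : DifferentiableAt ℝ (fderiv ℝ f) x :=
    (hf.fderiv_right (m := 1) (by norm_num)).differentiableAt (by norm_num)
  have key : ∀ a b : Space, fderiv ℝ (fun y => fderiv ℝ f y a) x b =
      fderiv ℝ (fderiv ℝ f) x b a := by
    intro a b
    rw [fderiv_clm_apply hd (differentiableAt_const a)]
    simp
  have hs : IsSymmSndFDerivAt ℝ f x := hf.isSymmSndFDerivAt (by simp)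
  change fderiv ℝ (fun y => fderiv ℝ f y _) x _ = fderiv ℝ (fun y => fderiv ℝ f y _) x _
  rw [key, key, hs.eq]

lemma contDiffAt_pd {f : Space → F} {x : Space} {n m : WithTop ℕ∞} (hf : ContDiffAt ℝ n f x)
    (hmn : m + 1 ≤ n) (i : Fin 3) : ContDiffAt ℝ m (pd i f) x :=
  (hf.fderiv_right hmn).clm_apply contDiffAt_const

lemma contDiff_pd_of_le {f : Space → F} {n m : WithTop ℕ∞} (hf : ContDiff ℝ n f)
    (hmn : m + 1 ≤ n) (i : Fin 3) : ContDiff ℝ m (pd i f) :=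
  (hf.fderiv_right hmn).clm_apply contDiff_const

lemma contDiff_pd {f : Space → F} (hf : ContDiff ℝ ∞ f) (i : Fin 3) : ContDiff ℝ ∞ (pd i f) :=
  contDiff_pd_of_le hf (by simp) i

lemma contDiff_lap {f : Space → F} (hf : ContDiff ℝ ∞ f) : ContDiff ℝ ∞ (lap f) :=
  ContDiff.sum fun i _ => contDiff_pd (contDiff_pd hf i) i

lemma tsupport_pd_subset (f : Space → F) (i : Fin 3) : tsupport (pd i f) ⊆ tsupport f := by
  refine (closure_mono ?_).trans (tsupport_fderiv_subset ℝ (f := f))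
  intro x hx h
  exact hx (by simp [pd, h])

lemma tsupport_lap_subset (f : Space → F) : tsupport (lap f) ⊆ tsupport f := by
  refine closure_minimal (fun x hx => ?_) (isClosed_tsupport f)
  by_contra h
  refine hx (Finset.sum_eq_zero fun i _ => ?_)
  exact image_eq_zero_of_notMem_tsupport fun hh => h
    (tsupport_pd_subset f i (tsupport_pd_subset (pd i f) i hh))

/-- A function that is `Cⁿ` on an open set, times a `Cⁿ` function whose support lies in that set,
is `Cⁿ` everywhere. -/
lemma contDiff_mul_of_tsupport_subset {n : WithTop ℕ∞} {U : Set Space} (hU : IsOpen U)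
    {f φ : Space → ℂ} (hf : ContDiffOn ℝ n f U) (hφ : ContDiff ℝ n φ) (hs : tsupport φ ⊆ U) :
    ContDiff ℝ n (fun x => f x * φ x) := by
  rw [contDiff_iff_contDiffAt]
  intro x
  by_cases hx : x ∈ tsupport φ
  · exact (hf.contDiffAt (hU.mem_nhds (hs hx))).mul hφ.contDiffAt
  · have : (fun x => f x * φ x) =ᶠ[𝓝 x] fun _ => 0 := by
      filter_upwards [notMem_tsupport_iff_eventuallyEq.mp hx] with y hy
      simp [hy]
    exact contDiffAt_const.congr_of_eventuallyEq this

lemma integral_pd_eq_zero {f : Space → ℂ} (hf : ContDiff ℝ 1 f) (hc : HasCompactSupport f)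
    (i : Fin 3) : ∫ x, pd i f x = 0 := by
  have hd : Continuous fun x => fderiv ℝ f x (EuclideanSpace.single i 1) :=
    (hf.continuous_fderiv (by norm_num)).clm_apply continuous_const
  have hi : Integrable fun x => fderiv ℝ f x (EuclideanSpace.single i 1) :=
    hd.integrable_of_hasCompactSupport (hc.fderiv_apply (𝕜 := ℝ) _)
  have := integral_mul_fderiv_eq_neg_fderiv_mul_of_integrable (μ := volume)
      (f := fun _ : Space => (1 : ℂ))
    (g := f) (v := EuclideanSpace.single i 1) (by simp) (by simpa using hi)
    (by simpa using hf.continuous.integrable_of_hasCompactSupport hc)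
    (fun x _ => differentiableAt_const _) (fun x _ => hf.differentiable (by norm_num) x)
  simpa [pd] using this

/-- Continuity on an open set together with compact support inside it gives integrability. -/
lemma integrable_mul_of_tsupport_subset {U : Set Space} (hU : IsOpen U)
    {f φ : Space → ℂ} (hf : ContinuousOn f U) (hφ : Continuous φ) (hc : HasCompactSupport φ)
    (hs : tsupport φ ⊆ U) : Integrable (fun x => f x * φ x) := by
  have h := contDiff_mul_of_tsupport_subset (n := 0) hU (contDiffOn_zero.2 hf)
    (contDiff_zero.2 hφ) hs
  exact h.continuous.integrable_of_hasCompactSupport hc.mul_left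

/-- Integration by parts against a compactly supported test function. -/
lemma integral_mul_pd {U : Set Space} (hU : IsOpen U) {f φ : Space → ℂ} (hf : ContDiffOn ℝ 1 f U)
    (hφ : ContDiff ℝ ∞ φ) (hc : HasCompactSupport φ) (hs : tsupport φ ⊆ U) (i : Fin 3) :
    ∫ x, f x * pd i φ x = - ∫ x, pd i f x * φ x := by
  have h0 := integral_pd_eq_zero (contDiff_mul_of_tsupport_subset hU hf (hφ.of_le (by simp)) hs)
    hc.mul_left i
  have hpd : ContinuousOn (pd i f) U :=
    (hf.continuousOn_fderiv_of_isOpen hU (by norm_num)).clm_apply continuousOn_const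
  have h1 := integrable_mul_of_tsupport_subset hU hpd hφ.continuous hc hs
  have h2 := integrable_mul_of_tsupport_subset hU hf.continuousOn (contDiff_pd hφ i).continuous
    (hc.mono' ((subset_tsupport _).trans (tsupport_pd_subset φ i)))
    ((tsupport_pd_subset φ i).trans hs)
  have : ∀ x, pd i (fun y => f y * φ y) x = pd i f x * φ x + f x * pd i φ x := by
    intro x
    by_cases hx : x ∈ tsupport φ
    · exact pd_mul ((hf.differentiableOn (by norm_num)).differentiableAt (hU.mem_nhds (hs hx)))
        (hφ.differentiable (by simp) x) i
    · have hz := notMem_tsupport_iff_eventuallyEq.mp hx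
      have : (fun x => f x * φ x) =ᶠ[𝓝 x] fun _ => 0 := by
        filter_upwards [hz] with y hy
        simp [hy]
      rw [pd_congr this, pd_congr hz]
      have : φ x = 0 := image_eq_zero_of_notMem_tsupport hx
      simp [this, pd]
  simp_rw [this] at h0
  rw [integral_add h1 h2] at h0
  linear_combination h0

end Calculus

/-! ### Polar coordinates -/

/-- The surface measure of the unit sphere. -/
def sph : Measure (sphere (0 : Space) 1) := (volume : Measure Space).toSphere

instance : IsFiniteMeasure sph := inferInstanceAs (IsFiniteMeasure (Measure.toSphere _))

instance : Measure.IsOpenPosMeasure sph :=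
  inferInstanceAs (Measure.IsOpenPosMeasure (Measure.toSphere _))

lemma integral_polar {F : Type*} [NormedAddCommGroup F] [NormedSpace ℝ F] {f : Space → F}
    (hf : Integrable f) :
    ∫ x, f x = ∫ r in Ioi (0 : ℝ), r ^ 2 • ∫ θ, f (r • (θ : Space)) ∂sph := by
  have hdim : Module.finrank ℝ Space - 1 = 2 := by simp
  have hmp := (volume : Measure Space).measurePreserving_homeomorphUnitSphereProd
  rw [hdim] at hmp
  set g : sphere (0 : Space) 1 × Ioi (0 : ℝ) → F := fun p => f ((p.2 : ℝ) • (p.1 : Space)) with hg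
  have hfg : ∀ x : ({(0 : Space)}ᶜ : Set Space), g (homeomorphUnitSphereProd Space x) = f x := by
    intro x
    have hx : ‖(x : Space)‖ ≠ 0 := norm_ne_zero_iff.2 x.2
    simp [hg, smul_smul, hx]
  have hgi : Integrable g (sph.prod (.volumeIoiPow 2)) := by
    rw [sph, ← hmp.integrable_comp_emb (Homeomorph.measurableEmbedding _)]
    have : g ∘ homeomorphUnitSphereProd Space = fun x : ({(0 : Space)}ᶜ : Set Space) => f x :=
      funext hfg
    rw [this]
    exact (integrableOn_iff_comap_subtypeVal (measurableSet_singleton _).compl).1 hf.integrableOn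
  calc
    ∫ x, f x = ∫ x : ({(0 : Space)}ᶜ : Set Space), f x ∂(volume.comap Subtype.val) := by
      rw [integral_subtype_comap (measurableSet_singleton _).compl f, restrict_compl_singleton]
    _ = ∫ p, g p ∂(sph.prod (.volumeIoiPow 2)) := by
      rw [sph, ← hmp.integral_comp (Homeomorph.measurableEmbedding _)]
      simp_rw [hfg]
    _ = ∫ r : Ioi (0 : ℝ), (∫ θ, f ((r : ℝ) • (θ : Space)) ∂sph) ∂(.volumeIoiPow 2) :=
      integral_prod_symm g hgi
    _ = _ := by
      simp only [Measure.volumeIoiPow, ENNReal.ofReal]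
      rw [integral_withDensity_eq_integral_smul,
        integral_subtype_comap measurableSet_Ioi fun a =>
          Real.toNNReal (a ^ 2) • ∫ θ, f (a • (θ : Space)) ∂sph,
        setIntegral_congr_fun measurableSet_Ioi fun x hx ↦ ?_]
      · simp only [NNReal.smul_def, Real.coe_toNNReal _ (pow_nonneg (le_of_lt hx) _)]
      · exact (measurable_subtype_coe.pow_const _).real_toNNReal

/-! ### Weak solutions of the Helmholtz equation -/

/-- Continuous weak (distributional) solutions of `Δv + k²v = 0` in `U`. -/
structure WeakHelm (k : ℝ) (U : Set Space) (v : Space → ℂ) : Prop where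
  continuousOn : ContinuousOn v U
  weak : ∀ φ : Space → ℂ, ContDiff ℝ ∞ φ → HasCompactSupport φ → tsupport φ ⊆ U →
    ∫ x, v x * (lap φ x + (k : ℂ) ^ 2 * φ x) = 0

lemma WeakHelm.mono {k : ℝ} {U V : Set Space} {v : Space → ℂ} (h : WeakHelm k U v) (hVU : V ⊆ U) :
    WeakHelm k V v :=
  ⟨h.continuousOn.mono hVU, fun φ h1 h2 h3 => h.weak φ h1 h2 (h3.trans hVU)⟩

lemma hasCompactSupport_pd {φ : Space → ℂ} (hc : HasCompactSupport φ) (i : Fin 3) :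
    HasCompactSupport (pd i φ) :=
  hc.mono' ((subset_tsupport _).trans (tsupport_pd_subset φ i))

lemma hasCompactSupport_lap {φ : Space → ℂ} (hc : HasCompactSupport φ) :
    HasCompactSupport (lap φ) :=
  hc.mono' ((subset_tsupport _).trans (tsupport_lap_subset φ))

lemma contDiffOn_pd {F : Type*} [NormedAddCommGroup F] [NormedSpace ℝ F] {U : Set Space}
    (hU : IsOpen U) {f : Space → F} {n m : WithTop ℕ∞}
    (hf : ContDiffOn ℝ n f U) (hmn : m + 1 ≤ n) (i : Fin 3) : ContDiffOn ℝ m (pd i f) U :=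
  fun _ hx => (contDiffAt_pd (hf.contDiffAt (hU.mem_nhds hx)) hmn i).contDiffWithinAt

/-- Green's formula against a test function. -/
lemma integral_mul_lap {U : Set Space} (hU : IsOpen U) {f φ : Space → ℂ} (hf : ContDiffOn ℝ 2 f U)
    (hφ : ContDiff ℝ ∞ φ) (hc : HasCompactSupport φ) (hs : tsupport φ ⊆ U) :
    ∫ x, f x * lap φ x = ∫ x, lap f x * φ x := by
  have hpd : ∀ i, ContDiffOn ℝ 1 (pd i f) U := fun i => contDiffOn_pd hU hf (by norm_num) i
  have h1 : ∀ i, Integrable fun x => f x * pd i (pd i φ) x := fun i =>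
    integrable_mul_of_tsupport_subset hU hf.continuousOn
      (contDiff_pd (contDiff_pd hφ i) i).continuous
          (hasCompactSupport_pd (hasCompactSupport_pd hc i) i)
      ((tsupport_pd_subset _ i).trans ((tsupport_pd_subset _ i).trans hs))
  have h2 : ∀ i, Integrable fun x => pd i (pd i f) x * φ x := fun i =>
    integrable_mul_of_tsupport_subset hU
      (contDiffOn_pd hU (hpd i) (m := 0) (by norm_num) i).continuousOn hφ.continuous hc hs
  simp only [lap, Finset.mul_sum, Finset.sum_mul]
  rw [integral_finsetSum _ fun i _ => h1 i, integral_finsetSum _ fun i _ => h2 i]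
  refine Finset.sum_congr rfl fun i _ => ?_
  rw [integral_mul_pd hU (hf.of_le (by norm_num)) (contDiff_pd hφ i) (hasCompactSupport_pd hc i)
    ((tsupport_pd_subset φ i).trans hs) i, integral_mul_pd hU (hpd i) hφ hc hs i, neg_neg]

lemma weakHelm_of_contDiffOn {k : ℝ} {U : Set Space} (hU : IsOpen U) {v : Space → ℂ}
    (hv : ContDiffOn ℝ 2 v U) (h : ∀ x ∈ U, lap v x + (k : ℂ) ^ 2 * v x = 0) : WeakHelm k U v := by
  refine ⟨hv.continuousOn, fun φ hφ hc hs => ?_⟩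
  have i1 := integrable_mul_of_tsupport_subset hU hv.continuousOn (contDiff_lap hφ).continuous
    (hasCompactSupport_lap hc) ((tsupport_lap_subset φ).trans hs)
  have i2 := (integrable_mul_of_tsupport_subset hU hv.continuousOn hφ.continuous hc hs).const_mul
    ((k : ℂ) ^ 2)
  have hl : ContinuousOn (lap v) U := continuousOn_finsetSum _ fun i _ =>
    (contDiffOn_pd hU (contDiffOn_pd hU hv (m := 1) (by norm_num) i)
        (m := 0) (by norm_num) i).continuousOn
  have i3 := integrable_mul_of_tsupport_subset hU hl hφ.continuous hc hs
  have e1 : (fun x => v x * (lap φ x + (k : ℂ) ^ 2 * φ x)) =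
      fun x => v x * lap φ x + (k : ℂ) ^ 2 * (v x * φ x) := by
    funext x; ring
  rw [e1, integral_add i1 i2, integral_mul_lap hU hv hφ hc hs, ← integral_add i3 i2]
  refine integral_eq_zero_of_ae (Eventually.of_forall fun x => ?_)
  by_cases hx : x ∈ tsupport φ
  · change lap v x * φ x + (k : ℂ) ^ 2 * (v x * φ x) = 0
    linear_combination φ x * h x (hs hx)
  · simp [image_eq_zero_of_notMem_tsupport hx]

lemma pd_comp_add {F : Type*} [NormedAddCommGroup F] [NormedSpace ℝ F] (f : Space → F) (a x : Space)
    (i : Fin 3) : pd i (fun y => f (y + a)) x = pd i f (x + a) := by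
  simp [pd, fderiv_comp_add_right]

lemma lap_comp_add {F : Type*} [NormedAddCommGroup F] [NormedSpace ℝ F] (f : Space → F)
    (a x : Space) : lap (fun y => f (y + a)) x = lap f (x + a) := by
  simp only [lap]
  refine Finset.sum_congr rfl fun i _ => ?_
  rw [← pd_comp_add (pd i f) a x i]
  congr 1
  funext y
  exact pd_comp_add f a y i

lemma tsupport_comp_add (φ : Space → ℂ) (a : Space) :
    tsupport (fun y => φ (y + a)) = (fun y => y + a) ⁻¹' tsupport φ :=
  tsupport_comp_eq_preimage φ (Homeomorph.addRight a)

lemma WeakHelm.comp_add {k : ℝ} {U : Set Space} {v : Space → ℂ} (h : WeakHelm k U v) (a : Space) :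
    WeakHelm k ((fun y => y + a) ⁻¹' U) (fun y => v (y + a)) := by
  refine ⟨h.continuousOn.comp (by fun_prop) (fun x hx => hx), fun φ h1 h2 h3 => ?_⟩
  have hc : HasCompactSupport fun y => φ (y + -a) := h2.comp_homeomorph (Homeomorph.addRight (-a))
  have := h.weak (fun y => φ (y + -a)) (h1.comp (contDiff_id.add contDiff_const)) hc (by
    rw [tsupport_comp_add]
    intro y hy
    simpa using h3 hy)
  rw [← integral_add_right_eq_self _ a] at this
  simpa only [lap_comp_add, add_neg_cancel_right] using this

/-! ### Homogeneous polynomials and radial test functions -/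

/-- Smooth functions that are homogeneous of degree `n`; as they are smooth at the origin, these
are exactly the homogeneous polynomials. -/
structure Homog (n : ℕ) (P : Space → ℂ) : Prop where
  contDiff : ContDiff ℝ ∞ P
  map_smul : ∀ (t : ℝ) (x : Space), 0 < t → P (t • x) = (t : ℂ) ^ n * P x

lemma fderiv_apply_eq_sum {F : Type*} [NormedAddCommGroup F] [NormedSpace ℝ F] (f : Space → F)
    (x v : Space) : fderiv ℝ f x v = ∑ i, v i • pd i f x := by
  conv_lhs => rw [← (EuclideanSpace.basisFun (Fin 3) ℝ).sum_repr v]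
  simp [pd]

/-- Euler's identity. -/
lemma Homog.euler {n : ℕ} {P : Space → ℂ} (h : Homog n P) (x : Space) :
    ∑ i, (x i : ℂ) * pd i P x = n * P x := by
  have h1 : HasDerivAt (fun t : ℝ => P (t • x)) (fderiv ℝ P x x) 1 := by
    have hP : HasFDerivAt P (fderiv ℝ P x) ((1 : ℝ) • x) := by
      rw [one_smul]
      exact (h.contDiff.differentiable (by simp) x).hasFDerivAt
    have := hP.comp_hasDerivAt (1 : ℝ) ((hasDerivAt_id (1 : ℝ)).smul_const x)
    rwa [one_smul] at this
  have h2 : HasDerivAt (fun t : ℝ => (t : ℂ) ^ n * P x) (n * P x) 1 := by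
    have := ((hasDerivAt_id (1 : ℝ)).ofReal_comp.pow n).mul_const (P x)
    simpa using this
  have h3 : (fun t : ℝ => P (t • x)) =ᶠ[𝓝 1] fun t : ℝ => (t : ℂ) ^ n * P x := by
    filter_upwards [lt_mem_nhds (show (0 : ℝ) < 1 by norm_num)] with t ht using h.map_smul t x ht
  have := (h2.congr_of_eventuallyEq h3).unique h1
  rw [this, fderiv_apply_eq_sum]
  simp

lemma Homog.pd_smul {n : ℕ} {P : Space → ℂ} (h : Homog n P) (i : Fin 3) (t : ℝ) (x : Space)
    (ht : 0 < t) : (t : ℂ) * pd i P (t • x) = (t : ℂ) ^ n * pd i P x := by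
  have e1 : (fun y => P (t • y)) = fun y => (t : ℂ) ^ n * P y :=
    funext fun y => h.map_smul t y ht
  have hd := h.contDiff.differentiable (by simp)
  have h1 : pd i (fun y => P (t • y)) x = (t : ℂ) * pd i P (t • x) := by
    have := (hd (t • x)).hasFDerivAt.comp x ((hasFDerivAt_id x).const_smul t)
    simp only [pd]
    change fderiv ℝ (P ∘ fun y => t • y) x _ = _
    rw [HasFDerivAt.fderiv (f := P ∘ fun y => t • y) this]
    simp
  rw [← h1, e1, pd_const_mul (hd x)]

lemma Homog.lap_smul {n : ℕ} {P : Space → ℂ} (h : Homog n P) (t : ℝ) (x : Space)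
    (ht : 0 < t) : (t : ℂ) ^ 2 * lap P (t • x) = (t : ℂ) ^ n * lap P x := by
  simp only [lap, Finset.mul_sum]
  refine Finset.sum_congr rfl fun i _ => ?_
  have e1 : (fun y => (t : ℂ) * pd i P (t • y)) =
      fun y => (t : ℂ) ^ n * pd i P y := funext fun y => h.pd_smul i t y ht
  have hd := (contDiff_pd h.contDiff i).differentiable (by simp)
  have hd2 : DifferentiableAt ℝ (fun y => pd i P (t • y)) x :=
    (hd (t • x)).comp x (differentiableAt_id.const_smul t)
  have h1 : pd i (fun y => pd i P (t • y)) x =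
      (t : ℂ) * pd i (pd i P) (t • x) := by
    have := (hd (t • x)).hasFDerivAt.comp x ((hasFDerivAt_id x).const_smul t)
    conv_lhs => rw [pd]
    change fderiv ℝ (pd i P ∘ fun y => t • y) x _ = _
    rw [HasFDerivAt.fderiv (f := pd i P ∘ fun y => t • y) this]
    simp [pd]
  have h2 := congrArg (fun f => pd i f x) e1
  rw [pd_const_mul hd2, pd_const_mul (hd x), h1] at h2
  linear_combination h2

lemma Homog.isHomog_lap {n : ℕ} {P : Space → ℂ} (h : Homog (n + 2) P) : Homog n (lap P) := by
  refine ⟨contDiff_lap h.contDiff, fun t x ht => ?_⟩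
  have := h.lap_smul t x ht
  have ht' : (t : ℂ) ^ 2 ≠ 0 := by simp [ht.ne']
  apply mul_left_cancel₀ ht'
  rw [this]; ring

/-- Homogeneous polynomials of degree at most one are harmonic. -/
lemma Homog.lap_eq_zero {n : ℕ} {P : Space → ℂ} (h : Homog n P) (hn : n < 2) (x : Space) :
    lap P x = 0 := by
  have h1 : Tendsto (fun t : ℝ => (t : ℂ) ^ (2 - n) * lap P (t • x)) (𝓝[>] 0) (𝓝 0) := by
    have hc : Continuous fun t : ℝ => (t : ℂ) ^ (2 - n) * lap P (t • x) := by
      have := (contDiff_lap h.contDiff).continuous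
      fun_prop
    have := (hc.tendsto 0).mono_left (nhdsWithin_le_nhds (s := Ioi 0))
    have h2n : 2 - n ≠ 0 := by omega
    simpa [h2n] using this
  have h2 : Tendsto (fun t : ℝ => (t : ℂ) ^ (2 - n) * lap P (t • x)) (𝓝[>] 0)
      (𝓝 (lap P x)) := by
    refine tendsto_const_nhds.congr' ?_
    filter_upwards [self_mem_nhdsWithin] with t ht
    have ht0 : (t : ℂ) ≠ 0 := by
      have : t ≠ 0 := ne_of_gt ht
      exact_mod_cast this
    have := h.lap_smul t x ht
    have h2 : (t : ℂ) ^ 2 = (t : ℂ) ^ n * (t : ℂ) ^ (2 - n) := by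
      rw [← pow_add]; congr 1; omega
    rw [h2, mul_assoc] at this
    exact (mul_left_cancel₀ (pow_ne_zero n ht0) this).symm
  exact tendsto_nhds_unique h2 h1

lemma Homog.one : Homog 0 fun _ => 1 := ⟨contDiff_const, fun t x _ => by simp⟩

lemma Homog.coord (i : Fin 3) : Homog 1 fun x => (x i : ℂ) :=
  ⟨Complex.ofRealCLM.contDiff.comp (by fun_prop), fun t x _ => by simp⟩

lemma Homog.mul {m n : ℕ} {P Q : Space → ℂ} (hP : Homog m P) (hQ : Homog n Q) :
    Homog (m + n) fun x => P x * Q x :=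
  ⟨hP.contDiff.mul hQ.contDiff, fun t x ht => by
    rw [hP.map_smul t x ht, hQ.map_smul t x ht]; ring⟩

lemma pd_norm {x : Space} (hx : x ≠ 0) (i : Fin 3) : pd i (fun y => ‖y‖) x = x i / ‖x‖ := by
  have hd : DifferentiableAt ℝ (fun y : Space => ‖y‖) x := differentiableAt_id.norm ℝ hx
  have h1 : HasFDerivAt (fun y : Space => ‖y‖ ^ 2) (2 • innerSL ℝ x) x :=
    (hasStrictFDerivAt_norm_sq x).hasFDerivAt
  have h2 := (hd.hasFDerivAt.pow 2).unique h1
  have h3 := congrArg (fun L => L (EuclideanSpace.single i (1 : ℝ))) h2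
  have hx' : ‖x‖ ≠ 0 := norm_ne_zero_iff.2 hx
  simp [EuclideanSpace.inner_single_right] at h3
  rw [pd, eq_div_iff hx']
  linarith

lemma pd_radial_smul {G : ℝ → ℝ} {G' : ℝ} {Q : Space → ℂ} {x : Space} (hx : x ≠ 0)
    (hG : HasDerivAt G G' ‖x‖) (hQ : DifferentiableAt ℝ Q x) (i : Fin 3) :
    pd i (fun y => (G ‖y‖ : ℂ) * Q y) x =
      ((G' / ‖x‖ : ℝ) : ℂ) * ((x i : ℂ) * Q x) + (G ‖x‖ : ℂ) * pd i Q x := by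
  have hd : DifferentiableAt ℝ (fun y : Space => ‖y‖) x := differentiableAt_id.norm ℝ hx
  have h1 : HasFDerivAt (fun y : Space => G ‖y‖) (G' • fderiv ℝ (fun y : Space => ‖y‖) x) x :=
    hG.comp_hasFDerivAt x hd.hasFDerivAt
  have h2 : HasFDerivAt (fun y : Space => (G ‖y‖ : ℂ))
      (Complex.ofRealCLM.comp (G' • fderiv ℝ (fun y : Space => ‖y‖) x)) x :=
    Complex.ofRealCLM.hasFDerivAt.comp x h1
  rw [pd_mul h2.differentiableAt hQ]
  congr 1
  have h3 : pd i (fun y : Space => (G ‖y‖ : ℂ)) x = ((G' * (x i / ‖x‖) : ℝ) : ℂ) := by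
    rw [pd, h2.fderiv]
    simp only [ContinuousLinearMap.coe_comp, Function.comp_apply, _root_.smul_apply,
      Complex.ofRealCLM_apply, smul_eq_mul]
    rw [← pd_norm hx i]; rfl
  rw [h3]; push_cast; ring

/-- The Laplacian of a radial function times a homogeneous polynomial. -/
lemma lap_radial_mul {n : ℕ} {P : Space → ℂ} (hP : Homog n P) {g g1 g2 : ℝ → ℝ}
    (h1 : ∀ s, 0 < s → HasDerivAt g (g1 s) s) (h2 : ∀ s, 0 < s → HasDerivAt g1 (g2 s) s)
    {x : Space} (hx : x ≠ 0) :
    lap (fun y => (g ‖y‖ : ℂ) * P y) x =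
      ((g2 ‖x‖ + (2 * n + 2) * g1 ‖x‖ / ‖x‖ : ℝ) : ℂ) * P x + (g ‖x‖ : ℂ) * lap P x := by
  have hx' : 0 < ‖x‖ := norm_pos_iff.2 hx
  have hPd := hP.contDiff.differentiable (by simp)
  have hcd : ∀ i, Differentiable ℝ fun y : Space => (y i : ℂ) := fun i =>
    (Homog.coord i).contDiff.differentiable (by simp)
  have e1 : ∀ i, pd i (fun y => (g ‖y‖ : ℂ) * P y) =ᶠ[𝓝 x] fun y =>
      ((g1 ‖y‖ / ‖y‖ : ℝ) : ℂ) * ((y i : ℂ) * P y) + (g ‖y‖ : ℂ) * pd i P y := by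
    intro i
    filter_upwards [isOpen_compl_singleton.mem_nhds hx] with y hy
    exact pd_radial_smul hy (h1 _ (norm_pos_iff.2 hy)) (hPd y) i
  have hh : HasDerivAt (fun s => g1 s / s) ((g2 ‖x‖ * ‖x‖ - g1 ‖x‖ * 1) / ‖x‖ ^ 2) ‖x‖ :=
    (h2 _ hx').div (hasDerivAt_id _) hx'.ne'
  have hN : DifferentiableAt ℝ (fun y : Space => ‖y‖) x := differentiableAt_id.norm ℝ hx
  have dr : ∀ {G : ℝ → ℝ} {G' : ℝ}, HasDerivAt G G' ‖x‖ →
      DifferentiableAt ℝ (fun y : Space => (G ‖y‖ : ℂ)) x := by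
    intro G G' hG
    exact (Complex.ofRealCLM.hasFDerivAt.comp x
        (hG.comp_hasFDerivAt x hN.hasFDerivAt)).differentiableAt
  have hpd2 : ∀ i, Differentiable ℝ (pd i P) := fun i =>
    (contDiff_pd hP.contDiff i).differentiable (by simp)
  have hcoord : ∀ i, pd i (fun y : Space => (y i : ℂ)) x = 1 := by
    intro i
    have : HasFDerivAt (fun y : Space => (y i : ℂ))
        (Complex.ofRealCLM.comp (EuclideanSpace.proj i)) x :=
      (Complex.ofRealCLM.comp (EuclideanSpace.proj i : Space →L[ℝ] ℝ)).hasFDerivAt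
    rw [pd, this.fderiv]; simp
  have e2 : ∀ i, pd i (pd i (fun y => (g ‖y‖ : ℂ) * P y)) x =
      (((g2 ‖x‖ * ‖x‖ - g1 ‖x‖) / ‖x‖ ^ 2 / ‖x‖ : ℝ) : ℂ) * ((x i : ℂ) ^ 2 * P x)
      + ((g1 ‖x‖ / ‖x‖ : ℝ) : ℂ) * (P x + 2 * ((x i : ℂ) * pd i P x))
      + (g ‖x‖ : ℂ) * pd i (pd i P) x := by
    intro i
    rw [pd_congr (e1 i) i, pd_add (f := fun y => ((g1 ‖y‖ / ‖y‖ : ℝ) : ℂ) * ((y i : ℂ) * P y))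
      (g := fun y => (g ‖y‖ : ℂ) * pd i P y) ((dr hh).mul ((hcd i x).mul (hPd x)))
      ((dr (h1 _ hx')).mul (hpd2 i x)),
          pd_radial_smul (Q := fun y => (y i : ℂ) * P y) hx hh ((hcd i x).mul (hPd x)) i,
      pd_radial_smul hx (h1 _ hx') (hpd2 i x) i, pd_mul (hcd i x) (hPd x), hcoord]
    push_cast; ring
  have hsum : ∑ i, (x i : ℂ) ^ 2 = (‖x‖ : ℂ) ^ 2 := by
    have := EuclideanSpace.real_norm_sq_eq x
    exact_mod_cast this.symm
  have he := hP.euler x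
  have hxc : (‖x‖ : ℂ) ≠ 0 := by exact_mod_cast hx'.ne'
  have : lap (fun y => (g ‖y‖ : ℂ) * P y) x =
      (((g2 ‖x‖ * ‖x‖ - g1 ‖x‖) / ‖x‖ ^ 2 / ‖x‖ : ℝ) : ℂ) * ((∑ i, (x i : ℂ) ^ 2) * P x)
      + ((g1 ‖x‖ / ‖x‖ : ℝ) : ℂ) * (3 * P x + 2 * (∑ i, (x i : ℂ) * pd i P x))
      + (g ‖x‖ : ℂ) * lap P x := by
    simp only [lap, e2, Fin.sum_univ_three]; ring
  rw [this, hsum, he]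
  push_cast
  field_simp
  ring

/-! ### Ordinary differential equations in the weak sense -/

lemma exists_Icc_of_tsupport_subset {ψ : ℝ → ℝ} {a b : ℝ} (hab : a < b) (hc : HasCompactSupport ψ)
    (hs : tsupport ψ ⊆ Ioo a b) : ∃ a' b', a < a' ∧ a' ≤ b' ∧ b' < b ∧ tsupport ψ ⊆ Icc a' b' := by
  rcases (tsupport ψ).eq_empty_or_nonempty with h | h
  · exact ⟨(a + b) / 2, (a + b) / 2, by linarith, le_rfl, by linarith, by simp [h]⟩
  · have hcomp : IsCompact (tsupport ψ) := hc
    obtain ⟨m, hm, hm'⟩ := hcomp.exists_isLeast h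
    obtain ⟨M, hM, hM'⟩ := hcomp.exists_isGreatest h
    exact ⟨m, M, (hs hm).1, hm' hM, (hs hM).2, fun x hx => ⟨hm' hx, hM' hx⟩⟩

/-- A test function on an interval has a smooth primitive that vanishes to the left of the support
and equals the total integral to the right of it. -/
lemma exists_primitive {ψ : ℝ → ℝ} {a b : ℝ} (hψ : ContDiff ℝ ∞ ψ) (hc : tsupport ψ ⊆ Icc a b)
    (hab : a ≤ b) :
    ∃ ξ : ℝ → ℝ, ContDiff ℝ ∞ ξ ∧ (∀ x, HasDerivAt ξ (ψ x) x) ∧ (∀ x ≤ a, ξ x = 0) ∧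
      ∀ x, b ≤ x → ξ x = ∫ t, ψ t := by
  have hz : ∀ x, x ∉ Icc a b → ψ x = 0 := fun x hx =>
    image_eq_zero_of_notMem_tsupport fun h => hx (hc h)
  have hd : ∀ x, HasDerivAt (fun x => ∫ t in a..x, ψ t) (ψ x) x := fun x =>
    intervalIntegral.integral_hasDerivAt_right (hψ.continuous.intervalIntegrable _ _)
      (hψ.continuous.stronglyMeasurableAtFilter _ _) hψ.continuous.continuousAt
  refine ⟨fun x => ∫ t in a..x, ψ t, ?_, hd, ?_, ?_⟩
  · rw [contDiff_infty_iff_deriv]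
    refine ⟨fun x => (hd x).differentiableAt, ?_⟩
    rwa [funext fun x => (hd x).deriv]
  · intro x hx
    change ∫ t in a..x, ψ t = 0
    rw [intervalIntegral.integral_symm, intervalIntegral.integral_of_le hx,
        ← integral_Ioc_eq_integral_Ioo.symm,
      neg_eq_zero]
    refine setIntegral_eq_zero_of_forall_eq_zero fun t ht => hz t fun h => ?_
    exact absurd h.1 (not_le.2 ht.2)
  · intro x hx
    change ∫ t in a..x, ψ t = _
    rw [intervalIntegral.integral_of_le (hab.trans hx), ← integral_Icc_eq_integral_Ioc]
    refine setIntegral_eq_integral_of_forall_compl_eq_zero fun t ht => hz t fun h => ht ?_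
    exact ⟨h.1, h.2.trans hx⟩

lemma smul_continuous_of_tsupport_subset {a b : ℝ} {f : ℝ → ℂ} {ξ : ℝ → ℝ}
    (hf : ContinuousOn f (Ioo a b)) (hξ : Continuous ξ) (hs : tsupport ξ ⊆ Ioo a b) :
    Continuous fun x => ξ x • f x := by
  rw [continuous_iff_continuousAt]
  intro x
  by_cases hx : x ∈ tsupport ξ
  · exact hξ.continuousAt.smul (hf.continuousAt (isOpen_Ioo.mem_nhds (hs hx)))
  · have : (fun x => ξ x • f x) =ᶠ[𝓝 x] fun _ => 0 := by
      filter_upwards [notMem_tsupport_iff_eventuallyEq.mp hx] with y hy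
      simp [hy]
    exact continuousAt_const.congr this.symm

lemma integrable_smul_of_tsupport_subset {a b : ℝ} {f : ℝ → ℂ} {ξ : ℝ → ℝ}
    (hf : ContinuousOn f (Ioo a b)) (hξ : Continuous ξ) (hc : HasCompactSupport ξ)
    (hs : tsupport ξ ⊆ Ioo a b) : Integrable fun x => ξ x • f x :=
  (smul_continuous_of_tsupport_subset hf hξ hs).integrable_of_hasCompactSupport hc.smul_right

lemma tsupport_deriv_subset' (ξ : ℝ → ℝ) : tsupport (deriv ξ) ⊆ tsupport ξ :=
  closure_minimal support_deriv_subset (isClosed_tsupport ξ)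

lemma integral_deriv_smul {a b : ℝ} {f f' : ℝ → ℂ} {ξ : ℝ → ℝ}
    (hf : ∀ x ∈ Ioo a b, HasDerivAt f (f' x) x) (hf' : ContinuousOn f' (Ioo a b))
    (hξ : ContDiff ℝ ∞ ξ) (hc : HasCompactSupport ξ) (hs : tsupport ξ ⊆ Ioo a b) :
    ∫ x, deriv ξ x • f x = -∫ x, ξ x • f' x := by
  have hfc : ContinuousOn f (Ioo a b) := fun x hx => (hf x hx).continuousAt.continuousWithinAt
  have hξ' : Continuous (deriv ξ) := hξ.continuous_deriv (by simp)
  have i1 := integrable_smul_of_tsupport_subset hfc hξ' hc.deriv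
      ((tsupport_deriv_subset' ξ).trans hs)
  have i2 := integrable_smul_of_tsupport_subset hf' hξ.continuous hc hs
  have i3 := integrable_smul_of_tsupport_subset hfc hξ.continuous hc hs
  have hd : ∀ x, HasDerivAt (fun x => ξ x • f x) (deriv ξ x • f x + ξ x • f' x) x := by
    intro x
    by_cases hx : x ∈ tsupport ξ
    · have h1 := (hξ.differentiable (by simp) x).hasDerivAt.smul (hf x (hs hx))
      rw [add_comm] at h1
      exact h1
    · have hz := notMem_tsupport_iff_eventuallyEq.mp hx
      have h1 : (fun x => ξ x • f x) =ᶠ[𝓝 x] fun _ => 0 := by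
        filter_upwards [hz] with y hy
        simp [hy]
      have h2 : ξ x = 0 := hz.self_of_nhds
      have h3 : deriv ξ x = 0 := by rw [hz.deriv_eq]; simp
      simpa [h2, h3] using (hasDerivAt_const x (0 : ℂ)).congr_of_eventuallyEq h1
  have := integral_eq_zero_of_hasDerivAt_of_integrable hd (i1.add i2) i3
  rw [integral_add i1 i2] at this
  linear_combination this

/-- A continuous function is determined by its integrals against test functions. -/
lemma eq_zero_of_integral_smul {a b : ℝ} {f : ℝ → ℂ} (hf : ContinuousOn f (Ioo a b))
    (h : ∀ ξ : ℝ → ℝ, ContDiff ℝ ∞ ξ → HasCompactSupport ξ → tsupport ξ ⊆ Ioo a b →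
      ∫ x, ξ x • f x = 0) : ∀ x ∈ Ioo a b, f x = 0 := by
  have hae := isOpen_Ioo.ae_eq_zero_of_integral_contDiff_smul_eq_zero (μ := volume)
    (hf.locallyIntegrableOn measurableSet_Ioo) h
  have : EqOn f (fun _ => 0) (Ioo a b) := by
    refine Measure.eqOn_open_of_ae_eq (μ := volume) ?_ isOpen_Ioo hf continuousOn_const
    exact (ae_restrict_iff' measurableSet_Ioo).2 hae
  exact this

lemma exists_test_integral_one {a b : ℝ} (hab : a < b) : ∃ θ : ℝ → ℝ, ContDiff ℝ ∞ θ ∧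
    HasCompactSupport θ ∧ tsupport θ ⊆ Ioo a b ∧ ∫ x, θ x = 1 ∧ ∀ x, 0 ≤ θ x := by
  let B : ContDiffBump ((a + b) / 2) := ⟨(b - a) / 8, (b - a) / 4, by linarith, by linarith⟩
  refine ⟨B.normed volume, B.contDiff_normed, B.hasCompactSupport_normed, ?_, B.integral_normed,
    fun x => B.nonneg_normed x⟩
  rw [B.tsupport_normed_eq, Real.closedBall_eq_Icc]
  intro x hx
  have h1 := hx.1
  have h2 := hx.2
  simp only [B] at h1 h2
  constructor <;> linarith

lemma exists_test_of_integral_eq_zero {a b : ℝ} (hab : a < b) {ψ : ℝ → ℝ} (hψ : ContDiff ℝ ∞ ψ)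
    (hc : HasCompactSupport ψ) (hs : tsupport ψ ⊆ Ioo a b) (h0 : ∫ x, ψ x = 0) :
    ∃ ξ : ℝ → ℝ, ContDiff ℝ ∞ ξ ∧ HasCompactSupport ξ ∧ tsupport ξ ⊆ Ioo a b ∧ deriv ξ = ψ := by
  obtain ⟨a', b', h1, h2, h3, h4⟩ := exists_Icc_of_tsupport_subset hab hc hs
  obtain ⟨ξ, k1, k2, k3, k4⟩ := exists_primitive hψ h4 h2
  have hsub : tsupport ξ ⊆ Icc a' b' := by
    refine closure_minimal (fun x hx => ?_) isClosed_Icc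
    by_contra hn
    rw [mem_Icc, not_and_or, not_le, not_le] at hn
    rcases hn with hn | hn
    · exact hx (k3 x hn.le)
    · exact hx ((k4 x hn.le).trans h0)
  exact ⟨ξ, k1, isCompact_Icc.of_isClosed_subset (isClosed_tsupport ξ) hsub,
    hsub.trans (Icc_subset_Ioo h1 h3), funext fun x => (k2 x).deriv⟩

/-- The du Bois-Reymond lemma. -/
lemma eq_const_of_integral_deriv_smul {a b : ℝ} {z : ℝ → ℂ} (hz : ContinuousOn z (Ioo a b))
    (h : ∀ ξ : ℝ → ℝ, ContDiff ℝ ∞ ξ → HasCompactSupport ξ → tsupport ξ ⊆ Ioo a b →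
      ∫ x, deriv ξ x • z x = 0) : ∃ C, ∀ x ∈ Ioo a b, z x = C := by
  rcases le_or_gt b a with hab | hab
  · exact ⟨0, fun x hx => absurd (hx.1.trans hx.2) (not_lt.2 hab)⟩
  obtain ⟨θ, t1, t2, t3, t4, -⟩ := exists_test_integral_one hab
  refine ⟨∫ x, θ x • z x, fun x hx => sub_eq_zero.1 ?_⟩
  refine eq_zero_of_integral_smul (f := fun x => z x - ∫ x, θ x • z x)
    (hz.sub continuousOn_const) (fun ψ p1 p2 p3 => ?_) x hx
  have i1 := integrable_smul_of_tsupport_subset hz p1.continuous p2 p3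
  have i2 := integrable_smul_of_tsupport_subset hz t1.continuous t2 t3
  have hψi := p1.continuous.integrable_of_hasCompactSupport p2 (μ := volume)
  have hθi := t1.continuous.integrable_of_hasCompactSupport t2 (μ := volume)
  obtain ⟨ξ, k1, k2, k3, k4⟩ := exists_test_of_integral_eq_zero hab
    (ψ := fun x => ψ x - (∫ t, ψ t) * θ x) (p1.sub (contDiff_const.mul t1))
    (p2.sub t2.mul_left) ((tsupport_sub _ _).trans (union_subset p3
      ((tsupport_mul_subset_right).trans t3))) (by
      rw [integral_sub hψi (hθi.const_mul _), integral_const_mul, t4]; ring)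
  have := h ξ k1 k2 k3
  have i3 : Integrable fun x => (∫ t, ψ t) • θ x • z x := i2.smul (∫ t, ψ t)
  rw [k4] at this
  simp only [sub_smul, mul_smul] at this
  rw [integral_sub i1 i3, integral_smul] at this
  simp only [smul_sub]
  rw [integral_sub i1 (hψi.smul_const _), integral_smul_const]
  exact this

lemma eq_affine_of_integral_deriv_deriv_smul {a b : ℝ} {z : ℝ → ℂ} (hz : ContinuousOn z (Ioo a b))
    (h : ∀ ξ : ℝ → ℝ, ContDiff ℝ ∞ ξ → HasCompactSupport ξ → tsupport ξ ⊆ Ioo a b →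
      ∫ x, deriv (deriv ξ) x • z x = 0) : ∃ A B : ℂ, ∀ x ∈ Ioo a b, z x = A + B * x := by
  rcases le_or_gt b a with hab | hab
  · exact ⟨0, 0, fun x hx => absurd (hx.1.trans hx.2) (not_lt.2 hab)⟩
  obtain ⟨θ, t1, t2, t3, t4, -⟩ := exists_test_integral_one hab
  set C := ∫ x, deriv θ x • z x with hC
  have hcx : ContinuousOn (fun x : ℝ => C * (x : ℂ)) (Ioo a b) := by fun_prop
  suffices key : ∀ ξ : ℝ → ℝ, ContDiff ℝ ∞ ξ → HasCompactSupport ξ → tsupport ξ ⊆ Ioo a b →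
      ∫ x, deriv ξ x • (z x + C * x) = 0 by
    obtain ⟨A, hA⟩ := eq_const_of_integral_deriv_smul (z := fun x => z x + C * x) (hz.add hcx) key
    exact ⟨A, -C, fun x hx => by rw [← hA x hx]; ring⟩
  intro ψ p1 p2 p3
  have p1' : ContDiff ℝ ∞ (deriv ψ) := (contDiff_infty_iff_deriv.1 p1).2
  have t1' : ContDiff ℝ ∞ (deriv θ) := (contDiff_infty_iff_deriv.1 t1).2
  have i1 := integrable_smul_of_tsupport_subset hz p1'.continuous p2.deriv
    ((tsupport_deriv_subset' _).trans p3)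
  have i1' := integrable_smul_of_tsupport_subset hcx p1'.continuous p2.deriv
    ((tsupport_deriv_subset' _).trans p3)
  have i2 := integrable_smul_of_tsupport_subset hz t1'.continuous t2.deriv
    ((tsupport_deriv_subset' _).trans t3)
  have hψi := p1.continuous.integrable_of_hasCompactSupport p2 (μ := volume)
  have hθi := t1.continuous.integrable_of_hasCompactSupport t2 (μ := volume)
  obtain ⟨ξ, k1, k2, k3, k4⟩ := exists_test_of_integral_eq_zero hab
    (ψ := fun x => ψ x - (∫ t, ψ t) * θ x) (p1.sub (contDiff_const.mul t1))
    (p2.sub t2.mul_left) ((tsupport_sub _ _).trans (union_subset p3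
      ((tsupport_mul_subset_right).trans t3))) (by
      rw [integral_sub hψi (hθi.const_mul _), integral_const_mul, t4]; ring)
  have h1 := h ξ k1 k2 k3
  have h2 : deriv (deriv ξ) = fun x => deriv ψ x - (∫ t, ψ t) * deriv θ x := by
    rw [k4]
    funext x
    exact ((p1.differentiable (by simp) x).hasDerivAt.sub
      ((t1.differentiable (by simp) x).hasDerivAt.const_mul _)).deriv
  rw [h2] at h1
  simp only [sub_smul, mul_smul] at h1
  have i3 : Integrable fun x => (∫ t, ψ t) • deriv θ x • z x := i2.smul (∫ t, ψ t)
  rw [integral_sub i1 i3, integral_smul, ← hC] at h1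
  have h3 := integral_deriv_smul (f := fun x : ℝ => C * (x : ℂ)) (f' := fun _ => C) (fun x _ => by
    simpa using (hasDerivAt_id x).ofReal_comp.const_mul C) continuousOn_const p1 p2 p3
  rw [integral_smul_const] at h3
  simp only [smul_add]
  rw [integral_add i1 i1', h3]
  linear_combination h1

/-- A continuous weak solution of `y'' = -g` is a classical one. -/
lemma hasDerivAt_of_weak {a b : ℝ} {y g : ℝ → ℂ} (hy : ContinuousOn y (Ioo a b))
    (hg : ContinuousOn g (Ioo a b))
    (h : ∀ ξ : ℝ → ℝ, ContDiff ℝ ∞ ξ → HasCompactSupport ξ → tsupport ξ ⊆ Ioo a b →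
      ∫ x, (deriv (deriv ξ) x • y x + ξ x • g x) = 0) :
    ∀ r ∈ Ioo a b, HasDerivAt y (deriv y r) r ∧ HasDerivAt (deriv y) (-g r) r := by
  intro c hc
  have prim : ∀ {f : ℝ → ℂ}, ContinuousOn f (Ioo a b) → ∀ s ∈ Ioo a b,
      HasDerivAt (fun s => ∫ t in c..s, f t) (f s) s := by
    intro f hf s hs
    have hsub : uIcc c s ⊆ Ioo a b := (ordConnected_Ioo.uIcc_subset hc hs)
    exact intervalIntegral.integral_hasDerivAt_right ((hf.mono hsub).intervalIntegrable)
      (hf.stronglyMeasurableAtFilter isOpen_Ioo s hs) (hf.continuousAt (isOpen_Ioo.mem_nhds hs))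
  set G := fun s => ∫ t in c..s, g t with hG
  set Z := fun s => ∫ t in c..s, G t with hZ
  have dG := prim hg
  have hGc : ContinuousOn G (Ioo a b) := fun x hx => (dG x hx).continuousAt.continuousWithinAt
  have dZ := prim hGc
  have hZc : ContinuousOn Z (Ioo a b) := fun x hx => (dZ x hx).continuousAt.continuousWithinAt
  obtain ⟨A, B, hAB⟩ := eq_affine_of_integral_deriv_deriv_smul (z := fun x => y x + Z x)
    (hy.add hZc) (fun ξ p1 p2 p3 => by
      have p1' : ContDiff ℝ ∞ (deriv ξ) := (contDiff_infty_iff_deriv.1 p1).2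
      have p1'' : ContDiff ℝ ∞ (deriv (deriv ξ)) := (contDiff_infty_iff_deriv.1 p1').2
      have s1 := (tsupport_deriv_subset' ξ).trans p3
      have s2 := (tsupport_deriv_subset' _).trans s1
      have i1 := integrable_smul_of_tsupport_subset hy p1''.continuous p2.deriv.deriv s2
      have i2 := integrable_smul_of_tsupport_subset hZc p1''.continuous p2.deriv.deriv s2
      have i3 := integrable_smul_of_tsupport_subset hg p1.continuous p2 p3
      have h0 := h ξ p1 p2 p3
      rw [integral_add i1 i3] at h0
      simp only [smul_add]
      rw [integral_add i1 i2, integral_deriv_smul dZ hGc p1' p2.deriv s1,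
        integral_deriv_smul dG hg p1 p2 p3, neg_neg]
      exact h0)
  have dy : ∀ s ∈ Ioo a b, HasDerivAt y (B - G s) s := by
    intro s hs
    have h1 : HasDerivAt (fun x : ℝ => A + B * (x : ℂ) - Z x) (B - G s) s := by
      have := (((hasDerivAt_id s).ofReal_comp.const_mul B).const_add A).fun_sub (dZ s hs)
      simpa using this
    refine h1.congr_of_eventuallyEq ?_
    filter_upwards [isOpen_Ioo.mem_nhds hs] with x hx
    rw [← hAB x hx]; ring
  have hd : deriv y =ᶠ[𝓝 c] fun s => B - G s := by
    filter_upwards [isOpen_Ioo.mem_nhds hc] with x hx using (dy x hx).deriv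
  refine ⟨(dy c hc).differentiableAt.hasDerivAt, ?_⟩
  exact ((dG c hc).const_sub B).congr_of_eventuallyEq hd

/-- Uniqueness of the Cauchy problem for `y'' = -q y`. -/
lemma eq_zero_of_hasDerivAt {a b r₀ : ℝ} {y y' : ℝ → ℂ} {q : ℝ → ℝ} (hq : ContinuousOn q (Ioo a b))
    (h1 : ∀ r ∈ Ioo a b, HasDerivAt y (y' r) r)
    (h2 : ∀ r ∈ Ioo a b, HasDerivAt y' (-(q r * y r)) r) (hr₀ : r₀ ∈ Ioo a b)
    (hy : y r₀ = 0) (hy' : y' r₀ = 0) : ∀ r ∈ Ioo a b, y r = 0 := by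
  intro r hr
  obtain ⟨c, hac, hc⟩ := exists_between (lt_min hr₀.1 hr.1)
  obtain ⟨d, hd, hdb⟩ := exists_between (max_lt hr₀.2 hr.2)
  have hsub : Icc c d ⊆ Ioo a b := Icc_subset_Ioo hac hdb
  obtain ⟨K, hK⟩ := isCompact_Icc.exists_bound_of_continuousOn (hq.mono hsub)
  have hv : ∀ t ∈ Ioo c d, LipschitzOnWith (max 1 K.toNNReal)
      (fun p : ℂ × ℂ => (p.2, -((q t : ℂ) * p.1))) univ := by
    intro t ht
    refine (LipschitzWith.prodMk LipschitzWith.prod_snd ?_).lipschitzOnWith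
    refine LipschitzWith.of_dist_le_mul fun p p' => ?_
    rw [dist_neg_neg, dist_eq_norm, ← mul_sub, norm_mul, Complex.norm_real]
    have h1 := hK t (Ioo_subset_Icc_self ht)
    have h2 : ‖p.1 - p'.1‖ ≤ dist p p' := by
      rw [← dist_eq_norm]; exact le_max_left _ _
    calc ‖q t‖ * ‖p.1 - p'.1‖ ≤ K * dist p p' := by
          gcongr
          exact (norm_nonneg _).trans h1
      _ ≤ K.toNNReal * dist p p' := by gcongr; exact Real.le_coe_toNNReal K
  have := ODE_solution_unique_of_mem_Ioo (f := fun t => (y t, y' t)) (g := fun _ => (0, 0)) hv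
    (t₀ := r₀) ⟨hc.trans_le (min_le_left _ _), (le_max_left _ _).trans_lt hd⟩
    (fun t ht => ⟨(h1 t (hsub (Ioo_subset_Icc_self ht))).prodMk
      (h2 t (hsub (Ioo_subset_Icc_self ht))), mem_univ _⟩)
    (fun t ht => ⟨(hasDerivAt_const t ((0 : ℂ), (0 : ℂ))).congr_deriv (by simp [Prod.ext_iff]),
        mem_univ _⟩)
    (by simp [hy, hy'])
  have h3 := this (x := r) ⟨hc.trans_le (min_le_right _ _), (le_max_right _ _).trans_lt hd⟩
  exact congrArg Prod.fst h3

/-- A solution of `y'' + (k² - c/r²) y = 0` on a half-line that tends to zero vanishes: the energy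
`|y'|² + (k² - c/r²)|y|²` is nondecreasing and tends to zero. -/
lemma eq_zero_of_tendsto_zero {R k c : ℝ} (hR : 0 ≤ R) (hk : 0 < k) (hc : 0 ≤ c) {y y' : ℝ → ℂ}
    (h1 : ∀ r, R < r → HasDerivAt y (y' r) r)
    (h2 : ∀ r, R < r → HasDerivAt y' (-(((k ^ 2 - c / r ^ 2 : ℝ) : ℂ) * y r)) r)
    (hy : Tendsto y atTop (𝓝 0)) : ∀ r, R < r → y r = 0 := by
  set q : ℝ → ℝ := fun r => k ^ 2 - c / r ^ 2 with hq
  have hq' : ∀ r, R < r → HasDerivAt q (2 * c / r ^ 3) r := by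
    intro r hr
    have hr0 : r ≠ 0 := (hR.trans_lt hr).ne'
    have := ((hasDerivAt_pow 2 r).fun_inv (pow_ne_zero 2 hr0)).const_mul c |>.const_sub (k ^ 2)
    refine this.congr_deriv ?_
    simp only [Nat.cast_ofNat, Nat.add_one_sub_one, pow_one]
    field_simp
  set E : ℝ → ℝ := fun r => ‖y' r‖ ^ 2 + q r * ‖y r‖ ^ 2 with hE
  have hE' : ∀ r, R < r → HasDerivAt E (2 * c / r ^ 3 * ‖y r‖ ^ 2) r := by
    intro r hr
    have := ((h2 r hr).norm_sq).add ((hq' r hr).mul (h1 r hr).norm_sq)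
    refine this.congr_deriv ?_
    have e1 : -((q r : ℂ) * y r) = (-q r) • y r := by
      rw [Complex.real_smul]; push_cast; ring
    change 2 * inner ℝ (y' r) (-((q r : ℂ) * y r)) + _ = _
    rw [e1, real_inner_smul_right, real_inner_comm (y r) (y' r)]
    ring
  have hmono : MonotoneOn E (Ioi R) := by
    refine monotoneOn_of_deriv_nonneg (convex_Ioi R)
      (fun r hr => (hE' r hr).continuousAt.continuousWithinAt) ?_ ?_
    · intro r hr
      rw [interior_Ioi] at hr
      exact (hE' r hr).differentiableAt.differentiableWithinAt
    · intro r hr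
      rw [interior_Ioi] at hr
      rw [(hE' r hr).deriv]
      have : 0 < r := hR.trans_lt hr
      positivity
  have hqle : ∀ r, 1 ≤ r → |q r| ≤ k ^ 2 + c := by
    intro r hr
    have h3 : c / r ^ 2 ≤ c := div_le_self hc (one_le_pow₀ hr)
    have h4 : 0 ≤ c / r ^ 2 := by positivity
    rw [abs_le]
    constructor <;> simp only [hq] <;> nlinarith [sq_nonneg k]
  -- by Taylor's formula `y'` is controlled by `y` and `y''` on an interval of length one
  have hy'0 : Tendsto y' atTop (𝓝 0) := by
    rw [Metric.tendsto_atTop] at hy ⊢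
    intro ε hε
    have hM : 0 < 2 + (k ^ 2 + c) := by positivity
    obtain ⟨N, hN⟩ := hy (ε / (2 + (k ^ 2 + c)) / 2) (by positivity)
    set δ := ε / (2 + (k ^ 2 + c)) / 2 with hδ
    refine ⟨max N (max (R + 1) 1), fun r hr => ?_⟩
    have hrN : N ≤ r := (le_max_left _ _).trans hr
    have hrR : R < r := by
      have : R + 1 ≤ r := ((le_max_left _ _).trans (le_max_right _ _)).trans hr
      linarith
    have hr1 : 1 ≤ r := ((le_max_right _ _).trans (le_max_right _ _)).trans hr
    have hyb : ∀ s, r ≤ s → ‖y s‖ ≤ δ := fun s hs => by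
      have := hN s (hrN.trans hs)
      rw [dist_zero_right] at this
      exact this.le
    have hy''b : ∀ s, r ≤ s → ‖-((q s : ℂ) * y s)‖ ≤ (k ^ 2 + c) * δ := fun s hs => by
      rw [norm_neg, norm_mul, Complex.norm_real, Real.norm_eq_abs]
      exact mul_le_mul (hqle s (hr1.trans hs)) (hyb s hs) (norm_nonneg _) (by positivity)
    have step1 : ∀ s ∈ Icc r (r + 1), ‖y' s - y' r‖ ≤ (k ^ 2 + c) * δ := by
      intro s hs
      have := norm_image_sub_le_of_norm_deriv_le_segment' (f := y') (a := r) (b := r + 1)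
        (C := (k ^ 2 + c) * δ)
        (fun t ht => (h2 t (hrR.trans_le ht.1)).hasDerivWithinAt)
        (fun t ht => hy''b t ht.1) s hs
      refine this.trans ?_
      have : 0 ≤ (k ^ 2 + c) * δ := by positivity
      nlinarith [hs.1, hs.2]
    have step2 := norm_image_sub_le_of_norm_deriv_le_segment' (f := fun s : ℝ => y s - s * y' r)
      (f' := fun s => y' s - y' r)
      (a := r) (b := r + 1) (C := (k ^ 2 + c) * δ)
      (fun t ht => by
        have := ((h1 t (hrR.trans_le ht.1)).fun_sub
          (((hasDerivAt_id t).ofReal_comp).mul_const (y' r)))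
        simpa using this.hasDerivWithinAt)
      (fun t ht => step1 t (Ico_subset_Icc_self ht)) (r + 1) ⟨by linarith, le_rfl⟩
    have e : y' r = y (r + 1) - y r - (y (r + 1) -
        ((r + 1 : ℝ) : ℂ) * y' r - (y r - r * y' r)) := by
      push_cast; ring
    rw [dist_zero_right, e]
    calc _ ≤ ‖y (r + 1)‖ + ‖y r‖ + (k ^ 2 + c) * δ := by
          refine (norm_sub_le _ _).trans (add_le_add (norm_sub_le _ _) ?_)
          simpa using step2
      _ ≤ δ + δ + (k ^ 2 + c) * δ :=
          add_le_add (add_le_add (hyb _ (by linarith)) (hyb _ le_rfl)) le_rfl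
      _ = (2 + (k ^ 2 + c)) * δ := by ring
      _ = ε / 2 := by rw [hδ]; field_simp
      _ < ε := by linarith
  have hE0 : Tendsto E atTop (𝓝 0) := by
    have hb : Tendsto (fun r => q r * ‖y r‖ ^ 2) atTop (𝓝 0) := by
      have hb1 : IsBoundedUnder (· ≤ ·) atTop (norm ∘ q) :=
        isBoundedUnder_of_eventually_le (a := k ^ 2 + c)
          (by filter_upwards [eventually_ge_atTop 1] with r hr using hqle r hr)
      have hb2 : Tendsto (fun r => ‖y r‖ ^ 2) atTop (𝓝 0) := by
        simpa using (hy.norm).pow 2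
      simpa [mul_comm] using hb2.zero_mul_isBoundedUnder_le hb1
    simpa using ((hy'0.norm).pow 2).add hb
  have hEle : ∀ r, R < r → E r ≤ 0 := by
    intro r hr
    refine ge_of_tendsto hE0 ?_
    filter_upwards [eventually_ge_atTop r] with s hs
    exact hmono hr (hr.trans_le hs) hs
  obtain ⟨r₁, hr₁, hq₁⟩ : ∃ r₁, R < r₁ ∧ 0 < q r₁ := by
    have : Tendsto q atTop (𝓝 (k ^ 2 - 0)) := by
      refine tendsto_const_nhds.sub ?_
      exact tendsto_const_nhds.div_atTop (tendsto_pow_atTop (by norm_num))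
    have h3 := this.eventually (lt_mem_nhds (show (0 : ℝ) < k ^ 2 - 0 by rw [sub_zero]; positivity))
    obtain ⟨r₁, h4, h5⟩ := (h3.and (eventually_gt_atTop R)).exists
    exact ⟨r₁, h5, h4⟩
  have hz := hEle r₁ hr₁
  have hz1 : ‖y' r₁‖ ^ 2 = 0 := by
    have := mul_nonneg hq₁.le (sq_nonneg ‖y r₁‖)
    have := sq_nonneg ‖y' r₁‖
    simp only [hE] at hz
    linarith
  have hz2 : ‖y r₁‖ ^ 2 = 0 := by
    simp only [hE, hz1, zero_add] at hz
    have := sq_nonneg ‖y r₁‖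
    by_contra hne
    have := mul_pos hq₁ (lt_of_le_of_ne this (Ne.symm hne))
    linarith
  intro r hr
  refine eq_zero_of_hasDerivAt (a := R) (b := max r r₁ + 1) (q := q)
    (fun s hs => (hq' s hs.1).continuousAt.continuousWithinAt)
    (fun s hs => h1 s hs.1) (fun s hs => h2 s hs.1) (r₀ := r₁)
    ⟨hr₁, by linarith [le_max_right r r₁]⟩ (by simpa using hz2) (by simpa using hz1) r
    ⟨hr, by linarith [le_max_left r r₁]⟩

/-! ### Spherical moments -/

/-- The open spherical shell with radii `a` and `b` about the origin. -/
def shell (a b : ℝ) : Set Space := {x | ‖x‖ ∈ Ioo a b}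

lemma isOpen_shell (a b : ℝ) : IsOpen (shell a b) := isOpen_Ioo.preimage continuous_norm

lemma smul_mem_shell {a b r : ℝ} (ha : 0 ≤ a) (hr : r ∈ Ioo a b) (θ : sphere (0 : Space) 1) :
    r • (θ : Space) ∈ shell a b := by
  have : ‖(θ : Space)‖ = 1 := by simp
  change ‖r • (θ : Space)‖ ∈ Ioo a b
  rwa [norm_smul, this, mul_one, Real.norm_of_nonneg (ha.trans hr.1.le)]

/-- The moment of `v` against `P` over the sphere of radius `r`. -/
def mom (v P : Space → ℂ) (r : ℝ) : ℂ := ∫ θ, v (r • (θ : Space)) * P θ ∂sph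

lemma continuousOn_sphere_smul {F : Type*} [NormedAddCommGroup F] {a b : ℝ} (ha : 0 ≤ a)
    {v : Space → F} (hv : ContinuousOn v (shell a b)) {r : ℝ} (hr : r ∈ Ioo a b) :
    Continuous fun θ : sphere (0 : Space) 1 => v (r • (θ : Space)) :=
  hv.comp_continuous (by fun_prop) (smul_mem_shell ha hr)

lemma continuousOn_integral_sphere {F : Type*} [NormedAddCommGroup F] [NormedSpace ℝ F] {a b : ℝ}
    (ha : 0 ≤ a) {f : Space → F} {Q : sphere (0 : Space) 1 → F → F}
    (hQ : Continuous (Function.uncurry Q)) (hf : ContinuousOn f (shell a b)) :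
    ContinuousOn (fun r : ℝ => ∫ θ, Q θ (f (r • (θ : Space))) ∂sph) (Ioo a b) := by
  refine continuousOn_integral_of_compact_support (k := univ) isCompact_univ ?_ (by simp)
  refine hQ.comp_continuousOn (f := fun p : ℝ × sphere (0 : Space) 1 =>
    (p.2, f (p.1 • (p.2 : Space)))) (ContinuousOn.prodMk continuousOn_snd ?_)
  exact hf.comp (by fun_prop) fun p hp => smul_mem_shell ha hp.1 p.2

lemma continuousOn_mom {a b : ℝ} (ha : 0 ≤ a) {v P : Space → ℂ} (hv : ContinuousOn v (shell a b))
    (hP : Continuous P) : ContinuousOn (mom v P) (Ioo a b) :=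
  continuousOn_integral_sphere ha (Q := fun θ z => z * P θ) (by fun_prop) hv

lemma integrable_sphere {F : Type*} [NormedAddCommGroup F] {f : sphere (0 : Space) 1 → F}
    (hf : Continuous f) : Integrable f sph :=
  hf.integrable_of_hasCompactSupport (HasCompactSupport.of_compactSpace f)

/-- A radial profile supported in an interval, times a smooth function, is a test function. -/
lemma radial_test {a b : ℝ} (ha : 0 ≤ a) {G : ℝ → ℝ} {P : Space → ℂ} (hP : ContDiff ℝ ∞ P)
    (hG : ∀ s, 0 < s → ContDiffAt ℝ ∞ G s) (hs : tsupport G ⊆ Ioo a b) :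
    ContDiff ℝ ∞ (fun x : Space => (G ‖x‖ : ℂ) * P x) ∧
      HasCompactSupport (fun x : Space => (G ‖x‖ : ℂ) * P x) ∧
      tsupport (fun x : Space => (G ‖x‖ : ℂ) * P x) ⊆ shell a b := by
  have hsub : tsupport (fun x : Space => (G ‖x‖ : ℂ) * P x) ⊆ {x | ‖x‖ ∈ tsupport G} := by
    refine closure_minimal (fun x hx => ?_) ((isClosed_tsupport G).preimage continuous_norm)
    by_contra hn
    exact hx (by simp [image_eq_zero_of_notMem_tsupport hn])
  refine ⟨?_, ?_, fun x hx => hs (hsub hx)⟩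
  · rw [contDiff_iff_contDiffAt]
    intro x
    by_cases hx : ‖x‖ ∈ tsupport G
    · have hx0 : 0 < ‖x‖ := ha.trans_lt (hs hx).1
      have h1 : ContDiffAt ℝ ∞ (fun x : Space => G ‖x‖) x :=
        (hG _ hx0).comp x (contDiffAt_norm ℝ (norm_pos_iff.1 hx0))
      exact (Complex.ofRealCLM.contDiff.contDiffAt.comp x h1).mul hP.contDiffAt
    · have : (fun x : Space => (G ‖x‖ : ℂ) * P x) =ᶠ[𝓝 x] fun _ => 0 := by
        have := (continuous_norm.tendsto x).eventually (notMem_tsupport_iff_eventuallyEq.mp hx)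
        filter_upwards [this] with y hy
        simp [hy]
      exact contDiffAt_const.congr_of_eventuallyEq this
  · refine HasCompactSupport.intro (isCompact_closedBall (0 : Space) b) fun x hx => ?_
    by_contra hn
    have := (hs (hsub (subset_tsupport _ hn))).2
    exact hx (by simpa using this.le)

/-- The moments of a weak solution of the Helmholtz equation satisfy weakly the radial equation,
with the moment against the Laplacian of the polynomial as inhomogeneity. -/
lemma WeakHelm.moment_weak {k a b : ℝ} (ha : 0 ≤ a) {v : Space → ℂ} (hv : WeakHelm k (shell a b) v)
    {n : ℕ} {P : Space → ℂ} (hP : Homog n P) {ξ : ℝ → ℝ} (h1 : ContDiff ℝ ∞ ξ)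
    (h3 : tsupport ξ ⊆ Ioo a b) :
    ∫ r, (deriv (deriv ξ) r • (r * mom v P r) +
      ξ r • (((k ^ 2 - n * (n + 1) / r ^ 2 : ℝ) : ℂ) * (r * mom v P r) +
        r * mom v (lap P) r / r ^ 2)) = 0 := by
  have hξ' : ContDiff ℝ ∞ (deriv ξ) := (contDiff_infty_iff_deriv.1 h1).2
  have d1 : ∀ s, HasDerivAt ξ (deriv ξ s) s := fun s => (h1.differentiable (by simp) s).hasDerivAt
  have d2 : ∀ s, HasDerivAt (deriv ξ) (deriv (deriv ξ) s) s := fun s =>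
    (hξ'.differentiable (by simp) s).hasDerivAt
  -- the profile `ξ(s) s^{-n-1}` turns the radial Laplacian into `ξ'' - n(n+1) ξ / s²`
  set g : ℝ → ℝ := fun s => ξ s / s ^ (n + 1) with hg
  set g1 : ℝ → ℝ := fun s => deriv ξ s / s ^ (n + 1) - (n + 1) * ξ s / s ^ (n + 2) with hg1
  set g2 : ℝ → ℝ := fun s => deriv (deriv ξ) s / s ^ (n + 1) - 2 * (n + 1) * deriv ξ s / s ^ (n + 2)
    + (n + 1) * (n + 2) * ξ s / s ^ (n + 3) with hg2
  have dg : ∀ s, 0 < s → HasDerivAt g (g1 s) s := by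
    intro s hs
    refine ((d1 s).fun_div (hasDerivAt_pow (n + 1) s) (pow_ne_zero _ hs.ne')).congr_deriv ?_
    simp only [hg1, Nat.add_sub_cancel]
    push_cast
    field_simp
    ring
  have dg1 : ∀ s, 0 < s → HasDerivAt g1 (g2 s) s := by
    intro s hs
    refine (((d2 s).fun_div (hasDerivAt_pow (n + 1) s) (pow_ne_zero _ hs.ne')).fun_sub
      (((d1 s).const_mul ((n : ℝ) + 1)).fun_div (hasDerivAt_pow (n + 2) s)
        (pow_ne_zero _ hs.ne'))).congr_deriv ?_
    simp only [hg2, Nat.add_sub_cancel, show n + 2 - 1 = n + 1 by omega]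
    push_cast
    field_simp
    ring
  have hgs : tsupport g ⊆ Ioo a b := by
    have : Function.support g ⊆ Function.support ξ := fun s hs h => hs (by simp [hg, h])
    exact (closure_mono this).trans h3
  have hgc : ∀ s, 0 < s → ContDiffAt ℝ ∞ g s := fun s hs =>
    h1.contDiffAt.fun_div (contDiff_id.pow (n + 1)).contDiffAt (pow_ne_zero _ hs.ne')
  obtain ⟨t1, t2, t3⟩ := radial_test ha hP.contDiff hgc hgs
  set φ : Space → ℂ := fun x => (g ‖x‖ : ℂ) * P x with hφ
  have key := hv.weak φ t1 t2 t3
  have hlk : Continuous fun x => lap φ x + (k : ℂ) ^ 2 * φ x :=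
    (contDiff_lap t1).continuous.add (continuous_const.mul t1.continuous)
  have hcs : HasCompactSupport fun x => lap φ x + (k : ℂ) ^ 2 * φ x :=
    (hasCompactSupport_lap t2).add t2.mul_left
  have hts : tsupport (fun x => lap φ x + (k : ℂ) ^ 2 * φ x) ⊆ shell a b :=
    (tsupport_add _ _).trans (union_subset ((tsupport_lap_subset φ).trans t3)
      (tsupport_mul_subset_right.trans t3))
  rw [integral_polar (integrable_mul_of_tsupport_subset (isOpen_shell a b) hv.continuousOn
    hlk hcs hts)] at key
  have hzero : ∀ r, r ∉ Ioo a b → ξ r = 0 ∧ deriv (deriv ξ) r = 0 := fun r hr =>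
    ⟨image_eq_zero_of_notMem_tsupport fun h => hr (h3 h),
      image_eq_zero_of_notMem_tsupport fun h =>
        hr (h3 (tsupport_deriv_subset' _ (tsupport_deriv_subset' _ h)))⟩
  rw [← key, ← setIntegral_eq_integral_of_forall_compl_eq_zero (s := Ioi (0 : ℝ))]
  swap
  · intro r hr
    have := hzero r fun h => hr (ha.trans_lt h.1)
    simp [this.1, this.2]
  refine setIntegral_congr_fun measurableSet_Ioi fun r hr => ?_
  have hr0 : (0 : ℝ) < r := hr
  have hrc : (r : ℂ) ≠ 0 := by exact_mod_cast hr0.ne'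
  have hval : ∀ θ : sphere (0 : Space) 1,
      v (r • (θ : Space)) * (lap φ (r • (θ : Space)) + (k : ℂ) ^ 2 * φ (r • (θ : Space))) =
      ((g2 r + (2 * n + 2) * g1 r / r + k ^ 2 * g r : ℝ) : ℂ) * (r : ℂ) ^ n *
        (v (r • (θ : Space)) * P θ) +
      (g r : ℂ) * (r : ℂ) ^ n / (r : ℂ) ^ 2 * (v (r • (θ : Space)) * lap P θ) := by
    intro θ
    have hθ : ‖(θ : Space)‖ = 1 := by simp
    have hn : ‖r • (θ : Space)‖ = r := by
      rw [norm_smul, hθ, mul_one, Real.norm_of_nonneg hr0.le]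
    have hne : r • (θ : Space) ≠ 0 := norm_pos_iff.1 (by rw [hn]; exact hr0)
    have hφr : φ (r • (θ : Space)) = (g r : ℂ) * ((r : ℂ) ^ n * P θ) := by
      simp only [hφ, hn, hP.map_smul r θ hr0]
    rw [hφr, hφ, lap_radial_mul hP dg dg1 hne, hn, hP.map_smul r θ hr0]
    have h5 : lap P (r • (θ : Space)) = (r : ℂ) ^ n * lap P θ / (r : ℂ) ^ 2 := by
      rw [eq_div_iff (pow_ne_zero 2 hrc), mul_comm]
      exact hP.lap_smul r θ hr0
    rw [h5]
    push_cast
    ring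
  simp_rw [hval]
  by_cases hrab : r ∈ Ioo a b
  · have hvc := continuousOn_sphere_smul ha hv.continuousOn hrab
    have hPc : Continuous fun θ : sphere (0 : Space) 1 => P θ :=
      hP.contDiff.continuous.comp continuous_subtype_val
    have hPl : Continuous fun θ : sphere (0 : Space) 1 => lap P θ :=
      (contDiff_lap hP.contDiff).continuous.comp continuous_subtype_val
    have i1 : Integrable (fun θ : sphere (0 : Space) 1 => v (r • (θ : Space)) * P θ) sph :=
      integrable_sphere (hvc.mul hPc)
    have i2 : Integrable (fun θ : sphere (0 : Space) 1 => v (r • (θ : Space)) * lap P θ) sph :=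
      integrable_sphere (hvc.mul hPl)
    rw [integral_add (i1.const_mul _) (i2.const_mul _), integral_const_mul, integral_const_mul]
    simp only [mom, Complex.real_smul, hg, hg1, hg2]
    push_cast
    field_simp
    ring
  · have h6 := hzero r hrab
    have h7 : deriv ξ r = 0 := image_eq_zero_of_notMem_tsupport fun h =>
      hrab (h3 (tsupport_deriv_subset' _ h))
    simp [h6.1, h6.2, hg, hg1, hg2, h7]

/-- The radial equation for the moments of a weak solution of the Helmholtz equation. -/
lemma WeakHelm.moment_ode {k a b : ℝ} (ha : 0 ≤ a) {v : Space → ℂ} (hv : WeakHelm k (shell a b) v)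
    {n : ℕ} {P : Space → ℂ} (hP : Homog n P) (hl : ∀ r ∈ Ioo a b, mom v (lap P) r = 0)
    {y : ℝ → ℂ} (hy : y = fun r => r * mom v P r) :
    ∀ r ∈ Ioo a b, HasDerivAt y (deriv y r) r ∧
      HasDerivAt (deriv y) (-(((k ^ 2 - n * (n + 1) / r ^ 2 : ℝ) : ℂ) * y r)) r := by
  have hc := continuousOn_mom ha hv.continuousOn hP.contDiff.continuous
  have hyc : ContinuousOn y (Ioo a b) := by
    rw [hy]; exact Complex.continuous_ofReal.continuousOn.mul hc
  refine hasDerivAt_of_weak hyc (ContinuousOn.mul ?_ hyc) fun ξ h1 _ h3 => ?_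
  · refine Complex.continuous_ofReal.comp_continuousOn (continuousOn_const.sub ?_)
    exact continuousOn_const.div (continuousOn_pow 2) fun r hr =>
      pow_ne_zero 2 (ha.trans_lt hr.1).ne'
  · rw [← hv.moment_weak ha hP h1 h3]
    congr 1
    funext r
    by_cases hr : r ∈ Ioo a b
    · simp [hy, hl r hr]
    · have : ξ r = 0 := image_eq_zero_of_notMem_tsupport fun h => hr (h3 h)
      simp [hy, this]

/-- A continuous function on the sphere whose moments against all homogeneous polynomials vanish
is zero, by the Stone-Weierstrass theorem. -/
lemma eq_zero_of_moments {f : sphere (0 : Space) 1 → ℂ} (hf : Continuous f)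
    (h : ∀ n P, Homog n P → ∫ θ, f θ * P θ ∂sph = 0) (θ : sphere (0 : Space) 1) : f θ = 0 := by
  let X : Fin 3 → C(sphere (0 : Space) 1, ℝ) := fun i => ⟨fun θ => (θ : Space) i, by fun_prop⟩
  let A : Subalgebra ℝ C(sphere (0 : Space) 1, ℝ) := Algebra.adjoin ℝ (range X)
  have hsep : A.SeparatesPoints := by
    intro θ θ' hne
    obtain ⟨i, hi⟩ : ∃ i, (θ : Space) i ≠ (θ' : Space) i := by
      by_contra hcon
      push Not at hcon
      exact hne (Subtype.ext (PiLp.ext hcon))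
    exact ⟨X i, ⟨X i, Algebra.subset_adjoin (mem_range_self i), rfl⟩, hi⟩
  have hA := ContinuousMap.subalgebra_topologicalClosure_eq_top_of_separatesPoints A hsep
  have hint : ∀ g : C(sphere (0 : Space) 1, ℝ), Integrable (fun θ => f θ * (g θ : ℂ)) sph :=
    fun g => integrable_sphere (hf.mul (Complex.continuous_ofReal.comp g.continuous))
  have hmon : ∀ g ∈ Submonoid.closure (range X), ∃ n P, Homog n P ∧
      ∀ θ : sphere (0 : Space) 1, (g θ : ℂ) = P θ := by
    intro g hg
    induction hg using Submonoid.closure_induction with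
    | mem g hg =>
      obtain ⟨i, rfl⟩ := hg
      exact ⟨1, _, Homog.coord i, fun θ => rfl⟩
    | one => exact ⟨0, _, Homog.one, fun θ => by simp⟩
    | mul g g' _ _ hg hg' =>
      obtain ⟨n, P, h1, h2⟩ := hg
      obtain ⟨n', P', h1', h2'⟩ := hg'
      exact ⟨n + n', _, h1.mul h1', fun θ => by simp [h2, h2']⟩
  have hAz : ∀ g ∈ Submodule.span ℝ (Submonoid.closure (range X) : Set C(sphere (0 : Space) 1, ℝ)),
      ∫ θ, f θ * (g θ : ℂ) ∂sph = 0 := by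
    intro g hg
    induction hg using Submodule.span_induction with
    | mem g hg =>
      obtain ⟨n, P, h1, h2⟩ := hmon g hg
      simp_rw [h2]
      exact h n P h1
    | zero => simp
    | add g g' h1 h2 h3 h4 =>
      have e : ∀ θ, f θ * ((g + g') θ : ℝ) = f θ * (g θ : ℂ) + f θ * (g' θ : ℂ) := by
        intro θ; simp; ring
      simp_rw [e]
      rw [integral_add (hint g) (hint g'), h3, h4, add_zero]
    | smul c g h1 h2 =>
      have e : ∀ θ, f θ * ((c • g) θ : ℝ) = c * (f θ * (g θ : ℂ)) := by
        intro θ; simp; ring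
      simp_rw [e]
      rw [integral_const_mul, h2, mul_zero]
  have hall : ∀ g : C(sphere (0 : Space) 1, ℝ), ∫ θ, f θ * (g θ : ℂ) ∂sph = 0 := by
    have hlip : LipschitzWith (∫ θ, ‖f θ‖ ∂sph).toNNReal
        fun g : C(sphere (0 : Space) 1, ℝ) => ∫ θ, f θ * (g θ : ℂ) ∂sph := by
      refine LipschitzWith.of_dist_le_mul fun g g' => ?_
      rw [dist_eq_norm, ← integral_sub (hint g) (hint g'),
        Real.coe_toNNReal _ (integral_nonneg fun θ => norm_nonneg _), ← integral_mul_const]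
      refine norm_integral_le_of_norm_le ((integrable_sphere hf.norm).mul_const _)
        (Eventually.of_forall fun θ => ?_)
      rw [← mul_sub, norm_mul, ← Complex.ofReal_sub, Complex.norm_real]
      gcongr
      rw [← dist_eq_norm]
      exact ContinuousMap.dist_apply_le_dist θ
    have hcl := isClosed_eq hlip.continuous (continuous_const (y := (0 : ℂ)))
    intro g
    have hg : g ∈ A.topologicalClosure := by rw [hA]; trivial
    refine closure_minimal (fun g hg => ?_) hcl hg
    refine hAz g ?_
    rw [← Algebra.adjoin_eq_span]
    exact hg
  have hsq : ∫ θ, ‖f θ‖ ^ 2 ∂sph = 0 := by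
    have h1 := hall ⟨fun θ => (f θ).re, by fun_prop⟩
    have h2 := hall ⟨fun θ => (f θ).im, by fun_prop⟩
    have h3 : ∫ θ, f θ * (starRingEnd ℂ) (f θ) ∂sph = 0 := by
      have e : ∀ θ, f θ * (starRingEnd ℂ) (f θ) =
          f θ * ((f θ).re : ℂ) + (-Complex.I) * (f θ * ((f θ).im : ℂ)) := by
        intro θ
        have : (starRingEnd ℂ) (f θ) = ((f θ).re : ℂ) - Complex.I * ((f θ).im : ℂ) := by
          apply Complex.ext <;> simp
        rw [this]
        ring
      simp_rw [e]
      have i1 := hint ⟨fun θ => (f θ).re, by fun_prop⟩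
      have i2 := hint ⟨fun θ => (f θ).im, by fun_prop⟩
      simp only [ContinuousMap.coe_mk] at i1 i2 h1 h2
      rw [integral_add i1 (i2.const_mul _), integral_const_mul, h1, h2]
      simp
    have h4 : ∀ θ, f θ * (starRingEnd ℂ) (f θ) = ((‖f θ‖ ^ 2 : ℝ) : ℂ) := by
      intro θ
      rw [Complex.mul_conj, Complex.normSq_eq_norm_sq]
    simp_rw [h4] at h3
    rw [integral_complex_ofReal] at h3
    exact_mod_cast h3
  have hae : (fun θ => ‖f θ‖ ^ 2) =ᵐ[sph] 0 :=
    (integral_eq_zero_iff_of_nonneg (fun θ => by positivity)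
      (integrable_sphere (by fun_prop))).1 hsq
  have := (Continuous.ae_eq_iff_eq sph (by fun_prop) (by fun_prop)).1 hae
  simpa using congrFun this θ

/-! ### Unique continuation, Rellich's lemma and mean values -/

lemma exists_smul_sphere {x : Space} (hx : x ≠ 0) :
    ∃ θ : sphere (0 : Space) 1, x = ‖x‖ • (θ : Space) := by
  have h : ‖x‖ ≠ 0 := norm_ne_zero_iff.2 hx
  exact ⟨⟨‖x‖⁻¹ • x, by simp [norm_smul, h]⟩, by simp [smul_smul, h]⟩

/-- If the radial equation forces every moment to vanish, then the solution vanishes: induction on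
the degree of the polynomial, as the Laplacian lowers the degree. -/
lemma WeakHelm.eq_zero_of_moments {k a : ℝ} (ha : 0 ≤ a) {I : Set ℝ}
    (hI : ∀ r ∈ I, ∃ b, r ∈ Ioo a b ∧ Ioo a b ⊆ I) {v : Space → ℂ}
    (hv : WeakHelm k {x | ‖x‖ ∈ I} v)
    (H : ∀ (n : ℕ) (P : Space → ℂ) (y : ℝ → ℂ), Homog n P → (y = fun r => r * mom v P r) →
      (∀ r ∈ I, HasDerivAt y (deriv y r) r ∧
        HasDerivAt (deriv y) (-(((k ^ 2 - n * (n + 1) / r ^ 2 : ℝ) : ℂ) * y r)) r) →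
      ∀ r ∈ I, y r = 0) {x : Space} (hx : ‖x‖ ∈ I) : v x = 0 := by
  have hpos : ∀ r ∈ I, 0 < r := fun r hr => by
    obtain ⟨b, hb, -⟩ := hI r hr
    exact ha.trans_lt hb.1
  have key : ∀ n P, Homog n P → ∀ r ∈ I, mom v P r = 0 := by
    intro n
    induction n using Nat.strong_induction_on with
    | _ n ih =>
      intro P hP r hr
      have hl : ∀ r ∈ I, mom v (lap P) r = 0 := by
        intro r hr
        rcases lt_or_ge n 2 with hn | hn
        · simp [mom, hP.lap_eq_zero hn]
        · obtain ⟨m, rfl⟩ := Nat.exists_eq_add_of_le' hn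
          exact ih m (by omega) _ hP.isHomog_lap r hr
      have := H n P _ hP rfl (fun s hs => by
        obtain ⟨b, hb, hbI⟩ := hI s hs
        exact (hv.mono (U := {x | ‖x‖ ∈ I}) (V := shell a b) fun x hx => hbI hx).moment_ode ha hP
          (fun t ht => hl t (hbI ht)) rfl s hb) r hr
      have hr0 : (r : ℂ) ≠ 0 := by exact_mod_cast (hpos r hr).ne'
      exact (mul_eq_zero.1 this).resolve_left hr0
  obtain ⟨θ, hθ⟩ := exists_smul_sphere (norm_pos_iff.1 (hpos _ hx))
  obtain ⟨b, hb, hbI⟩ := hI _ hx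
  have hc := continuousOn_sphere_smul ha
    (hv.continuousOn.mono (s := {x | ‖x‖ ∈ I}) (t := shell a b) fun x hx => hbI hx) hb
  have := ElasticScattering.eq_zero_of_moments hc (fun n P hP => key n P hP _ hx) θ
  rwa [← hθ] at this

/-- Continuation from a small ball to a concentric larger one: the moments have vanishing Cauchy
data at a small radius. -/
lemma WeakHelm.eq_zero_of_ball {k ρ ε : ℝ} {x₀ : Space} {v : Space → ℂ} (hε : 0 < ε)
    (hv : WeakHelm k (ball x₀ ρ) v) (h0 : ∀ x ∈ ball x₀ ε, v x = 0) : ∀ x ∈ ball x₀ ρ, v x = 0 := by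
  intro x hx
  have hρ : 0 < ρ := dist_nonneg.trans_lt hx
  rcases eq_or_ne x x₀ with rfl | hne
  · exact h0 x (mem_ball_self hε)
  have hw : WeakHelm k {z : Space | ‖z‖ ∈ Ioo 0 ρ} (fun y => v (y + x₀)) :=
    (hv.comp_add x₀).mono fun z hz => by simpa using hz.2
  have hz : ∀ r : ℝ, 0 ≤ r → r < ε → ∀ θ : sphere (0 : Space) 1, v (r • (θ : Space) + x₀) = 0 := by
    intro r hr0 hr θ
    refine h0 _ ?_
    have : ‖(θ : Space)‖ = 1 := by simp
    simpa [norm_smul, this, abs_of_nonneg hr0] using hr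
  have := hw.eq_zero_of_moments (x := x - x₀) le_rfl (fun r hr => ⟨ρ, hr, subset_rfl⟩)
    (fun n P y hP hy hode r hr => ?_) ⟨norm_pos_iff.2 (sub_ne_zero.2 hne), by
      simpa [dist_eq_norm] using hx⟩
  on_goal 1 => simpa using this
  have hloc : ∀ s ∈ Ioo 0 ε, y s = 0 := by
    intro s hs
    simp [hy, mom, hz s hs.1.le hs.2]
  obtain ⟨r₀, h1, h2⟩ := exists_between (lt_min hε hρ)
  have hr₀ : r₀ ∈ Ioo 0 ε := ⟨h1, h2.trans_le (min_le_left _ _)⟩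
  refine eq_zero_of_hasDerivAt (r₀ := r₀) (y' := deriv y)
    (q := fun r => k ^ 2 - n * (n + 1) / r ^ 2) ?_ (fun s hs => (hode s hs).1)
    (fun s hs => (hode s hs).2) ⟨h1, h2.trans_le (min_le_right _ _)⟩ (hloc _ hr₀) ?_ r hr
  · exact continuousOn_const.sub (continuousOn_const.div (continuousOn_pow 2) fun r hr =>
      pow_ne_zero 2 hr.1.ne')
  · have : y =ᶠ[𝓝 r₀] fun _ => 0 := by
      filter_upwards [isOpen_Ioo.mem_nhds hr₀] with s hs using hloc s hs
    rw [this.deriv_eq]; simp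

/-- Unique continuation for weak solutions of the Helmholtz equation. -/
lemma WeakHelm.eq_zero_of_isPreconnected {k : ℝ} {U V : Set Space} {v : Space → ℂ} (hU : IsOpen U)
    (hc : IsPreconnected U) (hv : WeakHelm k U v) (hV : IsOpen V) (hVU : V ⊆ U) (hVn : V.Nonempty)
    (h0 : ∀ x ∈ V, v x = 0) : ∀ x ∈ U, v x = 0 := by
  have hsub : U ⊆ interior {x | v x = 0} := by
    refine hc.subset_of_closure_inter_subset isOpen_interior ?_ ?_
    · obtain ⟨x, hx⟩ := hVn
      exact ⟨x, hVU hx, interior_maximal (fun y hy => h0 y hy) hV hx⟩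
    · rintro x ⟨hx, hxU⟩
      obtain ⟨ρ, hρ, hball⟩ := Metric.isOpen_iff.1 hU x hxU
      obtain ⟨z, hz, hzx⟩ := Metric.mem_closure_iff.1 hx (ρ / 2) (by positivity)
      obtain ⟨ε, hε, hεs⟩ := Metric.isOpen_iff.1 isOpen_interior z hz
      have hzero := (hv.mono (V := ball z (ρ / 2)) ((ball_subset_ball' (by
        rw [dist_comm]; linarith)).trans hball)).eq_zero_of_ball hε
        (fun y hy => (interior_subset (hεs hy) : y ∈ {x | v x = 0}))
      exact interior_maximal (fun y hy => hzero y hy) isOpen_ball (by simpa using hzx)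
  exact fun x hx => (interior_subset (hsub hx) : x ∈ {x | v x = 0})

/-- Rellich's lemma: a solution of the Helmholtz equation outside a ball whose means over large
spheres decay faster than the inverse of the radius vanishes. -/
lemma WeakHelm.eq_zero_of_rellich {k R : ℝ} (hk : 0 < k) (hR : 0 ≤ R) {v : Space → ℂ}
    (hv : WeakHelm k {x | R < ‖x‖} v)
    (hd : Tendsto (fun r : ℝ => r * ∫ θ, ‖v (r • (θ : Space))‖ ∂sph) atTop (𝓝 0)) :
    ∀ x, R < ‖x‖ → v x = 0 := by
  intro x hx
  refine WeakHelm.eq_zero_of_moments (I := Ioi R) hR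
    (fun r hr => ⟨r + 1, ⟨hr, by linarith⟩, fun s hs => hs.1⟩) hv
    (fun n P y hP hy hode => ?_) hx
  have hPc : Continuous fun θ : sphere (0 : Space) 1 => P θ :=
    hP.contDiff.continuous.comp continuous_subtype_val
  obtain ⟨M, hM⟩ := isCompact_univ.exists_bound_of_continuousOn hPc.continuousOn
  have hlim : Tendsto y atTop (𝓝 0) := by
    have hb := hd.const_mul M
    rw [mul_zero] at hb
    refine squeeze_zero_norm' ?_ hb
    filter_upwards [eventually_gt_atTop R] with r hr
    have hr0 : 0 ≤ r := hR.trans hr.le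
    have hc : Continuous fun θ : sphere (0 : Space) 1 => v (r • (θ : Space)) :=
      continuousOn_sphere_smul hR (hv.continuousOn.mono (s := {x | R < ‖x‖}) (t := shell R (r + 1))
        fun x hx => hx.1) ⟨hr, by linarith⟩
    have h1 : ‖mom v P r‖ ≤ ∫ θ, ‖v (r • (θ : Space))‖ * M ∂sph := by
      refine norm_integral_le_of_norm_le ((integrable_sphere hc.norm).mul_const _)
        (Eventually.of_forall fun θ => ?_)
      rw [norm_mul]
      gcongr
      exact hM θ (mem_univ _)
    rw [integral_mul_const] at h1
    rw [hy, norm_mul, Complex.norm_real, Real.norm_of_nonneg hr0]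
    calc r * ‖mom v P r‖ ≤ r * ((∫ θ, ‖v (r • (θ : Space))‖ ∂sph) * M) := by gcongr
      _ = _ := by ring
  -- here `r` times the moment tends to zero
  exact eq_zero_of_tendsto_zero hR hk (by positivity) (fun s hs => (hode s hs).1)
    (fun s hs => (hode s hs).2) hlim

/-- The mean value property for the Helmholtz equation. -/
lemma WeakHelm.mean_value {k ρ : ℝ} (hk : 0 < k) {v : Space → ℂ} (hv : WeakHelm k (ball 0 ρ) v) :
    ∀ r ∈ Ioo 0 ρ, (k : ℂ) * (r * ∫ θ, v (r • (θ : Space)) ∂sph) =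
      sph.real univ * v 0 * Real.sin (k * r) := by
  have hw : WeakHelm k (shell 0 ρ) v := hv.mono fun z hz => by simpa using hz.2
  set y : ℝ → ℂ := fun r => r * mom v (fun _ => 1) r with hy
  have hode := hw.moment_ode le_rfl Homog.one (fun r _ => by
    simp [mom, Homog.one.lap_eq_zero (by norm_num)]) hy
  simp only [Nat.cast_zero, zero_mul, zero_div, sub_zero] at hode
  set F : ℝ → ℂ := fun r => y r * Real.sin (k * r) + deriv y r * Real.cos (k * r) / k with hF
  set G : ℝ → ℂ := fun r => y r * Real.cos (k * r) - deriv y r * Real.sin (k * r) / k with hG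
  have hkc : (k : ℂ) ≠ 0 := by exact_mod_cast hk.ne'
  have hs : ∀ r : ℝ, HasDerivAt (fun r : ℝ => (Real.sin (k * r) : ℂ))
      ((Real.cos (k * r) * k : ℝ) : ℂ) r :=
    fun r => by
      have h1 := (Real.hasDerivAt_sin (k * r)).comp r ((hasDerivAt_id r).const_mul k)
      rw [mul_one] at h1
      exact h1.ofReal_comp
  have hc : ∀ r : ℝ, HasDerivAt (fun r : ℝ => (Real.cos (k * r) : ℂ))
      ((-Real.sin (k * r) * k : ℝ) : ℂ) r :=
    fun r => by
      have h1 := (Real.hasDerivAt_cos (k * r)).comp r ((hasDerivAt_id r).const_mul k)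
      rw [mul_one] at h1
      exact h1.ofReal_comp
  have dF : ∀ r ∈ Ioo 0 ρ, HasDerivAt F 0 r := fun r hr => by
    refine (((hode r hr).1.mul (hs r)).add (((hode r hr).2.mul (hc r)).div_const _)).congr_deriv ?_
    push_cast
    field_simp
    ring
  have dG : ∀ r ∈ Ioo 0 ρ, HasDerivAt G 0 r := fun r hr => by
    refine (((hode r hr).1.mul (hc r)).sub (((hode r hr).2.mul (hs r)).div_const _)).congr_deriv ?_
    push_cast
    field_simp
    ring
  have hconst : ∀ {H : ℝ → ℂ}, (∀ r ∈ Ioo 0 ρ, HasDerivAt H 0 r) →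
      ∀ r ∈ Ioo 0 ρ, ∀ s ∈ Ioo 0 ρ, H r = H s := by
    intro H hH r hr s hs
    exact isOpen_Ioo.is_const_of_deriv_eq_zero isPreconnected_Ioo
      (fun t ht => (hH t ht).differentiableAt.differentiableWithinAt)
      (fun t ht => (hH t ht).deriv) hr hs
  have hrep : ∀ r, y r = F r * Real.sin (k * r) + G r * Real.cos (k * r) := by
    intro r
    have := Real.sin_sq_add_cos_sq (k * r)
    have h2 : (Real.sin (k * r) : ℂ) ^ 2 + (Real.cos (k * r) : ℂ) ^ 2 = 1 := by exact_mod_cast this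
    simp only [hF, hG]
    linear_combination (-y r) * h2
  have hmc : ContinuousOn (mom v fun _ => 1) (Ioo (-ρ) ρ) := by
    refine continuousOn_integral_of_compact_support (k := univ) isCompact_univ ?_ (by simp)
    refine ContinuousOn.mul ?_ continuousOn_const
    refine hv.continuousOn.comp (by fun_prop) fun p hp => ?_
    have h1 : ‖(p.2 : Space)‖ = 1 := by simp
    simpa [norm_smul, h1, abs_lt] using hp.1
  intro r hr
  have hρ : 0 < ρ := hr.1.trans hr.2
  have hm0 : Tendsto (mom v fun _ => 1) (𝓝[>] 0) (𝓝 (sph.real univ * v 0)) := by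
    have := (hmc.continuousAt (isOpen_Ioo.mem_nhds ⟨by linarith, hρ⟩ : Ioo (-ρ) ρ ∈ 𝓝 0)).tendsto
    have h2 : mom v (fun _ => 1) 0 = sph.real univ * v 0 := by simp [mom]
    rw [h2] at this
    exact this.mono_left nhdsWithin_le_nhds
  have hid : Tendsto (fun s : ℝ => (s : ℂ)) (𝓝[>] 0) (𝓝 0) := by
    have := Complex.continuous_ofReal.tendsto 0
    exact (by simpa using this : Tendsto (fun s : ℝ => (s : ℂ)) (𝓝 0) (𝓝 0)).mono_left
      nhdsWithin_le_nhds
  have hy0 : Tendsto y (𝓝[>] 0) (𝓝 0) := by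
    have := hid.mul hm0
    rwa [zero_mul] at this
  have hmem : ∀ᶠ s in 𝓝[>] (0 : ℝ), s ∈ Ioo 0 ρ := Ioo_mem_nhdsGT hρ
  have hsin : Tendsto (fun s : ℝ => (Real.sin (k * s) : ℂ)) (𝓝[>] 0) (𝓝 0) := by
    have h1 : Continuous fun s : ℝ => (Real.sin (k * s) : ℂ) := by fun_prop
    have := h1.tendsto 0
    simp only [mul_zero, Real.sin_zero, Complex.ofReal_zero] at this
    exact this.mono_left nhdsWithin_le_nhds
  have hcos : Tendsto (fun s : ℝ => (Real.cos (k * s) : ℂ)) (𝓝[>] 0) (𝓝 1) := by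
    have h1 : Continuous fun s : ℝ => (Real.cos (k * s) : ℂ) := by fun_prop
    have := h1.tendsto 0
    simp only [mul_zero, Real.cos_zero, Complex.ofReal_one] at this
    exact this.mono_left nhdsWithin_le_nhds
  have hG0 : G r = 0 := by
    have h1 : Tendsto (fun s : ℝ => F r * Real.sin (k * s) + G r * Real.cos (k * s)) (𝓝[>] 0)
        (𝓝 (F r * 0 + G r * 1)) := (hsin.const_mul _).add (hcos.const_mul _)
    have h2 : Tendsto (fun s : ℝ => F r * Real.sin (k * s) + G r * Real.cos (k * s)) (𝓝[>] 0)
        (𝓝 0) := by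
      refine hy0.congr' ?_
      filter_upwards [hmem] with s hs
      rw [hrep s, hconst dF s hs r hr, hconst dG s hs r hr]
    simpa using tendsto_nhds_unique h1 h2
  have hyF : ∀ s ∈ Ioo 0 ρ, y s = F r * Real.sin (k * s) := by
    intro s hs
    rw [hrep s, hconst dF s hs r hr, hconst dG s hs r hr, hG0]; ring
  have hlim : F r * k = sph.real univ * v 0 := by
    have h1 : Tendsto (fun s : ℝ => F r * ((Real.sin (k * s) / s : ℝ) : ℂ)) (𝓝[>] 0)
        (𝓝 (F r * k)) := by
      have hd : HasDerivAt (fun s : ℝ => Real.sin (k * s)) k 0 := by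
        have h1 := (Real.hasDerivAt_sin (k * 0)).comp 0 ((hasDerivAt_id (0 : ℝ)).const_mul k)
        exact h1.congr_deriv (by simp)
      have h2 := hd.tendsto_slope_zero_right
      have h3 : Tendsto (fun s : ℝ => Real.sin (k * s) / s) (𝓝[>] 0) (𝓝 k) := by
        refine h2.congr fun s => ?_
        simp; ring
      exact ((Complex.continuous_ofReal.tendsto k).comp h3).const_mul (F r)
    refine tendsto_nhds_unique h1 (hm0.congr' ?_)
    filter_upwards [hmem] with s hs
    have hs0 : (s : ℂ) ≠ 0 := by exact_mod_cast hs.1.ne'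
    have := hyF s hs
    simp only [hy] at this
    push_cast
    rw [← mul_div_assoc, eq_div_iff hs0, ← Complex.ofReal_mul, ← Complex.ofReal_sin, ← this]; ring
  have := hyF r hr
  simp only [hy, mom, mul_one] at this
  rw [this, ← hlim]
  ring

/-! ### Interior regularity -/

/-- A smooth even averaging kernel, supported in a prescribed ball, that reproduces all solutions
of the Helmholtz equation. -/
lemma exists_kernel {k δ : ℝ} (hk : 0 < k) (hδ : 0 < δ) : ∃ β : Space → ℂ, ContDiff ℝ ∞ β ∧
    HasCompactSupport β ∧ tsupport β ⊆ ball 0 δ ∧ (∀ x, β (-x) = β x) ∧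
    ∀ (v : Space → ℂ) (x : Space), WeakHelm k (ball x δ) v → ∫ y, v y * β (y - x) = v x := by
  -- on radii below `π / k` the sine in the mean value property is positive
  set ρ := min δ (Real.pi / k) with hρ
  have hρ0 : 0 < ρ := lt_min hδ (by positivity)
  obtain ⟨G, g1, g2, g3, g4, g5⟩ := exists_test_integral_one hρ0
  obtain ⟨t1, t2, t3⟩ := radial_test le_rfl (P := fun _ => 1) contDiff_const
    (fun s _ => g1.contDiffAt) g3
  set β₀ : Space → ℂ := fun x => (G ‖x‖ : ℂ) * 1 with hβ₀
  set c : ℝ := ∫ r, G r * (r * Real.sin (k * r)) with hc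
  have hsin : ∀ r ∈ Ioo 0 ρ, 0 < r * Real.sin (k * r) := fun r hr => by
    refine mul_pos hr.1 (Real.sin_pos_of_pos_of_lt_pi (mul_pos hk hr.1) ?_)
    have := hr.2.trans_le (min_le_right _ _)
    rw [lt_div_iff₀ hk] at this
    linarith
  have hGz : ∀ r, r ∉ Ioo 0 ρ → G r = 0 := fun r hr =>
    image_eq_zero_of_notMem_tsupport fun h => hr (g3 h)
  have hcpos : 0 < c := by
    have hcont : Continuous fun r => G r * (r * Real.sin (k * r)) := g1.continuous.mul (by fun_prop)
    have hnn : ∀ r, 0 ≤ G r * (r * Real.sin (k * r)) := fun r => by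
      by_cases hr : r ∈ Ioo 0 ρ
      · exact mul_nonneg (g5 r) (hsin r hr).le
      · simp [hGz r hr]
    obtain ⟨r, hr⟩ : ∃ r, G r ≠ 0 := by
      by_contra hcon
      push Not at hcon
      simp [hcon] at g4
    have hrm : r ∈ Ioo 0 ρ := by
      by_contra h
      exact hr (hGz r h)
    exact hcont.integral_pos_of_hasCompactSupport_nonneg_nonzero g2.mul_right hnn
      (mul_ne_zero hr (hsin r hrm).ne')
  have hσ : 0 < sph.real univ := by
    rw [measureReal_def, ENNReal.toReal_pos_iff]
    exact ⟨Measure.measure_univ_pos.2 (Measure.toSphere_ne_zero _), measure_lt_top _ _⟩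
  set C : ℂ := ((sph.real univ * c / k : ℝ) : ℂ) with hC
  have hC0 : C ≠ 0 := by
    have : 0 < sph.real univ * c / k := by positivity
    rw [hC]; exact_mod_cast this.ne'
  have hsub : tsupport β₀ ⊆ ball 0 δ := fun x hx => by
    have := (t3 hx).2.trans_le (min_le_left _ _)
    simpa using this
  have hrepr : ∀ (v : Space → ℂ), WeakHelm k (ball 0 δ) v → ∫ y, v y * β₀ y = C * v 0 := by
    intro v hv
    rw [integral_polar (integrable_mul_of_tsupport_subset isOpen_ball hv.continuousOn t1.continuous
      t2 hsub)]
    have hmv := (hv.mono (ball_subset_ball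
        (min_le_left _ _) : ball (0 : Space) ρ ⊆ ball 0 δ)).mean_value hk
    have hkc : (k : ℂ) ≠ 0 := by exact_mod_cast hk.ne'
    have h1 : ∀ r ∈ Ioi (0 : ℝ), r ^ 2 • ∫ θ, v (r • (θ : Space)) * β₀ (r • (θ : Space)) ∂sph =
        ((G r * (r * Real.sin (k * r)) : ℝ) : ℂ) * ((sph.real univ / k : ℝ) * v 0) := by
      intro r hr
      have hr0 : (0 : ℝ) < r := hr
      have h2 : ∀ θ : sphere (0 : Space) 1, β₀ (r • (θ : Space)) = G r := by
        intro θ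
        have : ‖(θ : Space)‖ = 1 := by simp
        simp [hβ₀, norm_smul, this, abs_of_pos hr0]
      simp_rw [h2]
      rw [integral_mul_const]
      by_cases hrm : r ∈ Ioo 0 ρ
      · have h3 := hmv r hrm
        rw [Complex.real_smul]
        push_cast at h3 ⊢
        generalize Complex.sin ((k : ℂ) * r) = S at h3 ⊢
        field_simp
        linear_combination (G r : ℂ) * r * h3
      · simp [hGz r hrm]
    rw [setIntegral_congr_fun measurableSet_Ioi h1, integral_mul_const,
      setIntegral_eq_integral_of_forall_compl_eq_zero, integral_complex_ofReal, ← hc, hC]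
    · push_cast; ring
    · intro r hr
      simp [hGz r fun h => hr h.1]
  refine ⟨fun x => C⁻¹ * β₀ x, contDiff_const.mul t1, t2.mul_left,
    (tsupport_mul_subset_right).trans hsub, fun x => by simp [hβ₀], fun v x hv => ?_⟩
  have hv' : WeakHelm k (ball 0 δ) fun y => v (y + x) := (hv.comp_add x).mono fun z hz => by
    simpa using hz
  rw [← integral_add_right_eq_self _ x]
  have h1 := hrepr _ hv'
  simp only [add_sub_cancel_right]
  have h2 : (fun y => v (y + x) * (C⁻¹ * β₀ y)) = fun y => C⁻¹ * (v (y + x) * β₀ y) := by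
    funext y; ring
  rw [h2, integral_const_mul, h1, zero_add, inv_mul_cancel_left₀ hC0]

/-- Weyl's lemma for the Helmholtz equation. -/
lemma WeakHelm.contDiffOn {k : ℝ} (hk : 0 < k) {U : Set Space} (hU : IsOpen U) {v : Space → ℂ}
    (hv : WeakHelm k U v) : ContDiffOn ℝ ∞ v U := by
  intro x₀ hx₀
  obtain ⟨ε, hε, hball⟩ := Metric.isOpen_iff.1 hU x₀ hx₀
  obtain ⟨β, b1, b2, b3, b4, b5⟩ := exists_kernel hk (show 0 < ε / 4 by positivity)
  set K := closedBall x₀ (ε / 2) with hK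
  have hKU : K ⊆ U := (closedBall_subset_ball (by linarith)).trans hball
  have hint : Integrable (K.indicator v) :=
    ((hv.continuousOn.mono hKU).integrableOn_compact
        (isCompact_closedBall _ _)).integrable_indicator
      isClosed_closedBall.measurableSet
  have hsm := b2.contDiff_convolution_right (n := ⊤) (μ := volume) (ContinuousLinearMap.mul ℝ ℂ)
    hint.locallyIntegrable b1
  refine (hsm.contDiffAt.congr_of_eventuallyEq ?_).contDiffWithinAt
  filter_upwards [ball_mem_nhds x₀ (show 0 < ε / 4 by positivity)] with x hx
  have hxU : ball x (ε / 4) ⊆ U := (ball_subset_ball' (by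
    have := mem_ball.1 hx; linarith)).trans hball
  rw [← b5 v x (hv.mono hxU), convolution]
  congr 1
  funext y
  have e : β (x - y) = β (y - x) := by rw [← b4, neg_sub]
  simp only [ContinuousLinearMap.mul_apply', e]
  by_cases hy : y ∈ K
  · rw [indicator_of_mem hy]
  · have : β (y - x) = 0 := by
      refine image_eq_zero_of_notMem_tsupport fun h => hy ?_
      have h1 := b3 h
      rw [mem_ball, dist_zero_right, ← dist_eq_norm] at h1
      have h2 := dist_triangle y x x₀
      have h3 := mem_ball.1 hx
      simp only [hK, mem_closedBall]
      linarith
    simp [this]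

/-- Interior gradient estimate for the Helmholtz equation. -/
lemma exists_gradient_bound {k δ : ℝ} (hk : 0 < k) (hδ : 0 < δ) : ∃ C, 0 ≤ C ∧
    ∀ (v : Space → ℂ) (x : Space) (M : ℝ), WeakHelm k (ball x δ) v → (∀ y ∈ ball x δ, ‖v y‖ ≤ M) →
      ‖fderiv ℝ v x‖ ≤ C * M := by
  obtain ⟨β, b1, b2, b3, b4, b5⟩ := exists_kernel hk (show 0 < δ / 2 by positivity)
  obtain ⟨L, hL⟩ := ContDiff.lipschitzWith_of_hasCompactSupport b2 b1 (by simp)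
  refine ⟨L * volume.real (ball (0 : Space) δ), by positivity, fun v x M hv hM => ?_⟩
  have hM0 : 0 ≤ M := (norm_nonneg _).trans (hM x (mem_ball_self hδ))
  refine norm_fderiv_le_of_lip' ℝ (by positivity) ?_
  filter_upwards [ball_mem_nhds x (show 0 < δ / 2 by positivity)] with x' hx'
  have hsub : ∀ z ∈ ball x (δ / 2), ball z (δ / 2) ⊆ ball x δ := fun z hz =>
    ball_subset_ball' (by have := mem_ball.1 hz; linarith)
  have hx : x ∈ ball x (δ / 2) := mem_ball_self (by positivity)
  have hzero : ∀ z ∈ ball x (δ / 2), ∀ y, y ∉ ball x δ → β (y - z) = 0 := fun z hz y hy =>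
    image_eq_zero_of_notMem_tsupport fun h => hy (hsub z hz (by
      have := b3 h
      rwa [mem_ball, dist_zero_right, ← dist_eq_norm] at this))
  have hint : ∀ z ∈ ball x (δ / 2), Integrable fun y => v y * β (y - z) := by
    intro z hz
    have hc : HasCompactSupport fun y => β (y - z) := by
      simp only [sub_eq_add_neg]
      exact b2.comp_homeomorph (Homeomorph.addRight (-z))
    refine integrable_mul_of_tsupport_subset isOpen_ball hv.continuousOn
      (b1.continuous.comp (by fun_prop)) hc ?_
    have := tsupport_comp_add β (-z)
    simp only [← sub_eq_add_neg] at this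
    rw [this]
    intro y hy
    have := b3 hy
    rw [mem_ball, dist_zero_right, ← dist_eq_norm] at this
    exact hsub z hz this
  rw [← b5 v x' (hv.mono (hsub x' hx')), ← b5 v x (hv.mono (hsub x hx)),
    ← integral_sub (hint x' hx') (hint x hx),
    ← setIntegral_eq_integral_of_forall_compl_eq_zero (s := ball x δ)]
  swap
  · intro y hy
    rw [hzero x' hx' y hy, hzero x hx y hy]; simp
  have hvol : volume.real (ball x δ) = volume.real (ball (0 : Space) δ) := by
    simp only [measureReal_def, Measure.addHaar_ball_center]
  rw [← hvol]
  have := norm_setIntegral_le_of_norm_le_const (μ := volume) (s := ball x δ)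
    (f := fun y => v y * β (y - x') - v y * β (y - x)) (C := M * (L * ‖x' - x‖)) measure_ball_lt_top
    (fun y hy => by
      rw [← mul_sub, norm_mul]
      refine mul_le_mul (hM y hy) ?_ (norm_nonneg _) hM0
      have := hL.dist_le_mul (y - x') (y - x)
      rw [dist_eq_norm, dist_eq_norm] at this
      have e : y - x' - (y - x) = -(x' - x) := by abel
      rwa [e, norm_neg] at this)
  refine this.trans (le_of_eq ?_)
  ring

/-! ### The Navier equation in components -/

lemma two_le_infty : (2 : WithTop ℕ∞) ≤ ∞ := ENat.LEInfty.out

lemma contDiffAt_comp {n : WithTop ℕ∞} {u : Space → CVec} {x : Space} (hu : ContDiffAt ℝ n u x)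
    (j : Fin 3) : ContDiffAt ℝ n (fun y => u y j) x := (contDiffAt_piLp 2).1 hu j

lemma contDiffOn_comp {n : WithTop ℕ∞} {u : Space → CVec} {U : Set Space} (hu : ContDiffOn ℝ n u U)
    (j : Fin 3) : ContDiffOn ℝ n (fun y => u y j) U := (contDiffOn_piLp 2).1 hu j

lemma differentiableAt_comp {u : Space → CVec} {x : Space} (hu : DifferentiableAt ℝ u x)
    (j : Fin 3) : DifferentiableAt ℝ (fun y => u y j) x := (differentiableAt_piLp 2).1 hu j

/-- The `j`-th coordinate as a real-linear functional on `ℂ³`. -/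
def cproj (j : Fin 3) : CVec →L[ℝ] ℂ := (EuclideanSpace.proj j : CVec →L[ℂ] ℂ).restrictScalars ℝ

lemma fderiv_comp_apply {u : Space → CVec} {x : Space} (hu : DifferentiableAt ℝ u x) (j : Fin 3)
    (a : Space) : fderiv ℝ (fun y => u y j) x a = (fderiv ℝ u x a) j := by
  have := ((cproj j).hasFDerivAt.comp x hu.hasFDerivAt).fderiv
  change fderiv ℝ (cproj j ∘ u) x a = _
  rw [this]; rfl

lemma pderiv_eq_pd {u : Space → CVec} {x : Space} (hu : DifferentiableAt ℝ u x) (i j : Fin 3) :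
    pderiv u i j x = pd i (fun y => u y j) x := (fderiv_comp_apply hu j _).symm

lemma laplacian_eq_lap {F : Type*} [NormedAddCommGroup F] [NormedSpace ℝ F] {f : Space → F}
    {x : Space} (hf : ContDiffAt ℝ 2 f x) : Laplacian.laplacian f x = lap f x := by
  rw [InnerProductSpace.laplacian_eq_iteratedFDeriv_orthonormalBasis f
    (EuclideanSpace.basisFun (Fin 3) ℝ)]
  refine Finset.sum_congr rfl fun i _ => ?_
  have hd : DifferentiableAt ℝ (fderiv ℝ f) x :=
    (hf.fderiv_right (m := 1) (by norm_num)).differentiableAt (by norm_num)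
  rw [iteratedFDeriv_two_apply]
  change _ = fderiv ℝ (fun y => fderiv ℝ f y _) x _
  rw [fderiv_clm_apply hd (differentiableAt_const _)]
  simp

lemma laplacian_comp {u : Space → CVec} {x : Space} (hu : ContDiffAt ℝ 2 u x) (j : Fin 3) :
    (Laplacian.laplacian u x) j = lap (fun y => u y j) x := by
  rw [← laplacian_eq_lap (contDiffAt_comp hu j)]
  exact (hu.laplacian_CLM_comp_left (l := cproj j)).symm

/-- The divergence, as the sum of partial derivatives of the components. -/
def dv (u : Space → CVec) (x : Space) : ℂ := ∑ i, pd i (fun y => u y i) x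

lemma div_eq_dv {u : Space → CVec} {x : Space} (hu : DifferentiableAt ℝ u x) : div u x = dv u x :=
  Finset.sum_congr rfl fun i _ => pderiv_eq_pd hu i i

lemma div_eventuallyEq {u : Space → CVec} {x : Space} (hu : ContDiffAt ℝ 2 u x) :
    div u =ᶠ[𝓝 x] dv u := by
  filter_upwards [hu.eventually (by simp)] with y hy using
    div_eq_dv (hy.differentiableAt (by norm_num))

lemma contDiffAt_dv {u : Space → CVec} {x : Space} {n m : WithTop ℕ∞} (hu : ContDiffAt ℝ n u x)
    (hmn : m + 1 ≤ n) : ContDiffAt ℝ m (dv u) x :=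
  ContDiffAt.sum fun i _ => contDiffAt_pd (contDiffAt_comp hu i) hmn i

lemma grad_div_apply {u : Space → CVec} {x : Space} (hu : ContDiffAt ℝ 2 u x) (j : Fin 3) :
    (grad (div u) x) j = pd j (dv u) x := pd_congr (div_eventuallyEq hu) j

lemma lameOp_apply {lam mu : ℝ} {u : Space → CVec} {x : Space} (hu : ContDiffAt ℝ 2 u x)
    (j : Fin 3) : (lameOp lam mu u x) j =
      mu * lap (fun y => u y j) x + (lam + mu) * pd j (dv u) x := by
  simp only [lameOp, PiLp.add_apply, PiLp.smul_apply, laplacian_comp hu, grad_div_apply hu]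
  simp

lemma pressurePart_apply {lam mu om : ℝ} {u : Space → CVec} {x : Space} (hu : ContDiffAt ℝ 2 u x)
    (j : Fin 3) : (pressurePart lam mu om u x) j =
        -(1 / (kP lam mu om : ℂ) ^ 2) * pd j (dv u) x := by
  simp only [pressurePart, PiLp.smul_apply, grad_div_apply hu]
  simp

lemma curl_curl_apply {u : Space → CVec} {x : Space} (hu : ContDiffAt ℝ 2 u x) (j : Fin 3) :
    (curl (curl u) x) j = pd j (dv u) x - lap (fun y => u y j) x := by
  have hc : ∀ i, ContDiffAt ℝ 2 (fun y => u y i) x := contDiffAt_comp hu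
  have hd : ∀ i j, DifferentiableAt ℝ (pd i fun y => u y j) x := fun i j =>
    (contDiffAt_pd (hc j) (m := 1) (by norm_num) i).differentiableAt (by norm_num)
  have hev : ∀ᶠ y in 𝓝 x, DifferentiableAt ℝ u y := by
    filter_upwards [hu.eventually (by simp)] with y hy using hy.differentiableAt (by norm_num)
  have h0 : (fun y => (curl u y) 0) =ᶠ[𝓝 x] fun y =>
      pd 1 (fun y => u y 2) y - pd 2 (fun y => u y 1) y := by
    filter_upwards [hev] with y hy
    simp [curl, pderiv_eq_pd hy]
  have h1 : (fun y => (curl u y) 1) =ᶠ[𝓝 x] fun y =>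
      pd 2 (fun y => u y 0) y - pd 0 (fun y => u y 2) y := by
    filter_upwards [hev] with y hy
    simp [curl, pderiv_eq_pd hy]
  have h2 : (fun y => (curl u y) 2) =ᶠ[𝓝 x] fun y =>
      pd 0 (fun y => u y 1) y - pd 1 (fun y => u y 0) y := by
    filter_upwards [hev] with y hy
    simp [curl, pderiv_eq_pd hy]
  have hcd : DifferentiableAt ℝ (curl u) x := by
    rw [differentiableAt_piLp]
    intro i
    fin_cases i
    · exact ((hd 1 2).sub (hd 2 1)).congr_of_eventuallyEq h0
    · exact ((hd 2 0).sub (hd 0 2)).congr_of_eventuallyEq h1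
    · exact ((hd 0 1).sub (hd 1 0)).congr_of_eventuallyEq h2
  have hdv : ∀ j, pd j (dv u) x = ∑ i, pd j (pd i fun y => u y i) x := fun j =>
    pd_sum (fun i _ => hd i i) j
  have hcm : ∀ i j l, pd i (pd j fun y => u y l) x = pd j (pd i fun y => u y l) x := fun i j l =>
    pd_comm (hc l) i j
  fin_cases j
  · change pderiv (curl u) 1 2 x - pderiv (curl u) 2 1 x = _
    rw [pderiv_eq_pd hcd, pderiv_eq_pd hcd, pd_congr h2, pd_congr h1, pd_sub (hd _ _) (hd _ _),
      pd_sub (hd _ _) (hd _ _)]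
    simp only [Fin.zero_eta, hdv, lap, Fin.sum_univ_three]
    linear_combination hcm 1 0 1 + hcm 2 0 2
  · change pderiv (curl u) 2 0 x - pderiv (curl u) 0 2 x = _
    rw [pderiv_eq_pd hcd, pderiv_eq_pd hcd, pd_congr h0, pd_congr h2, pd_sub (hd _ _) (hd _ _),
      pd_sub (hd _ _) (hd _ _)]
    simp only [Fin.mk_one, hdv, lap, Fin.sum_univ_three]
    linear_combination hcm 2 1 2 + hcm 0 1 0
  · change pderiv (curl u) 0 1 x - pderiv (curl u) 1 0 x = _
    rw [pderiv_eq_pd hcd, pderiv_eq_pd hcd, pd_congr h1, pd_congr h0, pd_sub (hd _ _) (hd _ _),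
      pd_sub (hd _ _) (hd _ _)]
    simp only [Fin.reduceFinMk, hdv, lap, Fin.sum_univ_three]
    linear_combination hcm 0 2 0 + hcm 1 2 1

lemma shearPart_apply {mu om : ℝ} {u : Space → CVec} {x : Space} (hu : ContDiffAt ℝ 2 u x)
    (j : Fin 3) : (shearPart mu om u x) j =
      1 / (kS mu om : ℂ) ^ 2 * (pd j (dv u) x - lap (fun y => u y j) x) := by
  simp only [shearPart, PiLp.smul_apply, curl_curl_apply hu]
  simp

/-- A weak solution of the Helmholtz equation solves it classically. -/
lemma WeakHelm.lap_add {k : ℝ} (hk : 0 < k) {U : Set Space} (hU : IsOpen U) {v : Space → ℂ}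
    (hv : WeakHelm k U v) : ∀ x ∈ U, lap v x + (k : ℂ) ^ 2 * v x = 0 := by
  have hs := hv.contDiffOn hk hU
  have hl : ContinuousOn (lap v) U := continuousOn_finsetSum _ fun i _ =>
    (contDiffOn_pd hU (contDiffOn_pd hU (hs.of_le (m := 2) two_le_infty) (m := 1) (by norm_num) i)
      (m := 0) (by norm_num) i).continuousOn
  have hf : ContinuousOn (fun x => lap v x + (k : ℂ) ^ 2 * v x) U :=
    hl.add (continuousOn_const.mul hv.continuousOn)
  have hae := hU.ae_eq_zero_of_integral_contDiff_smul_eq_zero (μ := volume)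
    (f := fun x => lap v x + (k : ℂ) ^ 2 * v x) (hf.locallyIntegrableOn hU.measurableSet) (by
      intro g g1 g2 g3
      set φ : Space → ℂ := fun x => (g x : ℂ) with hφ
      have p1 : ContDiff ℝ ∞ φ := Complex.ofRealCLM.contDiff.comp g1
      have p2 : HasCompactSupport φ := g2.comp_left (g := fun t : ℝ => (t : ℂ)) (by simp)
      have p3 : tsupport φ ⊆ U :=
        (tsupport_comp_subset (g := fun t : ℝ => (t : ℂ)) (by simp) g).trans g3
      have h1 := hv.weak φ p1 p2 p3
      have i1 := integrable_mul_of_tsupport_subset hU hv.continuousOn (contDiff_lap p1).continuous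
        (hasCompactSupport_lap p2) ((tsupport_lap_subset φ).trans p3)
      have i2 := (integrable_mul_of_tsupport_subset hU hv.continuousOn p1.continuous p2
          p3).const_mul
        ((k : ℂ) ^ 2)
      have i3 := integrable_mul_of_tsupport_subset hU hl p1.continuous p2 p3
      have e1 : (fun x => v x * (lap φ x + (k : ℂ) ^ 2 * φ x)) =
          fun x => v x * lap φ x + (k : ℂ) ^ 2 * (v x * φ x) := by
        funext x; ring
      rw [e1, integral_add i1 i2, integral_mul_lap hU (hs.of_le two_le_infty) p1 p2 p3,
          ← integral_add i3 i2] at h1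
      rw [← h1]
      congr 1
      funext x
      simp only [hφ, Complex.real_smul]; ring)
  have : EqOn (fun x => lap v x + (k : ℂ) ^ 2 * v x) (fun _ => 0) U := by
    refine Measure.eqOn_open_of_ae_eq (μ := volume) ?_ hU hf continuousOn_const
    exact (ae_restrict_iff' hU.measurableSet).2 hae
  exact this

/-! ### Decomposition into pressure and shear waves -/

/-- A decomposition of a field `u` in `U` into a curl-free part `v` and a divergence-free part `w`
that solve Helmholtz equations with wave numbers `k₁` and `k₂`. -/
structure PSDecomp (k₁ k₂ : ℝ) (U : Set Space) (u v w : Space → CVec) : Prop where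
  sum : ∀ x ∈ U, ∀ i, u x i = v x i + w x i
  contDiff_p : ∀ i, ContDiffOn ℝ 2 (fun x => v x i) U
  contDiff_s : ∀ i, ContDiffOn ℝ 2 (fun x => w x i) U
  helm_p : ∀ x ∈ U, ∀ i, lap (fun y => v y i) x + (k₁ : ℂ) ^ 2 * v x i = 0
  helm_s : ∀ x ∈ U, ∀ i, lap (fun y => w y i) x + (k₂ : ℂ) ^ 2 * w x i = 0
  curl_p : ∀ x ∈ U, ∀ i j, pd i (fun y => v y j) x = pd j (fun y => v y i) x
  div_s : ∀ x ∈ U, dv w x = 0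

lemma kP_pos {lam mu om : ℝ} (h : 0 < lam + 2 * mu) (hom : 0 < om) : 0 < kP lam mu om :=
  div_pos hom (Real.sqrt_pos.2 h)

lemma kS_pos {mu om : ℝ} (h : 0 < mu) (hom : 0 < om) : 0 < kS mu om :=
  div_pos hom (Real.sqrt_pos.2 h)

lemma kP_sq {lam mu om : ℝ} (h : 0 < lam + 2 * mu) :
    (kP lam mu om : ℂ) ^ 2 * (lam + 2 * mu) = om ^ 2 := by
  have : kP lam mu om ^ 2 * (lam + 2 * mu) = om ^ 2 := by
    rw [kP, div_pow, Real.sq_sqrt h.le]; field_simp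
  exact_mod_cast this

lemma kS_sq {mu om : ℝ} (h : 0 < mu) : (kS mu om : ℂ) ^ 2 * mu = om ^ 2 := by
  have : kS mu om ^ 2 * mu = om ^ 2 := by
    rw [kS, div_pow, Real.sq_sqrt h.le]; field_simp
  exact_mod_cast this

lemma pd_lap_comm {φ : Space → ℂ} (hφ : ContDiff ℝ ∞ φ) (i : Fin 3) :
    pd i (lap φ) = lap (pd i φ) := by
  funext x
  have h2 : ∀ {f : Space → ℂ}, ContDiff ℝ ∞ f → ContDiffAt ℝ 2 f x := fun hf =>
    (hf.of_le two_le_infty).contDiffAt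
  change pd i (fun y => ∑ j, pd j (pd j φ) y) x = _
  rw [pd_sum fun j _ => (contDiff_pd (contDiff_pd hφ j) j).differentiable (by simp) x]
  refine Finset.sum_congr rfl fun j _ => ?_
  rw [pd_comm (h2 (contDiff_pd hφ j))]
  congr 1
  funext y
  exact pd_comm (hφ.of_le two_le_infty).contDiffAt i j

/-- The divergence of a solution of the Navier equation is a weak solution of the Helmholtz
equation with the pressure wave number. -/
lemma weakHelm_dv {lam mu om : ℝ} (hlm : 0 < lam + 2 * mu) {U : Set Space} (hU : IsOpen U)
    {u : Space → CVec} (hu : ContDiffOn ℝ 2 u U)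
    (hN : ∀ x ∈ U, lameOp lam mu u x + om ^ 2 • u x = 0) : WeakHelm (kP lam mu om) U (dv u) := by
  have hat : ∀ x ∈ U, ContDiffAt ℝ 2 u x := fun x hx => hu.contDiffAt (hU.mem_nhds hx)
  have hp : ContDiffOn ℝ 1 (dv u) U := fun x hx =>
    (contDiffAt_dv (hat x hx) (by norm_num)).contDiffWithinAt
  have hc := fun i => contDiffOn_comp hu i
  refine ⟨hp.continuousOn, fun φ p1 p2 p3 => ?_⟩
  have hlam : (lam + 2 * mu : ℂ) ≠ 0 := by exact_mod_cast hlm.ne'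
  -- integrate the equation against the gradient of `φ`
  have q1 : ∀ i, ContDiff ℝ ∞ (pd i φ) := contDiff_pd p1
  have q2 : ∀ i, HasCompactSupport (pd i φ) := hasCompactSupport_pd p2
  have q3 : ∀ i, tsupport (pd i φ) ⊆ U := fun i => (tsupport_pd_subset φ i).trans p3
  have l1 := contDiff_lap p1
  have l2 := hasCompactSupport_lap p2
  have l3 := (tsupport_lap_subset φ).trans p3
  have hlc : ∀ i, ContinuousOn (lap fun y => u y i) U := fun i =>
      continuousOn_finsetSum _ fun j _ =>
    (contDiffOn_pd hU (contDiffOn_pd hU (hc i) (m := 1) (by norm_num) j)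
        (m := 0) (by norm_num) j).continuousOn
  have hpc : ∀ i, ContinuousOn (pd i (dv u)) U := fun i =>
    (contDiffOn_pd hU hp (m := 0) (by norm_num) i).continuousOn
  have i1 : ∀ i, Integrable fun x => lap (fun y => u y i) x * pd i φ x := fun i =>
    integrable_mul_of_tsupport_subset hU (hlc i) (q1 i).continuous (q2 i) (q3 i)
  have i2 : ∀ i, Integrable fun x => pd i (dv u) x * pd i φ x := fun i =>
    integrable_mul_of_tsupport_subset hU (hpc i) (q1 i).continuous (q2 i) (q3 i)
  have i3 : ∀ i, Integrable fun x => u x i * pd i φ x := fun i =>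
    integrable_mul_of_tsupport_subset hU (hc i).continuousOn (q1 i).continuous (q2 i) (q3 i)
  have e0 : ∀ i, mu * ∫ x, lap (fun y => u y i) x * pd i φ x = -((lam + mu) *
      ∫ x, pd i (dv u) x * pd i φ x) - om ^ 2 * ∫ x, u x i * pd i φ x := by
    intro i
    have : ∫ x, (mu * (lap (fun y => u y i) x * pd i φ x) +
        (lam + mu) * (pd i (dv u) x * pd i φ x) +
        om ^ 2 * (u x i * pd i φ x)) = (0 : ℂ) := by
      refine integral_eq_zero_of_ae (Eventually.of_forall fun x => ?_)
      by_cases hx : x ∈ tsupport (pd i φ)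
      · have h1 := congrArg (fun z : CVec => z i) (hN x (q3 i hx))
        simp only [PiLp.add_apply, PiLp.smul_apply, lameOp_apply (hat x (q3 i hx)), PiLp.zero_apply,
          Complex.real_smul] at h1
        push_cast at h1
        change mu * (lap (fun y => u y i) x * pd i φ x) + (lam + mu) * (pd i (dv u) x * pd i φ x) +
          om ^ 2 * (u x i * pd i φ x) = (0 : ℂ)
        linear_combination pd i φ x * h1
      · simp [image_eq_zero_of_notMem_tsupport hx]
    have i12 : Integrable fun x => (mu : ℂ) * (lap (fun y => u y i) x * pd i φ x) +
        (lam + mu) * (pd i (dv u) x * pd i φ x) := ((i1 i).const_mul _).add ((i2 i).const_mul _)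
    rw [integral_add i12 ((i3 i).const_mul _),
      integral_add ((i1 i).const_mul _) ((i2 i).const_mul _), integral_const_mul,
          integral_const_mul,
      integral_const_mul] at this
    linear_combination this
  have e1 : ∀ i, ∫ x, lap (fun y => u y i) x * pd i φ x =
      - ∫ x, pd i (fun y => u y i) x * lap φ x := by
    intro i
    rw [← integral_mul_lap hU (hc i) (q1 i) (q2 i) (q3 i), ← pd_lap_comm p1,
      integral_mul_pd hU ((hc i).of_le (by norm_num)) l1 l2 l3]
  have e2 : ∀ i, ∫ x, pd i (dv u) x * pd i φ x = - ∫ x, dv u x * pd i (pd i φ) x := by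
    intro i
    rw [integral_mul_pd hU hp (q1 i) (q2 i) (q3 i), neg_neg]
  have e3 : ∀ i, ∫ x, u x i * pd i φ x = - ∫ x, pd i (fun y => u y i) x * φ x := fun i =>
    integral_mul_pd hU ((hc i).of_le (by norm_num)) p1 p2 p3 i
  have hpi : ∀ i, ContinuousOn (pd i fun y => u y i) U := fun i =>
    (contDiffOn_pd hU (hc i) (m := 1) (by norm_num) i).continuousOn
  have s1 : ∑ i, ∫ x, pd i (fun y => u y i) x * lap φ x = ∫ x, dv u x * lap φ x := by
    rw [← integral_finsetSum _ fun i _ =>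
      integrable_mul_of_tsupport_subset hU (hpi i) l1.continuous l2 l3]
    simp only [dv, Finset.sum_mul]
  have s2 : ∑ i, ∫ x, dv u x * pd i (pd i φ) x = ∫ x, dv u x * lap φ x := by
    rw [← integral_finsetSum _ fun i _ => integrable_mul_of_tsupport_subset hU hp.continuousOn
      (contDiff_pd (q1 i) i).continuous (hasCompactSupport_pd (q2 i) i)
      ((tsupport_pd_subset _ i).trans (q3 i))]
    simp only [lap, Finset.mul_sum]
  have s3 : ∑ i, ∫ x, pd i (fun y => u y i) x * φ x = ∫ x, dv u x * φ x := by
    rw [← integral_finsetSum _ fun i _ =>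
      integrable_mul_of_tsupport_subset hU (hpi i) p1.continuous p2 p3]
    simp only [dv, Finset.sum_mul]
  have hsum := Finset.sum_congr (rfl : (Finset.univ : Finset (Fin 3)) = Finset.univ) fun i _ => e0 i
  simp only [e1, e2, e3] at hsum
  simp only [mul_neg, Finset.sum_neg_distrib, Finset.sum_add_distrib, ← Finset.mul_sum, s1, s2, s3,
    neg_neg, sub_neg_eq_add] at hsum
  have e4 : (fun x => dv u x * (lap φ x + (kP lam mu om : ℂ) ^ 2 * φ x)) =
      fun x => dv u x * lap φ x + (kP lam mu om : ℂ) ^ 2 * (dv u x * φ x) := by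
    funext x; ring
  rw [e4, integral_add (integrable_mul_of_tsupport_subset hU hp.continuousOn l1.continuous l2 l3)
    ((integrable_mul_of_tsupport_subset hU hp.continuousOn p1.continuous p2 p3).const_mul _),
    integral_const_mul]
  apply mul_left_cancel₀ hlam
  have := kP_sq (om := om) hlm
  linear_combination -hsum + (∫ x, dv u x * φ x) * this

/-- A solution of the Navier equation is the sum of its pressure part and its shear part. Although
the field is only `C²`, both parts are, as the divergence solves a Helmholtz equation and is
smooth. -/
lemma psDecomp_of_navier {lam mu om : ℝ} (hmu : 0 < mu) (hlm : 0 < lam + 2 * mu) (hom : 0 < om)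
    {U : Set Space} (hU : IsOpen U) {u : Space → CVec} (hu : ContDiffOn ℝ 2 u U)
    (hN : ∀ x ∈ U, lameOp lam mu u x + om ^ 2 • u x = 0) :
    PSDecomp (kP lam mu om) (kS mu om) U u (pressurePart lam mu om u) (shearPart mu om u) := by
  have hat : ∀ x ∈ U, ContDiffAt ℝ 2 u x := fun x hx => hu.contDiffAt (hU.mem_nhds hx)
  have hkp := kP_pos hlm hom
  have hks := kS_pos hmu hom
  have hw := weakHelm_dv (om := om) hlm hU hu hN
  have hps := hw.contDiffOn hkp hU
  have hpl := hw.lap_add hkp hU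
  set p := dv u with hp
  set k₁ := kP lam mu om with hk₁
  set k₂ := kS mu om with hk₂
  have hk₁c : (k₁ : ℂ) ≠ 0 := by exact_mod_cast hkp.ne'
  have hk₂c : (k₂ : ℂ) ≠ 0 := by exact_mod_cast hks.ne'
  have hmuc : (mu : ℂ) ≠ 0 := by exact_mod_cast hmu.ne'
  have h1 := kP_sq (om := om) hlm
  have h2 := kS_sq (om := om) hmu
  rw [← hk₁] at h1
  rw [← hk₂] at h2
  have hpat : ∀ x ∈ U, ContDiffAt ℝ ∞ p x := fun x hx => hps.contDiffAt (hU.mem_nhds hx)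
  have hpd : ∀ x ∈ U, ∀ i, ContDiffAt ℝ ∞ (pd i p) x := fun x hx i =>
    contDiffAt_pd (hpat x hx) (by simp) i
  have d1 : ∀ {f : Space → ℂ} {x}, ContDiffAt ℝ ∞ f x → DifferentiableAt ℝ f x := fun hf =>
    hf.differentiableAt (by simp)
  have hv : ∀ x ∈ U, ∀ i, (pressurePart lam mu om u x) i = -(1 / (k₁ : ℂ) ^ 2) * pd i p x :=
    fun x hx i => pressurePart_apply (hat x hx) i
  have hnav : ∀ x ∈ U, ∀ i, mu * lap (fun y => u y i) x + (lam + mu) * pd i p x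
      + om ^ 2 * u x i = 0 := by
    intro x hx i
    have h1 := congrArg (fun z : CVec => z i) (hN x hx)
    simp only [PiLp.add_apply, PiLp.smul_apply, lameOp_apply (hat x hx), PiLp.zero_apply,
      Complex.real_smul] at h1
    push_cast at h1
    exact h1
  have hsum : ∀ x ∈ U, ∀ i, (shearPart mu om u x) i = u x i - (pressurePart lam mu om u x) i := by
    intro x hx i
    rw [hv x hx, shearPart_apply (hat x hx), ← hp, ← hk₂]
    have hn := hnav x hx i
    have hl : lap (fun y => u y i) x = -((lam + mu) * pd i p x + om ^ 2 * u x i) / mu := by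
      rw [eq_div_iff hmuc]; linear_combination hn
    rw [hl, ← h2]
    have h3 : (lam + 2 * mu : ℂ) = k₂ ^ 2 * mu / k₁ ^ 2 := by
      rw [eq_div_iff (pow_ne_zero 2 hk₁c)]; linear_combination h1 - h2
    have h4 : (lam + mu : ℂ) = k₂ ^ 2 * mu / k₁ ^ 2 - mu := by linear_combination h3
    rw [h4]
    field_simp
    ring
  have hvev : ∀ x ∈ U, ∀ i, (fun y => (pressurePart lam mu om u y) i) =ᶠ[𝓝 x]
      fun y => -(1 / (k₁ : ℂ) ^ 2) * pd i p y := fun x hx i => by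
    filter_upwards [hU.mem_nhds hx] with y hy using hv y hy i
  have hvs : ∀ i, ContDiffOn ℝ ∞ (fun x => (pressurePart lam mu om u x) i) U := fun i x hx =>
    ((contDiffAt_const.mul (hpd x hx i)).congr_of_eventuallyEq (hvev x hx i)).contDiffWithinAt
  have hvs2 : ∀ i, ContDiffOn ℝ 2 (fun x => (pressurePart lam mu om u x) i) U := fun i =>
    (hvs i).of_le two_le_infty
  have hpdv : ∀ x ∈ U, ∀ i j, pd j (fun y => (pressurePart lam mu om u y) i) x =
      -(1 / (k₁ : ℂ) ^ 2) * pd j (pd i p) x := fun x hx i j => by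
    rw [pd_congr (hvev x hx i), pd_const_mul (d1 (hpd x hx i))]
  have hlapv : ∀ x ∈ U, ∀ i, lap (fun y => (pressurePart lam mu om u y) i) x +
      (k₁ : ℂ) ^ 2 * (pressurePart lam mu om u x) i = 0 := by
    intro x hx i
    have e1 : lap (fun y => (pressurePart lam mu om u y) i) x =
        -(1 / (k₁ : ℂ) ^ 2) * pd i (lap p) x := by
      have e3 : pd i (lap p) x = ∑ j, pd i (pd j (pd j p)) x := by
        change pd i (fun y => ∑ j, pd j (pd j p) y) x = _
        exact pd_sum (fun j _ => d1 (contDiffAt_pd (hpd x hx j) (by simp) j)) i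
      rw [e3, lap, Finset.mul_sum]
      refine Finset.sum_congr rfl fun j _ => ?_
      have e2 : pd j (fun y => (pressurePart lam mu om u y) i) =ᶠ[𝓝 x]
          fun y => -(1 / (k₁ : ℂ) ^ 2) * pd i (pd j p) y := by
        filter_upwards [hU.mem_nhds hx] with y hy
        rw [hpdv y hy, pd_comm ((hpat y hy).of_le two_le_infty)]
      rw [pd_congr e2, pd_const_mul (d1 (contDiffAt_pd (hpd x hx j) (by simp) i)),
        pd_comm ((hpd x hx j).of_le two_le_infty)]
    have e4 : lap p =ᶠ[𝓝 x] fun y => -(k₁ : ℂ) ^ 2 * p y := by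
      filter_upwards [hU.mem_nhds hx] with y hy
      linear_combination hpl y hy
    rw [e1, pd_congr e4, pd_const_mul (d1 (hpat x hx)), hv x hx]
    ring
  have hwev : ∀ x ∈ U, ∀ i, (fun y => (shearPart mu om u y) i) =ᶠ[𝓝 x]
      fun y => u y i - (pressurePart lam mu om u y) i := fun x hx i => by
    filter_upwards [hU.mem_nhds hx] with y hy using hsum y hy i
  have hcu := fun i => contDiffOn_comp hu i
  have c1 : ∀ {f : Space → ℂ}, ContDiffOn ℝ 2 f U → ∀ x ∈ U, DifferentiableAt ℝ f x :=
    fun hf x hx => (hf.contDiffAt (hU.mem_nhds hx)).differentiableAt (by norm_num)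
  have c2 : ∀ {f : Space → ℂ}, ContDiffOn ℝ 2 f U → ∀ i, ∀ x ∈ U, DifferentiableAt ℝ (pd i f) x :=
    fun hf i x hx => (contDiffAt_pd (hf.contDiffAt (hU.mem_nhds hx))
        (m := 1) (by norm_num) i).differentiableAt
      (by norm_num)
  refine ⟨fun x hx i => by rw [hsum x hx]; ring, hvs2, fun i x hx => ?_, hlapv, fun x hx i => ?_,
    fun x hx i j => ?_, fun x hx => ?_⟩
  · exact ((((hcu i).sub (hvs2 i)).contDiffAt (hU.mem_nhds hx)).congr_of_eventuallyEq
      (hwev x hx i)).contDiffWithinAt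
  · have e1 : lap (fun y => (shearPart mu om u y) i) x = lap (fun y => u y i) x -
        lap (fun y => (pressurePart lam mu om u y) i) x := by
      rw [lap_congr (hwev x hx i)]
      simp only [lap, ← Finset.sum_sub_distrib]
      refine Finset.sum_congr rfl fun j _ => ?_
      have : pd j (fun y => u y i - (pressurePart lam mu om u y) i) =ᶠ[𝓝 x]
          fun y => pd j (fun y => u y i) y - pd j (fun y => (pressurePart lam mu om u y) i) y := by
        filter_upwards [hU.mem_nhds hx] with y hy
        exact pd_sub (c1 (hcu i) y hy) (c1 (hvs2 i) y hy) j
      rw [pd_congr this, pd_sub (c2 (hcu i) j x hx) (c2 (hvs2 i) j x hx)]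
    rw [e1, hsum x hx]
    have hn := hnav x hx i
    have hl := hlapv x hx i
    have hvx := hv x hx i
    have hpx : pd i p x = -(k₁ : ℂ) ^ 2 * (pressurePart lam mu om u x) i := by
      rw [hvx]; field_simp
    rw [hpx] at hn
    apply mul_left_cancel₀ hmuc
    linear_combination hn - mu * hl + (u x i - (pressurePart lam mu om u x) i) * h2
      + (pressurePart lam mu om u x) i * h1
  · rw [hpdv x hx, hpdv x hx, pd_comm ((hpat x hx).of_le two_le_infty)]
  · have : dv (shearPart mu om u) x = p x - ∑ i, -(1 / (k₁ : ℂ) ^ 2) * pd i (pd i p) x := by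
      rw [hp, dv, dv, ← Finset.sum_sub_distrib]
      refine Finset.sum_congr rfl fun i _ => ?_
      rw [pd_congr (hwev x hx i), pd_sub (c1 (hcu i) x hx) (c1 (hvs2 i) x hx), hpdv x hx]
    rw [this, ← Finset.mul_sum]
    have := hpl x hx
    rw [lap] at this
    field_simp
    linear_combination this

/-! ### Testing with functions of vanishing trace -/

lemma enorm_integral_mul_le {μ : Measure Space} {f g : Space → ℂ} (hf : AEStronglyMeasurable f μ)
    (hg : AEStronglyMeasurable g μ) :
    ‖∫ x, f x * g x ∂μ‖ₑ ≤ eLpNorm f 2 μ * eLpNorm g 2 μ := by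
  refine (enorm_integral_le_lintegral_enorm _).trans ?_
  rw [← eLpNorm_one_eq_lintegral_enorm]
  have := eLpNorm_smul_le_mul_eLpNorm (p := 2) (q := 2) (r := 1) (μ := μ) hg hf
  exact this

/-- A bounded linear condition passes to limits in `L²`. -/
lemma integral_sum_mul_conj_eq_zero {ι : Type*} [Fintype ι] {μ : Measure Space}
    {g f : ι → Space → ℂ} (hg : ∀ i, MemLp (g i) 2 μ) (hf : ∀ i, MemLp (f i) 2 μ)
    (H : ∀ ε : ENNReal, 0 < ε → ∃ f' : ι → Space → ℂ, (∀ i, MemLp (f' i) 2 μ) ∧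
      (∀ i, eLpNorm (fun x => f i x - f' i x) 2 μ ≤ ε) ∧
      ∫ x, ∑ i, g i x * (starRingEnd ℂ) (f' i x) ∂μ = 0) :
    Integrable (fun x => ∑ i, g i x * (starRingEnd ℂ) (f i x)) μ ∧
      ∫ x, ∑ i, g i x * (starRingEnd ℂ) (f i x) ∂μ = 0 := by
  have hstar : ∀ {f : Space → ℂ}, MemLp f 2 μ → MemLp (fun x => (starRingEnd ℂ) (f x)) 2 μ :=
    fun hf => hf.star
  have hint : ∀ {f : ι → Space → ℂ}, (∀ i, MemLp (f i) 2 μ) → ∀ i,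
      Integrable (fun x => g i x * (starRingEnd ℂ) (f i x)) μ := fun hf i =>
    (hg i).integrable_mul (hstar (hf i))
  refine ⟨integrable_finsetSum _ fun i _ => hint hf i, ?_⟩
  set C : ENNReal := ∑ i, eLpNorm (g i) 2 μ with hC
  have hCtop : C ≠ ⊤ := (ENNReal.sum_lt_top.2 fun i _ => (hg i).2).ne
  have hle : ∀ ε : ENNReal, 0 < ε →
      ‖∫ x, ∑ i, g i x * (starRingEnd ℂ) (f i x) ∂μ‖ₑ ≤ C * ε := by
    intro ε hε
    obtain ⟨f', h1, h2, h3⟩ := H ε hε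
    have e : ∫ x, ∑ i, g i x * (starRingEnd ℂ) (f i x) ∂μ =
        ∑ i, ∫ x, g i x * (starRingEnd ℂ) (f i x - f' i x) ∂μ := by
      rw [← sub_zero (∫ x, ∑ i, g i x * (starRingEnd ℂ) (f i x) ∂μ), ← h3,
        ← integral_sub (integrable_finsetSum _ fun i _ => hint hf i)
          (integrable_finsetSum _ fun i _ => hint h1 i),
        ← integral_finsetSum _ fun i _ => hint (f := fun i x => f i x - f' i x)
          (fun i => (hf i).sub (h1 i)) i]
      congr 1
      funext x
      rw [← Finset.sum_sub_distrib]
      refine Finset.sum_congr rfl fun i _ => ?_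
      rw [map_sub]; ring
    rw [e, hC, Finset.sum_mul]
    refine (enorm_sum_le _ _).trans (Finset.sum_le_sum fun i _ => ?_)
    have hs : MemLp (fun x => f i x - f' i x) 2 μ := (hf i).sub (h1 i)
    refine (enorm_integral_mul_le (hg i).1 (hstar hs).1).trans ?_
    gcongr
    refine le_trans (le_of_eq ?_) (h2 i)
    exact eLpNorm_congr_norm_ae (Eventually.of_forall fun x => Complex.norm_conj _)
  have hlim : Tendsto (fun n : ℕ => C * (n : ENNReal)⁻¹) atTop (𝓝 (C * 0)) :=
    ENNReal.Tendsto.const_mul ENNReal.tendsto_inv_nat_nhds_zero (Or.inr hCtop)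
  rw [mul_zero] at hlim
  have := ge_of_tendsto' hlim fun n => hle _ (by simp)
  simpa using this

lemma norm_comp_le (z : CVec) (j : Fin 3) : ‖z j‖ ≤ ‖z‖ := PiLp.norm_apply_le z j

lemma memLp_test {φ : Space → ℂ} (h1 : Continuous φ) (h2 : HasCompactSupport φ) (Ω : Set Space) :
    MemLp φ 2 (volume.restrict Ω) :=
  (h1.memLp_of_hasCompactSupport h2).restrict Ω

/-- Approximation in `H¹` by test functions, in components. -/
lemma MemH10.exists_approx {Ω : Set Space} (hΩ : IsOpen Ω) {w : Space → CVec}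
    (hw : ContDiffOn ℝ 1 w Ω) (h : MemH10 Ω w) {ε : ENNReal} (hε : 0 < ε) :
    ∃ φ : Fin 3 → Space → ℂ, (∀ j, ContDiff ℝ ∞ (φ j)) ∧ (∀ j, HasCompactSupport (φ j)) ∧
      (∀ j, tsupport (φ j) ⊆ Ω) ∧
      (∀ j, eLpNorm (fun x => w x j - φ j x) 2 (volume.restrict Ω) ≤ ε) ∧
      ∀ i j, eLpNorm (fun x => pd i (fun y => w y j) x - pd i (φ j) x)
          2 (volume.restrict Ω) ≤ ε := by
  obtain ⟨φ, h1, h2, h3, h4, h5⟩ := h ε hε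
  have hsup : ∀ j, tsupport (fun x => φ x j) ⊆ tsupport φ := fun j =>
    closure_mono fun x hx hn => hx (by simp [hn])
  refine ⟨fun j x => φ x j, fun j => (contDiff_piLp 2).1 h1 j,
    fun j => h2.mono' ((subset_tsupport _).trans (hsup j)), fun j => (hsup j).trans h3,
    fun j => (eLpNorm_mono fun x => ?_).trans h4, fun i j => (eLpNorm_mono_ae ?_).trans h5⟩
  · exact norm_comp_le (w x - φ x) j
  · refine (ae_restrict_iff' hΩ.measurableSet).2 (Eventually.of_forall fun x hx => ?_)
    have d1 : DifferentiableAt ℝ w x :=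
      (hw.contDiffAt (hΩ.mem_nhds hx)).differentiableAt (by norm_num)
    have d2 : DifferentiableAt ℝ φ x := h1.differentiable (by simp) x
    rw [← pderiv_eq_pd d1, ← pderiv_eq_pd d2, pderiv, pderiv]
    refine (norm_comp_le ((fderiv ℝ w x - fderiv ℝ φ x) (EuclideanSpace.single i 1)) j).trans
      (((fderiv ℝ w x - fderiv ℝ φ x).le_opNorm _).trans ?_)
    simp

lemma MemH10.memLp {Ω : Set Space} (hΩ : IsOpen Ω) {w : Space → CVec}
    (hw : ContDiffOn ℝ 1 w Ω) (h : MemH10 Ω w) :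
    (∀ j, MemLp (fun x => w x j) 2 (volume.restrict Ω)) ∧
      ∀ i j, MemLp (pd i fun y => w y j) 2 (volume.restrict Ω) := by
  obtain ⟨φ, h1, h2, h3, h4, h5⟩ := h.exists_approx hΩ hw (ε := 1) one_pos
  constructor
  · intro j
    have hm : MemLp (fun x => w x j - φ j x) 2 (volume.restrict Ω) :=
      ⟨(((contDiffOn_comp hw j).continuousOn).sub
        (h1 j).continuous.continuousOn).aestronglyMeasurable hΩ.measurableSet,
        (h4 j).trans_lt ENNReal.one_lt_top⟩
    have := hm.add (memLp_test (h1 j).continuous (h2 j) Ω)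
    simpa [Pi.add_def] using this
  · intro i j
    have hm : MemLp (fun x => pd i (fun y => w y j) x - pd i (φ j) x) 2 (volume.restrict Ω) :=
      ⟨((contDiffOn_pd hΩ (contDiffOn_comp hw j) (m := 0) (by norm_num) i).continuousOn.sub
        (contDiff_pd (h1 j) i).continuous.continuousOn).aestronglyMeasurable hΩ.measurableSet,
        (h5 i j).trans_lt ENNReal.one_lt_top⟩
    have := hm.add (memLp_test (contDiff_pd (h1 j) i).continuous (hasCompactSupport_pd (h2 j) i) Ω)
    simpa [Pi.add_def] using this

/-- A first order bilinear condition that holds for test functions holds for functions in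
`H¹₀`. -/
lemma MemH10.integral_eq_zero {Ω : Set Space} (hΩ : IsOpen Ω) {w : Space → CVec}
    (hw : ContDiffOn ℝ 1 w Ω) (h : MemH10 Ω w) {g : Fin 3 → Space → ℂ}
    {G : Fin 3 → Fin 3 → Space → ℂ} (hg : ∀ j, MemLp (g j) 2 (volume.restrict Ω))
    (hG : ∀ i j, MemLp (G i j) 2 (volume.restrict Ω))
    (H : ∀ φ : Fin 3 → Space → ℂ, (∀ j, ContDiff ℝ ∞ (φ j)) → (∀ j, HasCompactSupport (φ j)) →
      (∀ j, tsupport (φ j) ⊆ Ω) → ∫ x in Ω, (∑ j, g j x * (starRingEnd ℂ) (φ j x) +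
        ∑ i, ∑ j, G i j x * (starRingEnd ℂ) (pd i (φ j) x)) = 0) :
    IntegrableOn (fun x => ∑ j, g j x * (starRingEnd ℂ) (w x j) +
        ∑ i, ∑ j, G i j x * (starRingEnd ℂ) (pd i (fun y => w y j) x)) Ω ∧
    ∫ x in Ω, (∑ j, g j x * (starRingEnd ℂ) (w x j) +
        ∑ i, ∑ j, G i j x * (starRingEnd ℂ) (pd i (fun y => w y j) x)) = 0 := by
  obtain ⟨m1, m2⟩ := h.memLp hΩ hw
  have key := integral_sum_mul_conj_eq_zero (ι := Fin 3 ⊕ (Fin 3 × Fin 3)) (μ := volume.restrict Ω)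
    (g := Sum.elim g fun p => G p.1 p.2)
    (f := Sum.elim (fun j x => w x j) fun p => pd p.1 fun y => w y p.2)
    (by rintro (j | ⟨i, j⟩); exacts [hg j, hG i j])
    (by rintro (j | ⟨i, j⟩); exacts [m1 j, m2 i j]) (by
      intro ε hε
      obtain ⟨φ, h1, h2, h3, h4, h5⟩ := h.exists_approx hΩ hw hε
      refine ⟨Sum.elim φ fun p => pd p.1 (φ p.2), ?_, ?_, ?_⟩
      · rintro (j | ⟨i, j⟩)
        exacts [memLp_test (h1 j).continuous (h2 j) Ω,
          memLp_test (contDiff_pd (h1 j) i).continuous (hasCompactSupport_pd (h2 j) i) Ω]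
      · rintro (j | ⟨i, j⟩)
        exacts [h4 j, h5 i j]
      · simpa [Fintype.sum_sum_type, Fintype.sum_prod_type] using H φ h1 h2 h3)
  simpa [Fintype.sum_sum_type, Fintype.sum_prod_type, IntegrableOn] using key

/-- A smooth cut-off function that equals one on a given ball. -/
lemma exists_cutoff (R : ℝ) : ∃ χ : Space → ℝ, ContDiff ℝ ∞ χ ∧ HasCompactSupport χ ∧
    ∀ x ∈ ball (0 : Space) R, χ x = 1 := by
  let B : ContDiffBump (0 : Space) := ⟨|R| + 1, |R| + 2, by positivity, by linarith⟩
  refine ⟨B, B.contDiff, B.hasCompactSupport, fun x hx => B.one_of_mem_closedBall ?_⟩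
  rw [mem_ball_zero_iff] at hx
  rw [mem_closedBall_zero_iff]
  change ‖x‖ ≤ |R| + 1
  linarith [le_abs_self R]

lemma exists_tsupport_subset_ball {χ : Space → ℝ} (hc : HasCompactSupport χ) :
    ∃ R, tsupport χ ⊆ ball (0 : Space) R :=
  hc.isCompact.isBounded.subset_ball 0

lemma memLp_mul_of_hasCompactSupport {Ω : Set Space} {χ : Space → ℝ} {f : Space → ℂ}
    (h1 : Continuous χ) (h2 : HasCompactSupport χ) (hf : MemLp f 2 (volume.restrict Ω)) :
    MemLp (fun x => (χ x : ℂ) * f x) 2 (volume.restrict Ω) := by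
  obtain ⟨C, hC⟩ := h1.bounded_above_of_compact_support h2
  refine MemLp.of_le_mul (c := C) hf
    ((Complex.continuous_ofReal.comp h1).aestronglyMeasurable.mul hf.1)
    (Eventually.of_forall fun x => ?_)
  rw [norm_mul, Complex.norm_real]
  exact mul_le_mul_of_nonneg_right (hC x) (norm_nonneg _)

lemma pd_ofReal {χ : Space → ℝ} {x : Space} (hχ : DifferentiableAt ℝ χ x) (i : Fin 3) :
    pd i (fun y => (χ y : ℂ)) x = ((pd i χ x : ℝ) : ℂ) := by
  have := (Complex.ofRealCLM.hasFDerivAt.comp x hχ.hasFDerivAt).fderiv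
  simp only [pd]
  change fderiv ℝ (⇑Complex.ofRealCLM ∘ χ) x _ = _
  rw [this]; rfl

/-- The energy identity: the flux of a solution with vanishing trace through any surface around
the obstacle vanishes, here integrated against the gradient of a cut-off function `χ`. -/
lemma HasZeroTrace.integral_flux_eq_zero {Ω : Set Space} (hΩ : IsOpen Ω) {u : Space → CVec}
    (hu : ContDiffOn ℝ 2 u Ω) {a b c : ℝ}
    (hN : ∀ x ∈ Ω, ∀ j, a * lap (fun y => u y j) x + b * pd j (dv u) x + c * u x j = 0)
    (hz : HasZeroTrace Ω u) {χ : Space → ℝ} (h1 : ContDiff ℝ ∞ χ) (h2 : HasCompactSupport χ) :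
    ∫ x in Ω, (∑ i, ((pd i χ x : ℝ) : ℂ) *
        (a * ∑ j, pd i (fun y => u y j) x * (starRingEnd ℂ) (u x j) +
      b * dv u x * (starRingEnd ℂ) (u x i))).im = 0 := by
  obtain ⟨R, hR⟩ := exists_tsupport_subset_ball h2
  obtain ⟨η, e1, e2, e3⟩ := exists_cutoff R
  have hw0 := hz η e1 e2
  set w : Space → CVec := fun x => η x • u x with hw
  have hwC : ContDiffOn ℝ 2 w Ω := (e1.of_le two_le_infty).contDiffOn.smul hu
  have hwu : ∀ x ∈ tsupport χ, w =ᶠ[𝓝 x] u := by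
    intro x hx
    filter_upwards [isOpen_ball.mem_nhds (hR hx)] with y hy
    simp [hw, e3 y hy]
  have hwu' : ∀ x ∈ tsupport χ, ∀ i j, pd i (fun y => w y j) x = pd i (fun y => u y j) x := by
    intro x hx i j
    refine pd_congr ?_ i
    filter_upwards [hwu x hx] with y hy
    rw [hy]
  have hwd : ∀ x ∈ tsupport χ, dv w x = dv u x := fun x hx =>
    Finset.sum_congr rfl fun i _ => hwu' x hx i i
  obtain ⟨m1, m2⟩ := hw0.memLp hΩ (hwC.of_le (by norm_num))
  have m3 : MemLp (dv w) 2 (volume.restrict Ω) := memLp_finsetSum _ fun i _ => m2 i i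
  have hpc : ∀ i, Continuous (pd i χ) := fun i => (contDiff_pd h1 i).continuous
  have hps : ∀ i, HasCompactSupport (pd i χ) := fun i =>
    h2.mono' ((subset_tsupport _).trans (tsupport_pd_subset χ i))
  set g : Fin 3 → Space → ℂ := fun j x => a * ∑ i, ((pd i χ x : ℝ) : ℂ) * pd i (fun y => w y j) x +
    b * (((pd j χ x : ℝ) : ℂ) * dv w x) - c * ((χ x : ℂ) * w x j) with hg
  set G : Fin 3 → Fin 3 → Space → ℂ := fun i j x => a * ((χ x : ℂ) * pd i (fun y => w y j) x) +
    (if i = j then (b : ℂ) else 0) * ((χ x : ℂ) * dv w x) with hG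
  have hgm : ∀ j, MemLp (g j) 2 (volume.restrict Ω) := fun j =>
    ((((memLp_finsetSum _ fun i _ => memLp_mul_of_hasCompactSupport (hpc i) (hps i)
      (m2 i j)).const_mul _).add
          ((memLp_mul_of_hasCompactSupport (hpc j) (hps j) m3).const_mul _)).sub
      ((memLp_mul_of_hasCompactSupport h1.continuous h2 (m1 j)).const_mul _))
  have hGm : ∀ i j, MemLp (G i j) 2 (volume.restrict Ω) := fun i j =>
    ((memLp_mul_of_hasCompactSupport h1.continuous h2 (m2 i j)).const_mul _).add
      ((memLp_mul_of_hasCompactSupport h1.continuous h2 m3).const_mul _)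
  have hdC : ContDiffOn ℝ 1 (dv u) Ω := fun x hx =>
    (contDiffAt_dv (hu.contDiffAt (hΩ.mem_nhds hx)) (by norm_num)).contDiffWithinAt
  have key := hw0.integral_eq_zero hΩ (hwC.of_le (by norm_num)) hgm hGm (by
    intro φ p1 p2 p3
    -- the equation is tested with the functions `χ φ̄`
    set ψ : Fin 3 → Space → ℂ := fun j x => (χ x : ℂ) * (starRingEnd ℂ) (φ j x) with hψ
    have hχc : ContDiff ℝ ∞ fun x => (χ x : ℂ) := Complex.ofRealCLM.contDiff.comp h1
    have hφc : ∀ j, ContDiff ℝ ∞ fun x => (starRingEnd ℂ) (φ j x) := fun j =>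
      Complex.conjCLE.toContinuousLinearMap.contDiff.comp (p1 j)
    have q1 : ∀ j, ContDiff ℝ ∞ (ψ j) := fun j => hχc.mul (hφc j)
    have hsub : ∀ j, tsupport (ψ j) ⊆ tsupport (φ j) := fun j =>
      closure_mono fun x hx hn => hx (by simp [hψ, hn])
    have hsub' : ∀ j, tsupport (ψ j) ⊆ tsupport χ := fun j =>
      closure_mono fun x hx hn => hx (by simp [hψ, hn])
    have q2 : ∀ j, HasCompactSupport (ψ j) := fun j =>
      (p2 j).mono' ((subset_tsupport _).trans (hsub j))
    have q3 : ∀ j, tsupport (ψ j) ⊆ Ω := fun j => (hsub j).trans (p3 j)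
    set f : Fin 3 → Fin 3 → Space → ℂ := fun i j x => a * pd i (fun y => u y j) x +
      (if i = j then (b : ℂ) else 0) * dv u x with hf
    have hfC : ∀ i j, ContDiffOn ℝ 1 (f i j) Ω := fun i j =>
      (contDiffOn_const.mul (contDiffOn_pd hΩ (contDiffOn_comp hu j) (by norm_num) i)).add
        (contDiffOn_const.mul hdC)
    have hfp : ∀ x ∈ Ω, ∀ j, ∑ i, pd i (f i j) x = -(c * u x j) := by
      intro x hx j
      have dd : DifferentiableAt ℝ (dv u) x :=
        (hdC.contDiffAt (hΩ.mem_nhds hx)).differentiableAt (by norm_num)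
      have d1 : ∀ i, DifferentiableAt ℝ (pd i fun y => u y j) x := fun i =>
        (contDiffAt_pd ((contDiffOn_comp hu j).contDiffAt (hΩ.mem_nhds hx)) (m := 1)
          (by norm_num) i).differentiableAt (by norm_num)
      have : ∀ i, pd i (f i j) x = a * pd i (pd i fun y => u y j) x +
          (if i = j then (b : ℂ) else 0) * pd i (dv u) x := by
        intro i
        rw [hf, pd_add ((d1 i).const_mul _) (dd.const_mul _), pd_const_mul (d1 i), pd_const_mul dd]
      simp only [this, Finset.sum_add_distrib, ← Finset.mul_sum, ite_mul, zero_mul,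
        Finset.sum_ite_eq', Finset.mem_univ, if_true]
      have h3 := hN x hx j
      simp only [lap] at h3
      linear_combination h3
    have hI : ∫ x, ∑ j, (∑ i, f i j x * pd i (ψ j) x - c * (u x j * ψ j x)) = 0 := by
      have k1 : ∀ i j, Integrable fun x => f i j x * pd i (ψ j) x := fun i j =>
        integrable_mul_of_tsupport_subset hΩ (hfC i j).continuousOn
          (contDiff_pd (q1 j) i).continuous (hasCompactSupport_pd (q2 j) i)
          ((tsupport_pd_subset _ i).trans (q3 j))
      have k2 : ∀ j, Integrable fun x => u x j * ψ j x := fun j =>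
        integrable_mul_of_tsupport_subset hΩ (contDiffOn_comp hu j).continuousOn
          (q1 j).continuous (q2 j) (q3 j)
      have k3 : ∀ i j, Integrable fun x => pd i (f i j) x * ψ j x := fun i j =>
        integrable_mul_of_tsupport_subset hΩ
          (contDiffOn_pd hΩ (hfC i j) (m := 0) (by norm_num) i).continuousOn
          (q1 j).continuous (q2 j) (q3 j)
      have k5 : ∀ j, Integrable fun x => ∑ i, f i j x * pd i (ψ j) x - c * (u x j * ψ j x) :=
        fun j => (integrable_finsetSum _ fun i _ => k1 i j).sub ((k2 j).const_mul _)
      rw [integral_finsetSum _ fun j _ => k5 j]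
      refine Finset.sum_eq_zero fun j _ => ?_
      rw [integral_sub (integrable_finsetSum _ fun i _ => k1 i j) ((k2 j).const_mul _),
        integral_finsetSum _ fun i _ => k1 i j]
      have k4 : ∀ i, ∫ x, f i j x * pd i (ψ j) x = -∫ x, pd i (f i j) x * ψ j x := fun i =>
        integral_mul_pd hΩ (hfC i j) (q1 j) (q2 j) (q3 j) i
      simp only [k4, Finset.sum_neg_distrib]
      have k6 : Integrable fun x => -∑ i, pd i (f i j) x * ψ j x :=
        (integrable_finsetSum _ fun i _ => k3 i j).neg
      rw [← integral_finsetSum _ fun i _ => k3 i j, ← integral_neg,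
        ← integral_sub k6 ((k2 j).const_mul _)]
      refine integral_eq_zero_of_ae (Eventually.of_forall fun x => ?_)
      by_cases hx : x ∈ tsupport (ψ j)
      · have h3 := hfp x (q3 j hx) j
        simp only [← Finset.sum_mul, h3, Pi.zero_apply]
        ring
      · simp [image_eq_zero_of_notMem_tsupport hx]
    have hψ0 : ∀ x j, x ∉ tsupport (ψ j) → ψ j x = 0 ∧ ∀ i, pd i (ψ j) x = 0 := fun x j hx =>
      ⟨image_eq_zero_of_notMem_tsupport hx, fun i =>
        image_eq_zero_of_notMem_tsupport fun h => hx (tsupport_pd_subset _ i h)⟩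
    have hI' := setIntegral_eq_integral_of_forall_compl_eq_zero (μ := volume) (s := Ω)
      (f := fun x => ∑ j, (∑ i, f i j x * pd i (ψ j) x - c * (u x j * ψ j x))) (by
        intro x hx
        refine Finset.sum_eq_zero fun j _ => ?_
        obtain ⟨h3, h4⟩ := hψ0 x j fun h => hx (q3 j h)
        simp [h3, h4])
    rw [← hI, ← hI']
    refine setIntegral_congr_fun hΩ.measurableSet fun x hx => ?_
    by_cases hxχ : x ∈ tsupport χ
    · have hp : ∀ i j, pd i (ψ j) x = ((pd i χ x : ℝ) : ℂ) * (starRingEnd ℂ) (φ j x) +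
          (χ x : ℂ) * (starRingEnd ℂ) (pd i (φ j) x) := by
        intro i j
        have dφ := (p1 j).differentiable (by simp) x
        rw [hψ, pd_mul (hχc.differentiable (by simp) x) ((hφc j).differentiable (by simp) x),
          pd_ofReal (h1.differentiable (by simp) x), pd_conj i dφ]
      have hwx : ∀ j, w x j = u x j := fun j => by rw [(hwu x hxχ).self_of_nhds]
      have hψx : ∀ j, ψ j x = (χ x : ℂ) * (starRingEnd ℂ) (φ j x) := fun _ => rfl
      simp only [hg, hG, hf, hp, hψx, hwu' x hxχ, hwd x hxχ, hwx]
      simp only [Fin.sum_univ_three]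
      simp
      ring
    · have z1 : χ x = 0 := image_eq_zero_of_notMem_tsupport hxχ
      have z2 : ∀ i, pd i χ x = 0 := fun i =>
        image_eq_zero_of_notMem_tsupport fun h => hxχ (tsupport_pd_subset _ i h)
      have z3 := fun j => hψ0 x j fun h => hxχ (hsub' j h)
      simp [hg, hG, z1, z2, (z3 _).1, (z3 _).2])
  have him := integral_im key.1
  have h0 : ∫ x in Ω, RCLike.im (∑ j, g j x * (starRingEnd ℂ) (w x j) +
        ∑ i, ∑ j, G i j x * (starRingEnd ℂ) (pd i (fun y => w y j) x)) = 0 := by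
    rw [him, key.2]; simp
  rw [← h0]
  refine setIntegral_congr_fun hΩ.measurableSet fun x hx => ?_
  by_cases hxχ : x ∈ tsupport χ
  · have hwx : ∀ j, w x j = u x j := fun j => by rw [(hwu x hxχ).self_of_nhds]
    have hsq : ∀ z : ℂ, z * (starRingEnd ℂ) z = ((Complex.normSq z : ℝ) : ℂ) := Complex.mul_conj
    have e : ∑ j, g j x * (starRingEnd ℂ) (w x j) +
        ∑ i, ∑ j, G i j x * (starRingEnd ℂ) (pd i (fun y => w y j) x) =
      ∑ i, ((pd i χ x : ℝ) : ℂ) * (a * ∑ j, pd i (fun y => u y j) x * (starRingEnd ℂ) (u x j) +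
        b * dv u x * (starRingEnd ℂ) (u x i)) +
      ((-(c * χ x * ∑ j, Complex.normSq (u x j)) +
        a * χ x * (∑ i, ∑ j, Complex.normSq (pd i (fun y => u y j) x)) +
        b * χ x * Complex.normSq (dv u x) : ℝ) : ℂ) := by
      simp only [hg, hG, hwu' x hxχ, hwd x hxχ, hwx]
      push_cast
      simp only [← hsq]
      have hd : (starRingEnd ℂ) (dv u x) = ∑ i, (starRingEnd ℂ) (pd i (fun y => u y i) x) := by
        rw [dv, map_sum]
      rw [hd]
      simp only [Fin.sum_univ_three]
      simp
      ring
    refine Eq.symm ((congrArg Complex.im e).trans ?_)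
    rw [Complex.add_im, Complex.ofReal_im, add_zero]
  · have z1 : χ x = 0 := image_eq_zero_of_notMem_tsupport hxχ
    have z2 : ∀ i, pd i χ x = 0 := fun i =>
      image_eq_zero_of_notMem_tsupport fun h => hxχ (tsupport_pd_subset _ i h)
    simp [hg, hG, z1, z2]

/-! ### The flux through spheres -/

lemma isOpen_exterior (R : ℝ) : IsOpen {x : Space | R < ‖x‖} :=
  isOpen_lt continuous_const continuous_norm

/-- A radial cut-off function with prescribed radial derivative. -/
lemma exists_radial_cutoff {ψ : ℝ → ℝ} {a b : ℝ} (ha : 0 ≤ a) (hab : a < b)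
    (h1 : ContDiff ℝ ∞ ψ) (h2 : HasCompactSupport ψ) (h3 : tsupport ψ ⊆ Ioo a b) :
    ∃ χ : Space → ℝ, ContDiff ℝ ∞ χ ∧ HasCompactSupport χ ∧
      ∀ i x, pd i χ x = ψ ‖x‖ * (x i / ‖x‖) := by
  obtain ⟨a', b', k1, k2, k3, k4⟩ := exists_Icc_of_tsupport_subset hab h2 h3
  obtain ⟨ξ, x1, x2, x3, x4⟩ := exists_primitive h1 k4 k2
  have hz : ∀ s, s < a' → ψ s = 0 := fun s hs =>
    image_eq_zero_of_notMem_tsupport fun h => absurd (k4 h).1 (not_le.2 hs)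
  have hev : ∀ x : Space, ‖x‖ < a' →
      (fun y : Space => ξ ‖y‖ - ∫ t, ψ t) =ᶠ[𝓝 x] fun _ => -∫ t, ψ t := by
    intro x hx
    filter_upwards [(continuous_norm.tendsto x).eventually (gt_mem_nhds hx)] with y hy
    rw [x3 _ hy.le, zero_sub]
  refine ⟨fun x => ξ ‖x‖ - ∫ t, ψ t, ?_, ?_, fun i x => ?_⟩
  · rw [contDiff_iff_contDiffAt]
    intro x
    rcases lt_or_ge ‖x‖ a' with hx | hx
    · exact contDiffAt_const.congr_of_eventuallyEq (hev x hx)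
    · have hx0 : x ≠ 0 := norm_pos_iff.1 (ha.trans_lt (k1.trans_le hx))
      exact (x1.contDiffAt.comp x (contDiffAt_norm ℝ hx0)).sub contDiffAt_const
  · refine HasCompactSupport.intro (isCompact_closedBall (0 : Space) b') fun x hx => ?_
    have : b' ≤ ‖x‖ := by
      have : ¬ ‖x‖ ≤ b' := by simpa using hx
      exact (not_le.1 this).le
    rw [x4 _ this, sub_self]
  · rcases lt_or_ge ‖x‖ a' with hx | hx
    · rw [pd_congr (hev x hx), pd_const, hz _ hx, zero_mul]
    · have hx0 : x ≠ 0 := norm_pos_iff.1 (ha.trans_lt (k1.trans_le hx))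
      have hd : DifferentiableAt ℝ (fun y : Space => ‖y‖) x := differentiableAt_id.norm ℝ hx0
      have := ((x2 ‖x‖).comp_hasFDerivAt x hd.hasFDerivAt).sub_const (∫ t, ψ t)
      have h5 := pd_norm hx0 i
      rw [pd] at h5 ⊢
      have e := this.fderiv
      change (fderiv ℝ (fun y : Space => (ξ ∘ norm) y - ∫ t, ψ t) x) _ = _
      rw [e, ← h5]
      rfl

lemma integrable_pd_mul {U : Set Space} (hU : IsOpen U) {χ : Space → ℝ} (h1 : ContDiff ℝ ∞ χ)
    (h2 : HasCompactSupport χ) {i : Fin 3} (h3 : tsupport (pd i χ) ⊆ U) {f : Space → ℂ}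
    (hf : ContinuousOn f U) : Integrable fun x => ((pd i χ x : ℝ) : ℂ) * f x := by
  have hc := (contDiff_pd h1 i).continuous
  have hs : HasCompactSupport (pd i χ) :=
    h2.mono' ((subset_tsupport _).trans (tsupport_pd_subset χ i))
  have := integrable_mul_of_tsupport_subset hU hf (φ := fun x => ((pd i χ x : ℝ) : ℂ))
    (Complex.continuous_ofReal.comp hc) (hs.comp_left (g := fun t : ℝ => (t : ℂ)) (by simp))
    ((tsupport_comp_subset (g := fun t : ℝ => (t : ℂ)) (by simp) _).trans h3)
  exact this.congr (Eventually.of_forall fun x => mul_comm _ _)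

/-- The flux of the imaginary part of the vector field `J` through the sphere of radius `r`,
without the factor `r²`. -/
def sphereFlux (J : Fin 3 → Space → ℂ) (r : ℝ) : ℝ :=
  (∑ i, mom (J i) (fun x => (x i : ℂ)) r).im

/-- If the flux of a vector field vanishes when averaged with arbitrary cut-off functions, then it
vanishes through every sphere. -/
lemma sphereFlux_eq_zero {R : ℝ} (hR : 0 ≤ R) {J : Fin 3 → Space → ℂ}
    (hJ : ∀ i, ContinuousOn (J i) {x | R < ‖x‖})
    (H : ∀ χ : Space → ℝ, ContDiff ℝ ∞ χ → HasCompactSupport χ →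
      (∀ i, tsupport (pd i χ) ⊆ {x | R < ‖x‖}) →
      (∫ x, ∑ i, ((pd i χ x : ℝ) : ℂ) * J i x).im = 0) : ∀ r, R < r → sphereFlux J r = 0 := by
  intro r hr
  have hsh : ∀ b, shell R b ⊆ {x | R < ‖x‖} := fun b x hx => hx.1
  set M : ℝ → ℂ := fun s => ∑ i, mom (J i) (fun x => (x i : ℂ)) s with hM
  have hcoord : ∀ i : Fin 3, Continuous fun x : Space => (x i : ℂ) := fun i => by fun_prop
  have hMc : ContinuousOn M (Ioo R (r + 1)) := continuousOn_finsetSum _ fun i _ =>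
    continuousOn_mom hR ((hJ i).mono (hsh _)) (hcoord i)
  have key := eq_zero_of_integral_smul (a := R) (b := r + 1)
    (f := fun s => ((((s : ℂ) ^ 2 * M s).im : ℝ) : ℂ))
    (Complex.continuous_ofReal.comp_continuousOn (Complex.continuous_im.comp_continuousOn
      (((Complex.continuous_ofReal.pow 2).continuousOn).mul hMc))) (by
    intro ψ h1 h2 h3
    obtain ⟨χ, c1, c2, c3⟩ := exists_radial_cutoff hR (by linarith) h1 h2 h3
    have c4 : ∀ i, tsupport (pd i χ) ⊆ {x | R < ‖x‖} := by
      intro i x hx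
      have hsub : tsupport (pd i χ) ⊆ {x | ‖x‖ ∈ tsupport ψ} := by
        refine closure_minimal (fun x hx => ?_) ((isClosed_tsupport ψ).preimage continuous_norm)
        by_contra hn
        exact hx (by rw [c3, image_eq_zero_of_notMem_tsupport hn, zero_mul])
      exact (h3 (hsub hx)).1
    have hI := H χ c1 c2 c4
    rw [integral_polar (integrable_finsetSum _ fun i _ =>
      integrable_pd_mul (isOpen_exterior R) c1 c2 (c4 i) (hJ i))] at hI
    have hz : ∀ s, s ∉ Ioo R (r + 1) → ψ s = 0 := fun s hs =>
      image_eq_zero_of_notMem_tsupport fun h => hs (h3 h)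
    have e1 : ∫ s in Ioi (0 : ℝ), s ^ 2 • ∫ θ, (∑ i, ((pd i χ (s • (θ : Space)) : ℝ) : ℂ) *
        J i (s • (θ : Space))) ∂sph = ∫ s, ψ s • ((s : ℂ) ^ 2 * M s) := by
      rw [← setIntegral_eq_integral_of_forall_compl_eq_zero (s := Ioi (0 : ℝ))
        (f := fun s : ℝ => ψ s • ((s : ℂ) ^ 2 * M s)) fun s hs => by
          rw [hz s fun h => hs (hR.trans_lt h.1), zero_smul]]
      refine setIntegral_congr_fun measurableSet_Ioi fun s hs => ?_
      have hs0 : (0 : ℝ) < s := hs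
      have hp : ∀ (θ : sphere (0 : Space) 1) i, pd i χ (s • (θ : Space)) = ψ s * (θ : Space) i := by
        intro θ i
        have hθ : ‖(θ : Space)‖ = 1 := by simp
        rw [c3, norm_smul, hθ, mul_one, Real.norm_of_nonneg hs0.le]
        simp only [PiLp.smul_apply, smul_eq_mul]
        field_simp
      simp_rw [hp]
      by_cases hsI : s ∈ Ioo R (r + 1)
      · have hi : ∀ i, Integrable (fun θ : sphere (0 : Space) 1 =>
            J i (s • (θ : Space)) * ((θ : Space) i : ℂ)) sph := fun i =>
          integrable_sphere ((continuousOn_sphere_smul hR ((hJ i).mono (hsh _)) hsI).mul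
            ((hcoord i).comp continuous_subtype_val))
        have : ∀ θ : sphere (0 : Space) 1, ∑ i, ((ψ s * (θ : Space) i : ℝ) : ℂ) *
            J i (s • (θ : Space)) = (ψ s : ℂ) * ∑ i, J i (s • (θ : Space))
                * ((θ : Space) i : ℂ) := by
          intro θ
          rw [Finset.mul_sum]
          refine Finset.sum_congr rfl fun i _ => ?_
          push_cast; ring
        simp_rw [this]
        rw [integral_const_mul, integral_finsetSum _ fun i _ => hi i]
        simp only [hM, mom, Complex.real_smul]
        push_cast; ring
      · simp [hz s hsI]
    rw [e1] at hI
    have hint : Integrable fun s => ψ s • ((s : ℂ) ^ 2 * M s) :=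
      integrable_smul_of_tsupport_subset
        (((Complex.continuous_ofReal.pow 2).continuousOn).mul hMc) h1.continuous h2 h3
    have e2 : ∀ s, ψ s • ((((s : ℂ) ^ 2 * M s).im : ℝ) : ℂ) =
        (((ψ s • ((s : ℂ) ^ 2 * M s)).im : ℝ) : ℂ) := by
      intro s
      simp
      ring
    simp_rw [e2]
    rw [integral_complex_ofReal]
    have := integral_im hint
    simp only [RCLike.im_to_complex] at this
    rw [this, hI, Complex.ofReal_zero]) r ⟨hr, by linarith⟩
  have hr0 : (r : ℂ) ^ 2 * M r = ((r ^ 2 : ℝ) : ℂ) * M r := by push_cast; rfl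
  simp only [hr0, Complex.im_ofReal_mul, Complex.ofReal_eq_zero, mul_eq_zero] at key
  rcases key with h | h
  · exact absurd h (pow_ne_zero 2 (hR.trans_lt hr).ne')
  · exact h

lemma pd_mul_conj {f g : Space → ℂ} {x : Space} (hf : DifferentiableAt ℝ f x)
    (hg : DifferentiableAt ℝ g x) (i : Fin 3) :
    pd i (fun y => f y * (starRingEnd ℂ) (g y)) x =
      pd i f x * (starRingEnd ℂ) (g x) + f x * (starRingEnd ℂ) (pd i g x) := by
  have hg' : DifferentiableAt ℝ (fun y => (starRingEnd ℂ) (g y)) x :=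
    Complex.conjCLE.differentiableAt.comp x hg
  rw [pd_mul hf hg', pd_conj i hg]

lemma pd_linear_combination {f₁ f₂ f₃ f₄ : Space → ℂ} {x : Space} (h₁ : DifferentiableAt ℝ f₁ x)
    (h₂ : DifferentiableAt ℝ f₂ x) (h₃ : DifferentiableAt ℝ f₃ x) (h₄ : DifferentiableAt ℝ f₄ x)
    (c₁ c₂ c₃ c₄ : ℂ) (i : Fin 3) :
    pd i (fun y => (c₁ * f₁ y + c₂ * f₂ y) + (c₃ * f₃ y + c₄ * f₄ y)) x =
      (c₁ * pd i f₁ x + c₂ * pd i f₂ x) + (c₃ * pd i f₃ x + c₄ * pd i f₄ x) := by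
  rw [← pd_const_mul h₁, ← pd_const_mul h₂, ← pd_const_mul h₃, ← pd_const_mul h₄,
    ← pd_add (h₁.const_mul _) (h₂.const_mul _), ← pd_add (h₃.const_mul _) (h₄.const_mul _)]
  exact pd_add ((h₁.const_mul _).add (h₂.const_mul _)) ((h₃.const_mul _).add (h₄.const_mul _)) i

lemma contDiffOn_conj {n : WithTop ℕ∞} {U : Set Space} {f : Space → ℂ} (hf : ContDiffOn ℝ n f U) :
    ContDiffOn ℝ n (fun x => (starRingEnd ℂ) (f x)) U :=
  Complex.conjCLE.toContinuousLinearMap.contDiff.comp_contDiffOn hf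

lemma PSDecomp.smooth_p {k₁ k₂ : ℝ} {U : Set Space} {u v w : Space → CVec} (hU : IsOpen U)
    (hk₁ : 0 < k₁) (h : PSDecomp k₁ k₂ U u v w) (i : Fin 3) :
    ContDiffOn ℝ ∞ (fun x => v x i) U :=
  (weakHelm_of_contDiffOn hU (h.contDiff_p i) fun x hx => h.helm_p x hx i).contDiffOn hk₁ hU

lemma PSDecomp.smooth_s {k₁ k₂ : ℝ} {U : Set Space} {u v w : Space → CVec} (hU : IsOpen U)
    (hk₂ : 0 < k₂) (h : PSDecomp k₁ k₂ U u v w) (i : Fin 3) :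
    ContDiffOn ℝ ∞ (fun x => w x i) U :=
  (weakHelm_of_contDiffOn hU (h.contDiff_s i) fun x hx => h.helm_s x hx i).contDiffOn hk₂ hU

lemma PSDecomp.mono {k₁ k₂ : ℝ} {U V : Set Space} {u v w : Space → CVec}
    (h : PSDecomp k₁ k₂ U u v w) (hVU : V ⊆ U) : PSDecomp k₁ k₂ V u v w :=
  ⟨fun x hx => h.sum x (hVU hx), fun i => (h.contDiff_p i).mono hVU,
    fun i => (h.contDiff_s i).mono hVU, fun x hx => h.helm_p x (hVU hx),
    fun x hx => h.helm_s x (hVU hx), fun x hx => h.curl_p x (hVU hx),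
    fun x hx => h.div_s x (hVU hx)⟩

/-- The energy current of a vector field for the operator `a Δ + b grad div`. -/
def current (a b : ℝ) (u : Space → CVec) (i : Fin 3) (x : Space) : ℂ :=
  a * ∑ j, pd i (fun y => u y j) x * (starRingEnd ℂ) (u x j) + b * dv u x * (starRingEnd ℂ) (u x i)

/-- The energy current of an elastic field agrees with the sum of the currents of its pressure and
shear parts, up to a real field and the divergence of a tensor field `T` whose symmetric part is
real. Hence the two currents have the same flux. -/
lemma PSDecomp.integral_current {lam mu k₁ k₂ : ℝ} {U : Set Space} {u v w : Space → CVec}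
    (hU : IsOpen U) (hk₁ : 0 < k₁) (hk₂ : 0 < k₂) (hk : (lam + 2 * mu) * k₁ ^ 2 = mu * k₂ ^ 2)
    (h : PSDecomp k₁ k₂ U u v w) {χ : Space → ℝ} (h1 : ContDiff ℝ ∞ χ) (h2 : HasCompactSupport χ)
    (h3 : ∀ i, tsupport (pd i χ) ⊆ U) :
    (∫ x, ∑ i, ((pd i χ x : ℝ) : ℂ) * current mu (lam + mu) u i x).im =
      (∫ x, ∑ i, ((pd i χ x : ℝ) : ℂ) *
        (current (lam + 2 * mu) 0 v i x + current mu 0 w i x)).im := by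
  have hv := h.smooth_p hU hk₁
  have hw := h.smooth_s hU hk₂
  have hu : ∀ i, ContDiffOn ℝ ∞ (fun x => u x i) U := fun i =>
    ((hv i).add (hw i)).congr fun x hx => h.sum x hx i
  have hvp : ∀ i j, ContDiffOn ℝ ∞ (pd i fun x => v x j) U := fun i j =>
    contDiffOn_pd hU (hv j) (by simp) i
  have hwp : ∀ i j, ContDiffOn ℝ ∞ (pd i fun x => w x j) U := fun i j =>
    contDiffOn_pd hU (hw j) (by simp) i
  have hup : ∀ i j, ContDiffOn ℝ ∞ (pd i fun x => u x j) U := fun i j =>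
    contDiffOn_pd hU (hu j) (by simp) i
  have hpC : ContDiffOn ℝ ∞ (dv v) U := ContDiffOn.sum fun i _ => hvp i i
  have hduC : ContDiffOn ℝ ∞ (dv u) U := ContDiffOn.sum fun i _ => hup i i
  have hdvC : ContDiffOn ℝ ∞ (dv w) U := ContDiffOn.sum fun i _ => hwp i i
  have dd : ∀ {f : Space → ℂ}, ContDiffOn ℝ ∞ f U → ∀ x ∈ U, DifferentiableAt ℝ f x :=
    fun hf x hx => (hf.contDiffAt (hU.mem_nhds hx)).differentiableAt (by simp)
  have c2 : ∀ {f : Space → ℂ}, ContDiffOn ℝ ∞ f U → ∀ x ∈ U, ContDiffAt ℝ 2 f x :=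
    fun hf x hx => (hf.contDiffAt (hU.mem_nhds hx)).of_le two_le_infty
  -- the antisymmetric gradient of `w`, that is, its curl
  set A : Fin 3 → Fin 3 → Space → ℂ := fun i j x =>
    pd i (fun y => w y j) x - pd j (fun y => w y i) x with hA
  have hAC : ∀ i j, ContDiffOn ℝ ∞ (A i j) U := fun i j => (hwp i j).sub (hwp j i)
  have hk₁c : (k₁ : ℂ) ≠ 0 := by exact_mod_cast hk₁.ne'
  set T : Fin 3 → Fin 3 → Space → ℂ := fun i j x =>
    ((lam + mu) * (v x j * (starRingEnd ℂ) (v x i)) + mu * (w x i * (starRingEnd ℂ) (v x j))) +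
      (mu * (v x i * (starRingEnd ℂ) (w x j)) +
        -(mu / (k₁ : ℂ) ^ 2) * (A i j x * (starRingEnd ℂ) (dv v x))) with hT
  have hTC : ∀ i j, ContDiffOn ℝ ∞ (T i j) U := fun i j =>
    ((contDiffOn_const.mul ((hv j).mul (contDiffOn_conj (hv i)))).add
      (contDiffOn_const.mul ((hw i).mul (contDiffOn_conj (hv j))))).add
      ((contDiffOn_const.mul ((hv i).mul (contDiffOn_conj (hw j)))).add
      (contDiffOn_const.mul ((hAC i j).mul (contDiffOn_conj hpC))))
  have hTsym : ∀ x i j, (T i j x + T j i x).im = 0 := by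
    intro x i j
    have : T i j x + T j i x = (((lam + mu) * (v x j * (starRingEnd ℂ) (v x i)).re * 2 +
        mu * 2 * (w x i * (starRingEnd ℂ) (v x j)).re +
        mu * 2 * (w x j * (starRingEnd ℂ) (v x i)).re : ℝ) : ℂ) := by
      push_cast
      simp only [hT, hA, Complex.re_eq_add_conj, map_mul, Complex.conj_conj]
      ring
    rw [this, Complex.ofReal_im]
  -- the divergence of `v` determines `v`, and the curl of `w` determines `w`
  have hgp : ∀ x ∈ U, ∀ i, pd i (dv v) x = -(k₁ : ℂ) ^ 2 * v x i := by
    intro x hx i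
    have e : pd i (dv v) x = ∑ j, pd i (pd j fun y => v y j) x :=
      pd_sum (fun j _ => dd (hvp j j) x hx) i
    have e2 : ∀ j, pd i (pd j fun y => v y j) x = pd j (pd j fun y => v y i) x := by
      intro j
      rw [pd_comm (c2 (hv j) x hx)]
      refine pd_congr ?_ j
      filter_upwards [hU.mem_nhds hx] with y hy using h.curl_p y hy i j
    rw [e, Finset.sum_congr rfl fun j _ => e2 j]
    have := h.helm_p x hx i
    rw [lap] at this
    linear_combination this
  have hgA : ∀ x ∈ U, ∀ i, ∑ j, pd j (A i j) x = (k₂ : ℂ) ^ 2 * w x i := by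
    intro x hx i
    have e : ∀ j, pd j (A i j) x = pd i (pd j fun y => w y j) x - pd j (pd j fun y => w y i) x := by
      intro j
      rw [hA, pd_sub (dd (hwp i j) x hx) (dd (hwp j i) x hx), pd_comm (c2 (hw j) x hx)]
    have e2 : ∑ j, pd i (pd j fun y => w y j) x = 0 := by
      rw [← pd_sum fun j _ => dd (hwp j j) x hx]
      have : (fun y => ∑ j, pd j (fun y => w y j) y) =ᶠ[𝓝 x] fun _ => 0 := by
        filter_upwards [hU.mem_nhds hx] with y hy using h.div_s y hy
      rw [pd_congr this, pd_const]
    simp only [e, Finset.sum_sub_distrib, e2]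
    have := h.helm_s x hx i
    rw [lap] at this
    linear_combination -this
  have hkc : ((lam : ℂ) + 2 * mu) * (k₁ : ℂ) ^ 2 = mu * (k₂ : ℂ) ^ 2 := by exact_mod_cast hk
  have hpt : ∀ x ∈ U, ∀ i, (current mu (lam + mu) u i x -
      (current (lam + 2 * mu) 0 v i x + current mu 0 w i x) - ∑ j, pd j (T i j) x).im = 0 := by
    intro x hx i
    have hTp : ∀ j, pd j (T i j) x =
        (lam + mu) * (pd j (fun y => v y j) x * (starRingEnd ℂ) (v x i) +
        v x j * (starRingEnd ℂ) (pd j (fun y => v y i) x)) +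
        mu * (pd j (fun y => w y i) x * (starRingEnd ℂ) (v x j) +
        w x i * (starRingEnd ℂ) (pd j (fun y => v y j) x)) +
        (mu * (pd j (fun y => v y i) x * (starRingEnd ℂ) (w x j) +
        v x i * (starRingEnd ℂ) (pd j (fun y => w y j) x)) +
        -(mu / (k₁ : ℂ) ^ 2) * (pd j (A i j) x * (starRingEnd ℂ) (dv v x) +
        A i j x * (starRingEnd ℂ) (pd j (dv v) x))) := by
      intro j
      have t1 : DifferentiableAt ℝ (fun y => v y j * (starRingEnd ℂ) (v y i)) x :=
        dd ((hv j).mul (contDiffOn_conj (hv i))) x hx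
      have t2 : DifferentiableAt ℝ (fun y => w y i * (starRingEnd ℂ) (v y j)) x :=
        dd ((hw i).mul (contDiffOn_conj (hv j))) x hx
      have t3 : DifferentiableAt ℝ (fun y => v y i * (starRingEnd ℂ) (w y j)) x :=
        dd ((hv i).mul (contDiffOn_conj (hw j))) x hx
      have t4 : DifferentiableAt ℝ (fun y => A i j y * (starRingEnd ℂ) (dv v y)) x :=
        dd ((hAC i j).mul (contDiffOn_conj hpC)) x hx
      refine (pd_linear_combination t1 t2 t3 t4 _ _ _ _ j).trans ?_
      rw [pd_mul_conj (dd (hv j) x hx) (dd (hv i) x hx),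
          pd_mul_conj (dd (hw i) x hx) (dd (hv j) x hx),
        pd_mul_conj (dd (hv i) x hx) (dd (hw j) x hx),
            pd_mul_conj (dd (hAC i j) x hx) (dd hpC x hx)]
    have hup' : ∀ i j, pd i (fun y => u y j) x = pd i (fun y => v y j) x +
        pd i (fun y => w y j) x := by
      intro i j
      rw [← pd_add (dd (hv j) x hx) (dd (hw j) x hx)]
      refine pd_congr ?_ i
      filter_upwards [hU.mem_nhds hx] with y hy using h.sum y hy j
    have hdu : dv u x = dv v x := by
      have := h.div_s x hx
      simp only [dv] at this ⊢
      simp only [hup', Finset.sum_add_distrib, this, add_zero]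
    have hdiv := h.div_s x hx
    have hcurl := h.curl_p x hx
    have hgAx := hgA x hx i
    set z : ℂ := (lam + mu) * (dv v x * (starRingEnd ℂ) (w x i) -
      ∑ j, (starRingEnd ℂ) (v x j) * pd i (fun y => v y j) x) with hz
    have : current mu (lam + mu) u i x -
      (current (lam + 2 * mu) 0 v i x + current mu 0 w i x) - ∑ j, pd j (T i j) x =
        z + (starRingEnd ℂ) z := by
      have e1 : ∑ j, pd j (T i j) x = (lam + mu) * (dv v x * (starRingEnd ℂ) (v x i) +
          ∑ j, v x j * (starRingEnd ℂ) (pd i (fun y => v y j) x)) +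
          mu * (∑ j, pd j (fun y => w y i) x * (starRingEnd ℂ) (v x j) +
          w x i * (starRingEnd ℂ) (dv v x)) +
          mu * (∑ j, pd i (fun y => v y j) x * (starRingEnd ℂ) (w x j)) +
          -(mu / (k₁ : ℂ) ^ 2) * ((k₂ : ℂ) ^ 2 * w x i * (starRingEnd ℂ) (dv v x) -
          ∑ j, A i j x * ((k₁ : ℂ) ^ 2 * (starRingEnd ℂ) (v x j))) := by
        have e2 : v x i * (starRingEnd ℂ) (dv w x) = 0 := by rw [hdiv]; simp
        have e3 : ∀ j, (starRingEnd ℂ) (pd j (dv v) x) =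
            -((k₁ : ℂ) ^ 2 * (starRingEnd ℂ) (v x j)) := by
          intro j
          rw [hgp x hx j]; simp
        simp only [hTp, ← hgAx, e3, fun j => hcurl j i]
        simp only [dv, map_sum] at e2 ⊢
        simp only [Fin.sum_univ_three] at e2 ⊢
        linear_combination (mu : ℂ) * e2
      have hmu : (mu : ℂ) / (k₁ : ℂ) ^ 2 * (k₂ : ℂ) ^ 2 = lam + 2 * mu := by
        field_simp
        linear_combination -hkc
      have e4 : -((mu : ℂ) / (k₁ : ℂ) ^ 2) * ((k₂ : ℂ) ^ 2 * w x i * (starRingEnd ℂ) (dv v x) -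
          ∑ j, A i j x * ((k₁ : ℂ) ^ 2 * (starRingEnd ℂ) (v x j))) =
          -(lam + 2 * mu) * w x i * (starRingEnd ℂ) (dv v x) +
          mu * ∑ j, A i j x * (starRingEnd ℂ) (v x j) := by
        rw [← hmu]
        simp only [Fin.sum_univ_three]
        field_simp
        ring
      rw [e1, e4]
      simp only [current, hup', hdu, h.sum x hx, hz, hA, map_mul, map_sub, map_add, map_sum,
        Complex.conj_conj, Complex.conj_ofReal]
      simp only [Fin.sum_univ_three]
      push_cast
      ring
    rw [this, Complex.add_conj, Complex.ofReal_im]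
  have hcur : ∀ {a b : ℝ} {f : Space → CVec} (i : Fin 3), (∀ i, ContDiffOn ℝ ∞ (fun x => f x i) U) →
      ContinuousOn (current a b f i) U := by
    intro a b f i hf
    have hfp : ∀ i j, ContinuousOn (pd i fun x => f x j) U := fun i j =>
      (contDiffOn_pd hU (hf j) (m := 0) (by simp) i).continuousOn
    have hfd : ContinuousOn (dv f) U := continuousOn_finsetSum _ fun i _ => hfp i i
    exact (continuousOn_const.mul (continuousOn_finsetSum _ fun j _ =>
      (hfp i j).mul (contDiffOn_conj (hf j)).continuousOn)).add
      ((continuousOn_const.mul hfd).mul (contDiffOn_conj (hf i)).continuousOn)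
  set J₁ : Fin 3 → Space → ℂ := current mu (lam + mu) u with hJ₁
  set J₀ : Fin 3 → Space → ℂ := fun i x => current (lam + 2 * mu) 0 v i x +
      current mu 0 w i x with hJ₀
  have hJ₁c : ∀ i, ContinuousOn (J₁ i) U := fun i => hcur i hu
  have hJ₀c : ∀ i, ContinuousOn (J₀ i) U := fun i => (hcur i hv).add (hcur i hw)
  have hTpc : ∀ i j, ContinuousOn (pd j (T i j)) U := fun i j =>
    (contDiffOn_pd hU (hTC i j) (m := 0) (by simp) j).continuousOn
  have n1 : ∀ i, Integrable fun x => ((pd i χ x : ℝ) : ℂ) * J₁ i x := fun i =>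
    integrable_pd_mul hU h1 h2 (h3 i) (hJ₁c i)
  have n2 : ∀ i, Integrable fun x => ((pd i χ x : ℝ) : ℂ) * J₀ i x := fun i =>
    integrable_pd_mul hU h1 h2 (h3 i) (hJ₀c i)
  have n3 : ∀ i j, Integrable fun x => ((pd i χ x : ℝ) : ℂ) * pd j (T i j) x := fun i j =>
    integrable_pd_mul hU h1 h2 (h3 i) (hTpc i j)
  -- the divergence of `T` has no flux: after integration by parts, `T` is paired with the real
  -- symmetric matrix of second derivatives of `χ`
  have hTI : (∫ x, ∑ i, ∑ j, ((pd i χ x : ℝ) : ℂ) * pd j (T i j) x).im = 0 := by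
    have hχ1 : ∀ i, ContDiff ℝ ∞ fun x => ((pd i χ x : ℝ) : ℂ) := fun i =>
      Complex.ofRealCLM.contDiff.comp (contDiff_pd h1 i)
    have hχ2 : ∀ i, HasCompactSupport fun x => ((pd i χ x : ℝ) : ℂ) := fun i =>
      (h2.mono' ((subset_tsupport _).trans (tsupport_pd_subset χ i))).comp_left
        (g := fun t : ℝ => (t : ℂ)) (by simp)
    have hχ3 : ∀ i, tsupport (fun x => ((pd i χ x : ℝ) : ℂ)) ⊆ U := fun i =>
      (tsupport_comp_subset (g := fun t : ℝ => (t : ℂ)) (by simp) _).trans (h3 i)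
    have hpp : ∀ i j, (pd j fun x => ((pd i χ x : ℝ) : ℂ)) = fun x => ((pd j (pd i χ) x : ℝ) : ℂ) :=
      fun i j => funext fun x => pd_ofReal ((contDiff_pd h1 i).differentiable (by simp) x) j
    have n4 : ∀ i j, Integrable fun x => T i j x * ((pd j (pd i χ) x : ℝ) : ℂ) := by
      intro i j
      have := integrable_mul_of_tsupport_subset hU (hTC i j).continuousOn
        (contDiff_pd (hχ1 i) j).continuous (hasCompactSupport_pd (hχ2 i) j)
        ((tsupport_pd_subset _ j).trans (hχ3 i))
      rwa [hpp] at this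
    have e : ∀ i j, ∫ x, ((pd i χ x : ℝ) : ℂ) * pd j (T i j) x =
        -∫ x, T i j x * ((pd j (pd i χ) x : ℝ) : ℂ) := by
      intro i j
      have := integral_mul_pd hU ((hTC i j).of_le (by simp)) (hχ1 i) (hχ2 i) (hχ3 i) j
      rw [hpp] at this
      rw [this, neg_neg]
      congr 1
      funext x
      ring
    rw [integral_finsetSum _ fun i _ => integrable_finsetSum _ fun j _ => n3 i j]
    simp only [integral_finsetSum _ fun j _ => n3 _ j, e, Finset.sum_neg_distrib]
    simp only [← integral_finsetSum _ fun j _ => n4 _ j]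
    rw [← integral_finsetSum _ fun i _ => integrable_finsetSum _ fun j _ => n4 i j, Complex.neg_im]
    have hI := integral_im (integrable_finsetSum Finset.univ fun i _ =>
      integrable_finsetSum Finset.univ fun j _ => n4 i j)
    simp only [RCLike.im_to_complex] at hI
    rw [← hI, neg_eq_zero]
    refine integral_eq_zero_of_ae (Eventually.of_forall fun x => ?_)
    have hc : ∀ i j, pd j (pd i χ) x = pd i (pd j χ) x := fun i j =>
      pd_comm (h1.of_le two_le_infty).contDiffAt j i
    have hs : ∑ i, ∑ j, T i j x * ((pd j (pd i χ) x : ℝ) : ℂ) =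
        ∑ i, ∑ j, T j i x * ((pd j (pd i χ) x : ℝ) : ℂ) := by
      rw [Finset.sum_comm]
      refine Finset.sum_congr rfl fun i _ => Finset.sum_congr rfl fun j _ => ?_
      rw [hc]
    have h2S : (2 * ∑ i, ∑ j, T i j x * ((pd j (pd i χ) x : ℝ) : ℂ)).im = 0 := by
      rw [two_mul]
      nth_rw 2 [hs]
      simp only [← Finset.sum_add_distrib, ← add_mul, Complex.im_sum, Complex.im_mul_ofReal, hTsym,
        zero_mul, Finset.sum_const_zero]
    simpa using h2S
  have n5 : Integrable fun x => ∑ i, ((pd i χ x : ℝ) : ℂ) * (J₁ i x - J₀ i x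
      - ∑ j, pd j (T i j) x) :=
    integrable_finsetSum _ fun i _ => integrable_pd_mul hU h1 h2 (h3 i)
      (((hJ₁c i).sub (hJ₀c i)).sub (continuousOn_finsetSum _ fun j _ => hTpc i j))
  have h0 : (∫ x, ∑ i, ((pd i χ x : ℝ) : ℂ) * (J₁ i x - J₀ i x - ∑ j, pd j (T i j) x)).im = 0 := by
    have hI := integral_im n5
    simp only [RCLike.im_to_complex] at hI
    rw [← hI]
    refine integral_eq_zero_of_ae (Eventually.of_forall fun x => ?_)
    simp only [Complex.im_sum, Complex.im_ofReal_mul, Pi.zero_apply]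
    refine Finset.sum_eq_zero fun i _ => ?_
    by_cases hx : x ∈ tsupport (pd i χ)
    · rw [hpt x (h3 i hx) i, mul_zero]
    · rw [image_eq_zero_of_notMem_tsupport hx, zero_mul]
  have e5 : ∀ x, ∑ i, ((pd i χ x : ℝ) : ℂ) * (J₁ i x - J₀ i x - ∑ j, pd j (T i j) x) =
      (∑ i, ((pd i χ x : ℝ) : ℂ) * J₁ i x - ∑ i, ((pd i χ x : ℝ) : ℂ) * J₀ i x) -
        ∑ i, ∑ j, ((pd i χ x : ℝ) : ℂ) * pd j (T i j) x := by
    intro x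
    simp only [mul_sub, Finset.sum_sub_distrib, Finset.mul_sum]
  have m1 : Integrable fun x => ∑ i, ((pd i χ x : ℝ) : ℂ) * J₁ i x :=
      integrable_finsetSum _ fun i _ => n1 i
  have m2 : Integrable fun x => ∑ i, ((pd i χ x : ℝ) : ℂ) * J₀ i x :=
      integrable_finsetSum _ fun i _ => n2 i
  have m3 : Integrable fun x => ∑ i, ∑ j, ((pd i χ x : ℝ) : ℂ) * pd j (T i j) x :=
    integrable_finsetSum _ fun i _ => integrable_finsetSum _ fun j _ => n3 i j
  have m12 : Integrable fun x => ∑ i, ((pd i χ x : ℝ) : ℂ) * J₁ i x -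
    ∑ i, ((pd i χ x : ℝ) : ℂ) * J₀ i x := m1.sub m2
  simp_rw [e5] at h0
  rw [integral_sub m12 m3, integral_sub m1 m2, Complex.sub_im, Complex.sub_im, hTI] at h0
  linarith

/-! ### Radiating fields without flux vanish -/

/-- The energy flux of a scalar field through the sphere of radius `r`, without the factor
`r²`. -/
def radialFlux (f : Space → ℂ) (r : ℝ) : ℝ :=
  (∫ θ, fderiv ℝ f (r • (θ : Space)) (θ : Space) * (starRingEnd ℂ) (f (r • (θ : Space))) ∂sph).im

/-- The scalar form of the radiation condition. -/
def RadCond (k : ℝ) (f : Space → ℂ) : Prop :=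
  Tendsto (fun x : Space => ‖x‖ * ‖fderiv ℝ f x (‖x‖⁻¹ • x) - Complex.I * k * f x‖)
    (Bornology.cobounded Space) (𝓝 0)

/-- A scalar outgoing wave in the exterior of a ball: a solution of the Helmholtz equation that
satisfies Sommerfeld's radiation condition and is `O(1/r)` at infinity. -/
structure Radiates (k R : ℝ) (f : Space → ℂ) : Prop where
  helm : WeakHelm k {x | R < ‖x‖} f
  rad : RadCond k f
  bdd : ∃ C, ∀ᶠ x in Bornology.cobounded Space, ‖x‖ * ‖f x‖ ≤ C

lemma shell_subset_exterior (R b : ℝ) : shell R b ⊆ {x | R < ‖x‖} := fun _ hx => hx.1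

lemma continuous_sphere_of_exterior {R r : ℝ} (hR : 0 ≤ R) (hr : R < r) {F : Type*}
    [NormedAddCommGroup F] {f : Space → F} (hf : ContinuousOn f {x | R < ‖x‖}) :
    Continuous fun θ : sphere (0 : Space) 1 => f (r • (θ : Space)) :=
  continuousOn_sphere_smul hR (hf.mono (shell_subset_exterior R (r + 1))) ⟨hr, by linarith⟩

lemma norm_smul_sphere {r : ℝ} (hr : 0 ≤ r) (θ : sphere (0 : Space) 1) : ‖r • (θ : Space)‖ = r := by
  have hθ : ‖(θ : Space)‖ = 1 := by simp
  rw [norm_smul, hθ, mul_one, Real.norm_of_nonneg hr]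

lemma continuous_radialDeriv {R r : ℝ} (hR : 0 ≤ R) (hr : R < r) {f : Space → ℂ}
    (hf : ContDiffOn ℝ 1 f {x | R < ‖x‖}) :
    Continuous fun θ : sphere (0 : Space) 1 => fderiv ℝ f (r • (θ : Space)) (θ : Space) :=
  (continuous_sphere_of_exterior hR hr
    (hf.continuousOn_fderiv_of_isOpen (isOpen_exterior R) (by norm_num))).clm_apply
    continuous_subtype_val

lemma sphereFlux_current {a R r : ℝ} (hR : 0 ≤ R) (hr : R < r) {u : Space → CVec}
    (hu : ∀ i, ContDiffOn ℝ 1 (fun x => u x i) {x | R < ‖x‖}) :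
    sphereFlux (current a 0 u) r = a * ∑ j, radialFlux (fun x => u x j) r := by
  have hc : ∀ i j, Continuous fun θ : sphere (0 : Space) 1 =>
      pd i (fun x => u x j) (r • (θ : Space)) := fun i j => continuous_sphere_of_exterior hR hr
    (contDiffOn_pd (isOpen_exterior R) (hu j) (m := 0) (by norm_num) i).continuousOn
  have hc' : ∀ j, Continuous fun θ : sphere (0 : Space) 1 => u (r • (θ : Space)) j := fun j =>
    continuous_sphere_of_exterior hR hr (hu j).continuousOn
  have e1 : ∑ i, mom (current a 0 u i) (fun x => (x i : ℂ)) r =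
      a * ∑ j, ∫ θ, fderiv ℝ (fun x => u x j) (r • (θ : Space)) (θ : Space) *
        (starRingEnd ℂ) (u (r • (θ : Space)) j) ∂sph := by
    have i1 : ∀ j, Integrable (fun θ : sphere (0 : Space) 1 =>
        fderiv ℝ (fun x => u x j) (r • (θ : Space)) (θ : Space) *
          (starRingEnd ℂ) (u (r • (θ : Space)) j)) sph := fun j =>
      integrable_sphere ((continuous_radialDeriv hR hr (hu j)).mul
        (Complex.continuous_conj.comp (hc' j)))
    have i2 : ∀ i, Integrable (fun θ : sphere (0 : Space) 1 =>
        current a 0 u i (r • (θ : Space)) * ((θ : Space) i : ℂ)) sph := by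
      intro i
      refine integrable_sphere ?_
      simp only [current, Complex.ofReal_zero, zero_mul, add_zero]
      exact (continuous_const.mul (continuous_finsetSum _ fun j _ => (hc i j).mul
        (Complex.continuous_conj.comp (hc' j)))).mul (by fun_prop)
    simp only [mom]
    rw [← integral_finsetSum _ fun i _ => i2 i, ← integral_finsetSum _ fun j _ => i1 j,
      ← integral_const_mul]
    congr 1
    funext θ
    simp only [current, fderiv_apply_eq_sum _ _ (θ : Space), Complex.real_smul]
    simp only [Fin.sum_univ_three]
    push_cast
    ring
  rw [sphereFlux, e1, Complex.im_ofReal_mul, Complex.im_sum]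
  rfl

/-- The flux of an outgoing wave is asymptotically `k` times its squared `L²` norm on spheres. -/
lemma Radiates.tendsto_flux {k R : ℝ} (hk : 0 < k) (hR : 0 ≤ R) {f : Space → ℂ}
    (h : Radiates k R f) :
    Tendsto (fun r : ℝ => r ^ 2 * radialFlux f r - k * (r ^ 2 *
        ∫ θ, ‖f (r • (θ : Space))‖ ^ 2 ∂sph))
      atTop (𝓝 0) := by
  have hs := (h.helm.contDiffOn hk (isOpen_exterior R)).of_le (m := 1) (by simp)
  obtain ⟨C, hC⟩ := h.bdd
  have hlim : Tendsto (fun x : Space =>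
      C * (‖x‖ * ‖fderiv ℝ f x (‖x‖⁻¹ • x) - Complex.I * k * f x‖) *
      sph.real univ) (Bornology.cobounded Space) (𝓝 0) := by
    simpa using (h.rad.const_mul C).mul_const (sph.real univ)
  rw [Metric.tendsto_atTop]
  intro ε hε
  have h1 : ∀ᶠ x in Bornology.cobounded Space, C * (‖x‖ * ‖fderiv ℝ f x (‖x‖⁻¹ • x) -
      Complex.I * k * f x‖) * sph.real univ ≤ ε / 2 :=
    hlim.eventually (ge_mem_nhds (half_pos hε))
  obtain ⟨R₁, -, hR₁⟩ := (hasBasis_cobounded_norm (E := Space)).eventually_iff.1 (hC.and h1)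
  refine ⟨max (max R₁ (R + 1)) 1, fun r hr => ?_⟩
  have hr1 : R₁ ≤ r := (le_max_left _ _).trans ((le_max_left _ _).trans hr)
  have hr2 : R < r := (by linarith : R < R + 1).trans_le
    ((le_max_right _ _).trans ((le_max_left _ _).trans hr))
  have hr3 : 0 < r := one_pos.trans_le ((le_max_right _ _).trans hr)
  have c1 := continuous_radialDeriv hR hr2 hs
  have c2 := continuous_sphere_of_exterior hR hr2 hs.continuousOn
  have c3 : Continuous fun θ : sphere (0 : Space) 1 => (starRingEnd ℂ) (f (r • (θ : Space))) :=
    Complex.continuous_conj.comp c2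
  set g : sphere (0 : Space) 1 → ℂ := fun θ => fderiv ℝ f (r • (θ : Space)) (θ : Space) -
    Complex.I * k * f (r • (θ : Space)) with hg
  have cg : Continuous g := c1.sub (continuous_const.mul c2)
  have e1 : r ^ 2 * radialFlux f r - k * (r ^ 2 * ∫ θ, ‖f (r • (θ : Space))‖ ^ 2 ∂sph) =
      (∫ θ, (r : ℂ) ^ 2 * (g θ * (starRingEnd ℂ) (f (r • (θ : Space)))) ∂sph).im := by
    have e2 : ∀ θ : sphere (0 : Space) 1, g θ * (starRingEnd ℂ) (f (r • (θ : Space))) =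
        fderiv ℝ f (r • (θ : Space)) (θ : Space) * (starRingEnd ℂ) (f (r • (θ : Space))) -
          Complex.I * k * ((‖f (r • (θ : Space))‖ ^ 2 : ℝ) : ℂ) := by
      intro θ
      rw [← Complex.normSq_eq_norm_sq, ← Complex.mul_conj, hg]
      ring
    simp_rw [integral_const_mul, e2]
    have i1 : Integrable (fun θ : sphere (0 : Space) 1 => fderiv ℝ f (r • (θ : Space)) (θ : Space) *
        (starRingEnd ℂ) (f (r • (θ : Space)))) sph := integrable_sphere (c1.mul c3)
    have i2 : Integrable (fun θ : sphere (0 : Space) 1 =>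
        Complex.I * k * ((‖f (r • (θ : Space))‖ ^ 2 : ℝ) : ℂ)) sph :=
      integrable_sphere (continuous_const.mul (Complex.continuous_ofReal.comp (c2.norm.pow 2)))
    rw [integral_sub i1 i2,
      integral_const_mul, integral_complex_ofReal]
    have : (r : ℂ) ^ 2 = ((r ^ 2 : ℝ) : ℂ) := by push_cast; rfl
    rw [this, Complex.im_ofReal_mul, Complex.sub_im, radialFlux, mul_assoc Complex.I, mul_sub,
      ← Complex.ofReal_mul, Complex.I_mul_im, Complex.ofReal_re]
    ring
  rw [Real.dist_eq, sub_zero, e1]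
  refine lt_of_le_of_lt ?_ (half_lt_self hε)
  refine (Complex.abs_im_le_norm _).trans ?_
  rcases isEmpty_or_nonempty (sphere (0 : Space) 1) with hem | ⟨⟨θ₀⟩⟩
  · rw [integral_of_isEmpty, norm_zero]; positivity
  have hb : ∀ θ : sphere (0 : Space) 1,
      ‖(r : ℂ) ^ 2 * (g θ * (starRingEnd ℂ) (f (r • (θ : Space))))‖ * sph.real univ ≤ ε / 2 := by
    intro θ
    have hn := norm_smul_sphere hr3.le θ
    obtain ⟨k1, k2⟩ := hR₁ (x := r • (θ : Space)) (by exact hr1.trans_eq hn.symm)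
    rw [hn, smul_smul, inv_mul_cancel₀ hr3.ne', one_smul] at k2
    rw [hn] at k1
    refine le_trans (mul_le_mul_of_nonneg_right ?_ measureReal_nonneg) k2
    rw [norm_mul, norm_mul, norm_pow, Complex.norm_real, Real.norm_of_nonneg hr3.le,
      Complex.norm_conj]
    calc r ^ 2 * (‖g θ‖ * ‖f (r • (θ : Space))‖) =
        (r * ‖f (r • (θ : Space))‖) * (r * ‖g θ‖) := by ring
      _ ≤ C * (r * ‖g θ‖) := mul_le_mul_of_nonneg_right k1 (by positivity)
  have hpos : 0 < sph.real univ := by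
    rw [measureReal_def, ENNReal.toReal_pos_iff]
    exact ⟨isOpen_univ.measure_pos sph ⟨θ₀, trivial⟩, measure_lt_top _ _⟩
  have := norm_integral_le_of_norm_le_const (μ := sph) (C := ε / 2 / sph.real univ)
    (f := fun θ : sphere (0 : Space) 1 =>
        (r : ℂ) ^ 2 * (g θ * (starRingEnd ℂ) (f (r • (θ : Space)))))
    (Eventually.of_forall fun θ => (le_div_iff₀ hpos).2 (hb θ))
  rwa [div_mul_cancel₀ _ hpos.ne'] at this

lemma sq_integral_le {g : sphere (0 : Space) 1 → ℝ} (hg : Continuous g) :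
    (∫ θ, g θ ∂sph) ^ 2 ≤ sph.real univ * ∫ θ, g θ ^ 2 ∂sph := by
  set m := ∫ θ, g θ ∂sph
  set S := sph.real univ
  have i1 := integrable_sphere hg
  have i2 : Integrable (fun θ => g θ ^ 2) sph := integrable_sphere (hg.pow 2)
  have h : 0 ≤ ∫ θ, (S * g θ - m) ^ 2 ∂sph := integral_nonneg fun θ => sq_nonneg _
  have e : ∀ θ, (S * g θ - m) ^ 2 = S ^ 2 * g θ ^ 2 - 2 * S * m * g θ + m ^ 2 := fun θ => by ring
  have i3 : Integrable (fun θ => S ^ 2 * g θ ^ 2 - 2 * S * m * g θ) sph :=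
    (i2.const_mul _).sub (i1.const_mul _)
  simp_rw [e] at h
  rw [integral_add i3 (integrable_const _), integral_sub (i2.const_mul _) (i1.const_mul _),
    integral_const_mul, integral_const_mul, integral_const] at h
  change 0 ≤ S ^ 2 * (∫ θ, g θ ^ 2 ∂sph) - 2 * S * m * m + S • m ^ 2 at h
  rw [smul_eq_mul] at h
  have hS : 0 ≤ S := measureReal_nonneg
  rcases hS.eq_or_lt with h0 | h0
  · have : sph = 0 := by
      have h1 : sph univ = 0 := by
        rcases (ENNReal.toReal_eq_zero_iff _).1 h0.symm with h1 | h1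
        · exact h1
        · exact absurd h1 (measure_ne_top _ _)
      exact Measure.measure_univ_eq_zero.1 h1
    have hm : m = 0 := by
      change ∫ θ, g θ ∂sph = 0
      rw [this, integral_zero_measure]
    rw [hm, ← h0]; simp
  · by_contra hn
    push Not at hn
    nlinarith [mul_pos h0 (sub_pos.2 hn)]

/-- Outgoing waves whose total energy flux vanishes are zero: the fluxes are asymptotically positive
multiples of the squared norms on spheres. -/
lemma Radiates.eq_zero_of_flux {ι : Type*} [Fintype ι] {k c : ι → ℝ} {R : ℝ} (hk : ∀ i, 0 < k i)
    (hc : ∀ i, 0 < c i) (hR : 0 ≤ R) {f : ι → Space → ℂ} (h : ∀ i, Radiates (k i) R (f i))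
    (h0 : ∀ r, R < r → ∑ i, c i * radialFlux (f i) r = 0) : ∀ i x, R < ‖x‖ → f i x = 0 := by
  set N : ι → ℝ → ℝ := fun i r => r ^ 2 * ∫ θ, ‖f i (r • (θ : Space))‖ ^ 2 ∂sph with hN
  have hN0 : ∀ i r, 0 ≤ N i r := fun i r =>
    mul_nonneg (sq_nonneg r) (integral_nonneg fun θ => by positivity)
  -- all weights are positive, so no cancellation between the fields is possible
  have hsum : Tendsto (fun r => ∑ i, c i * (k i * N i r)) atTop (𝓝 0) := by
    have h1 : Tendsto (fun r => -∑ i, c i * (r ^ 2 * radialFlux (f i) r - k i * N i r)) atTop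
        (𝓝 0) := by
      have := (tendsto_finsetSum Finset.univ fun i _ =>
        ((h i).tendsto_flux (hk i) hR).const_mul (c i)).neg
      simpa using this
    refine h1.congr' ?_
    filter_upwards [eventually_gt_atTop R] with r hr
    have h2 := h0 r hr
    have : ∑ i, c i * (r ^ 2 * radialFlux (f i) r - k i * N i r) =
        r ^ 2 * ∑ i, c i * radialFlux (f i) r - ∑ i, c i * (k i * N i r) := by
      rw [Finset.mul_sum, ← Finset.sum_sub_distrib]
      exact Finset.sum_congr rfl fun i _ => by ring
    rw [this, h2]
    ring
  intro i
  have hNi : Tendsto (N i) atTop (𝓝 0) := by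
    have h1 : Tendsto (fun r => (c i * k i)⁻¹ * ∑ i, c i * (k i * N i r)) atTop (𝓝 0) := by
      simpa using hsum.const_mul (c i * k i)⁻¹
    refine squeeze_zero (hN0 i) (fun r => ?_) h1
    have hck := mul_pos (hc i) (hk i)
    rw [le_inv_mul_iff₀ hck]
    calc c i * k i * N i r = c i * (k i * N i r) := by ring
      _ ≤ _ := Finset.single_le_sum (f := fun i => c i * (k i * N i r)) (fun j _ =>
          mul_nonneg (hc j).le (mul_nonneg (hk j).le (hN0 j r))) (Finset.mem_univ i)
  refine (h i).helm.eq_zero_of_rellich (hk i) hR ?_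
  have hsq : Tendsto (fun r : ℝ => (r * ∫ θ, ‖f i (r • (θ : Space))‖ ∂sph) ^ 2) atTop (𝓝 0) := by
    have h1 : Tendsto (fun r => sph.real univ * N i r) atTop (𝓝 0) := by
      simpa using hNi.const_mul (sph.real univ)
    refine squeeze_zero' (Eventually.of_forall fun r => sq_nonneg _) ?_ h1
    filter_upwards [eventually_gt_atTop R] with r hr
    have hcont := (continuous_sphere_of_exterior hR hr (h i).helm.continuousOn).norm
    have := sq_integral_le hcont
    rw [mul_pow, hN]
    calc r ^ 2 * (∫ θ, ‖f i (r • (θ : Space))‖ ∂sph) ^ 2 ≤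
        r ^ 2 * (sph.real univ * ∫ θ, ‖f i (r • (θ : Space))‖ ^ 2 ∂sph) :=
          mul_le_mul_of_nonneg_left this (sq_nonneg r)
      _ = _ := by ring
  have := hsq.sqrt
  rw [Real.sqrt_zero] at this
  refine (tendsto_zero_iff_abs_tendsto_zero _).2 (this.congr fun r => ?_)
  exact Real.sqrt_sq_eq_abs _

/-- The flux through spheres of a field with vanishing trace is zero. -/
lemma HasZeroTrace.integral_current_im {Ω : Set Space} (hΩ : IsOpen Ω) {R : ℝ}
    (hRΩ : {x | R < ‖x‖} ⊆ Ω) {u : Space → CVec}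
    (hu : ContDiffOn ℝ 2 u Ω) {a b c : ℝ}
    (hN : ∀ x ∈ Ω, ∀ j, a * lap (fun y => u y j) x + b * pd j (dv u) x + c * u x j = 0)
    (hz : HasZeroTrace Ω u) {χ : Space → ℝ} (h1 : ContDiff ℝ ∞ χ) (h2 : HasCompactSupport χ)
    (h3 : ∀ i, tsupport (pd i χ) ⊆ {x | R < ‖x‖}) :
    (∫ x, ∑ i, ((pd i χ x : ℝ) : ℂ) * current a b u i x).im = 0 := by
  have h4 := hz.integral_flux_eq_zero hΩ hu hN h1 h2
  rw [setIntegral_eq_integral_of_forall_compl_eq_zero] at h4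
  swap
  · intro x hx
    have : ∀ i, pd i χ x = 0 := fun i =>
      image_eq_zero_of_notMem_tsupport fun h => hx (hRΩ (h3 i h))
    simp [this]
  have hcur : ∀ i, ContinuousOn (current a b u i) Ω := by
    intro i
    have hfp : ∀ i j, ContinuousOn (pd i fun x => u x j) Ω := fun i j =>
      (contDiffOn_pd hΩ (contDiffOn_comp hu j) (m := 1) (by norm_num) i).continuousOn
    have hfd : ContinuousOn (dv u) Ω := continuousOn_finsetSum _ fun i _ => hfp i i
    exact (continuousOn_const.mul (continuousOn_finsetSum _ fun j _ =>
      (hfp i j).mul (contDiffOn_conj (contDiffOn_comp hu j)).continuousOn)).add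
      ((continuousOn_const.mul hfd).mul (contDiffOn_conj (contDiffOn_comp hu i)).continuousOn)
  have hint : Integrable fun x => ∑ i, ((pd i χ x : ℝ) : ℂ) * current a b u i x :=
    integrable_finsetSum _ fun i _ => integrable_pd_mul hΩ h1 h2 ((h3 i).trans hRΩ) (hcur i)
  have := integral_im hint
  simp only [RCLike.im_to_complex] at this
  rw [← this, ← h4]
  rfl

/-- Energy balance for a vector field with vanishing trace whose components satisfy the Helmholtz
equation. -/
lemma HasZeroTrace.radialFlux_helm {Ω : Set Space} (hΩ : IsOpen Ω) {R : ℝ} (hR : 0 ≤ R)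
    (hRΩ : {x | R < ‖x‖} ⊆ Ω) {u : Space → CVec} (hu : ContDiffOn ℝ 2 u Ω) {k : ℝ}
    (hN : ∀ x ∈ Ω, ∀ j, lap (fun y => u y j) x + (k : ℂ) ^ 2 * u x j = 0)
    (hz : HasZeroTrace Ω u) {r : ℝ} (hr : R < r) : ∑ j, radialFlux (fun x => u x j) r = 0 := by
  have hu1 : ∀ i, ContDiffOn ℝ 1 (fun x => u x i) {x | R < ‖x‖} := fun i =>
    ((contDiffOn_comp hu i).mono hRΩ).of_le (by norm_num)
  have h1 := sphereFlux_current (a := 1) hR hr hu1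
  rw [one_mul] at h1
  rw [← h1]
  refine sphereFlux_eq_zero hR (fun i => ?_) (fun χ h1 h2 h3 =>
    hz.integral_current_im hΩ hRΩ hu (c := k ^ 2) (fun x hx j => by
      have := hN x hx j
      push_cast
      linear_combination this) h1 h2 h3) r hr
  have hfp : ∀ i j, ContinuousOn (pd i fun x => u x j) {x | R < ‖x‖} := fun i j =>
    (contDiffOn_pd (isOpen_exterior R) (hu1 j) (m := 0) (by norm_num) i).continuousOn
  have hfd : ContinuousOn (dv u) {x | R < ‖x‖} := continuousOn_finsetSum _ fun i _ => hfp i i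
  exact (continuousOn_const.mul (continuousOn_finsetSum _ fun j _ =>
    (hfp i j).mul (contDiffOn_conj (hu1 j)).continuousOn)).add
    ((continuousOn_const.mul hfd).mul (contDiffOn_conj (hu1 i)).continuousOn)

/-- Energy balance for an elastic field with vanishing trace, in terms of its pressure and shear
parts. -/
lemma HasZeroTrace.radialFlux_elastic {lam mu om k₁ k₂ : ℝ} {Ω : Set Space} (hΩ : IsOpen Ω) {R : ℝ}
    (hR : 0 ≤ R) (hRΩ : {x | R < ‖x‖} ⊆ Ω) {u v w : Space → CVec} (hu : ContDiffOn ℝ 2 u Ω)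
    (hN : ∀ x ∈ Ω, lameOp lam mu u x + om ^ 2 • u x = 0)
    (hk₁ : 0 < k₁) (hk₂ : 0 < k₂) (hk : (lam + 2 * mu) * k₁ ^ 2 = mu * k₂ ^ 2)
    (h : PSDecomp k₁ k₂ {x | R < ‖x‖} u v w) (hz : HasZeroTrace Ω u) {r : ℝ} (hr : R < r) :
    (lam + 2 * mu) * ∑ j, radialFlux (fun x => v x j) r +
      mu * ∑ j, radialFlux (fun x => w x j) r = 0 := by
  have hU := isOpen_exterior R
  have hv := fun i => (h.smooth_p hU hk₁ i).of_le (m := 1) (by simp)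
  have hw := fun i => (h.smooth_s hU hk₂ i).of_le (m := 1) (by simp)
  have hcur : ∀ {a : ℝ} {f : Space → CVec} (i : Fin 3),
      (∀ i, ContDiffOn ℝ 1 (fun x => f x i) {x | R < ‖x‖}) →
      ContinuousOn (current a 0 f i) {x | R < ‖x‖} := by
    intro a f i hf
    have hfp : ∀ i j, ContinuousOn (pd i fun x => f x j) {x | R < ‖x‖} := fun i j =>
      (contDiffOn_pd hU (hf j) (m := 0) (by norm_num) i).continuousOn
    have hfd : ContinuousOn (dv f) {x | R < ‖x‖} := continuousOn_finsetSum _ fun i _ => hfp i i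
    exact (continuousOn_const.mul (continuousOn_finsetSum _ fun j _ =>
      (hfp i j).mul (contDiffOn_conj (hf j)).continuousOn)).add
      ((continuousOn_const.mul hfd).mul (contDiffOn_conj (hf i)).continuousOn)
  rw [← sphereFlux_current hR hr hv, ← sphereFlux_current hR hr hw]
  have hi : ∀ {a : ℝ} {f : Space → CVec} (i : Fin 3),
      (∀ i, ContDiffOn ℝ 1 (fun x => f x i) {x | R < ‖x‖}) → Integrable
        (fun θ : sphere (0 : Space) 1 => current a 0 f i (r • (θ : Space)) * ((θ : Space) i : ℂ))
            sph :=
    fun i hf => integrable_sphere ((continuous_sphere_of_exterior hR hr (hcur i hf)).mul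
      (by fun_prop))
  have e : sphereFlux (current (lam + 2 * mu) 0 v) r + sphereFlux (current mu 0 w) r =
      sphereFlux (fun i x => current (lam + 2 * mu) 0 v i x + current mu 0 w i x) r := by
    simp only [sphereFlux, ← Complex.add_im, ← Finset.sum_add_distrib, mom]
    congr 1
    refine Finset.sum_congr rfl fun i _ => ?_
    rw [← integral_add (hi i hv) (hi i hw)]
    congr 1
    funext θ
    ring
  rw [e]
  refine sphereFlux_eq_zero hR (fun i => (hcur i hv).add (hcur i hw)) (fun χ h1 h2 h3 => ?_) r hr
  refine (h.integral_current hU hk₁ hk₂ hk h1 h2 h3).symm.trans ?_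
  refine hz.integral_current_im hΩ hRΩ hu (c := om ^ 2) (fun x hx j => ?_) h1 h2 h3
  have h1 := congrArg (fun z : CVec => z j) (hN x hx)
  simp only [PiLp.add_apply, PiLp.smul_apply, lameOp_apply (hu.contDiffAt (hΩ.mem_nhds hx)),
    PiLp.zero_apply, Complex.real_smul] at h1
  push_cast at h1 ⊢
  exact h1

/-! ### Plane waves -/

/-- The scalar plane wave `e^{i k x·d}`. -/
def phase (k : ℝ) (d x : Space) : ℂ := Complex.exp (Complex.I * (k * inner ℝ x d : ℝ))

/-- The plane wave `A b e^{i k x·d}` with wave number `k`, direction `d` and polarization `b`. -/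
def planeWave (A : ℂ) (k : ℝ) (d b x : Space) : CVec := (A * phase k d x) • toCVec b

lemma planeWave_apply (A : ℂ) (k : ℝ) (d b x : Space) (j : Fin 3) :
    planeWave A k d b x j = (A * b j) * phase k d x := by
  simp [planeWave, toCVec]; ring

lemma incident_eq_planeWave_p (lam mu om : ℝ) (α : ℂ) (d dp : Space) :
    incident lam mu om α 0 d dp = planeWave α (kP lam mu om) d d := by
  funext x; simp [incident, planeWave, phase]

lemma incident_eq_planeWave_s (lam mu om : ℝ) (β : ℂ) (d dp : Space) :
    incident lam mu om 0 β d dp = planeWave β (kS mu om) d dp := by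
  funext x; simp [incident, planeWave, phase]

lemma phase_add (k : ℝ) (d x a : Space) : phase k d (x + a) = phase k d a * phase k d x := by
  rw [phase, phase, phase, ← Complex.exp_add, inner_add_left]
  congr 1
  push_cast
  ring

lemma norm_phase (k : ℝ) (d x : Space) : ‖phase k d x‖ = 1 := by
  rw [phase, mul_comm, Complex.norm_exp_ofReal_mul_I]

lemma contDiff_phase (k : ℝ) (d : Space) : ContDiff ℝ ∞ (phase k d) := by
  unfold phase
  have h : ContDiff ℝ ∞ fun x : Space => inner ℝ x d := contDiff_id.inner ℝ contDiff_const
  exact (contDiff_const.mul (Complex.ofRealCLM.contDiff.comp (contDiff_const.mul h))).cexp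

lemma pd_phase (k : ℝ) (d : Space) (i : Fin 3) (x : Space) :
    pd i (phase k d) x = Complex.I * k * d i * phase k d x := by
  have h1 : HasFDerivAt (fun y : Space => k * inner ℝ y d) (k • innerSL ℝ d) x := by
    have := ((innerSL ℝ d).hasFDerivAt (x := x)).const_mul k
    refine this.congr_of_eventuallyEq (Eventually.of_forall fun y => ?_)
    simp [real_inner_comm]
  have h2 := ((Complex.ofRealCLM.hasFDerivAt.comp x h1).const_mul Complex.I).cexp
  have h3 : fderiv ℝ (phase k d) x = _ := h2.fderiv
  rw [pd, h3]
  simp [phase, EuclideanSpace.inner_single_right]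
  ring

lemma contDiff_planeWave (A : ℂ) (k : ℝ) (d b : Space) : ContDiff ℝ ∞ (planeWave A k d b) :=
  (contDiff_const.mul (contDiff_phase k d)).smul contDiff_const

lemma pd_planeWave (A : ℂ) (k : ℝ) (d b : Space) (i j : Fin 3) :
    pd i (fun x => planeWave A k d b x j) =
      fun x => (A * b j * (Complex.I * k * d i)) * phase k d x := by
  funext x
  simp only [planeWave_apply]
  rw [pd_const_mul ((contDiff_phase k d).differentiable (by simp) x), pd_phase]
  ring

lemma dv_planeWave (A : ℂ) (k : ℝ) (d b : Space) :
    dv (planeWave A k d b) = fun x => (A * (Complex.I * k) * (inner ℝ b d : ℝ)) * phase k d x := by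
  funext x
  simp only [dv, pd_planeWave, PiLp.inner_apply, Fin.sum_univ_three]
  simp
  ring

lemma pd_const_mul_phase (c : ℂ) (k : ℝ) (d : Space) (i : Fin 3) (x : Space) :
    pd i (fun x => c * phase k d x) x = c * (Complex.I * k * d i) * phase k d x := by
  rw [pd_const_mul ((contDiff_phase k d).differentiable (by simp) x), pd_phase]
  ring

lemma lap_planeWave (A : ℂ) (k : ℝ) {d : Space} (hd : ‖d‖ = 1) (b : Space) (j : Fin 3) (x : Space) :
    lap (fun x => planeWave A k d b x j) x + (k : ℂ) ^ 2 * planeWave A k d b x j = 0 := by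
  have hd2 : (d 0 : ℂ) ^ 2 + (d 1 : ℂ) ^ 2 + (d 2 : ℂ) ^ 2 = 1 := by
    have : ‖d‖ ^ 2 = 1 := by rw [hd]; norm_num
    rw [EuclideanSpace.norm_sq_eq, Fin.sum_univ_three] at this
    simp only [Real.norm_eq_abs, sq_abs] at this
    exact_mod_cast this
  simp only [lap, pd_planeWave, pd_const_mul_phase, Fin.sum_univ_three]
  rw [planeWave_apply]
  linear_combination A * b j * (Complex.I * k) ^ 2 * phase k d x * hd2 +
    A * b j * k ^ 2 * phase k d x * Complex.I_sq

lemma navier_planeWave {lam mu om k : ℝ} {A : ℂ} {d b : Space} (hd : ‖d‖ = 1)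
    (h : (b = d ∧ (k : ℂ) ^ 2 * (lam + 2 * mu) = om ^ 2) ∨
      (inner ℝ b d = 0 ∧ (k : ℂ) ^ 2 * mu = om ^ 2)) (x : Space) :
    lameOp lam mu (planeWave A k d b) x + om ^ 2 • planeWave A k d b x = 0 := by
  ext j
  have hc : ContDiffAt ℝ 2 (planeWave A k d b) x :=
    ((contDiff_planeWave A k d b).of_le two_le_infty).contDiffAt
  simp only [PiLp.add_apply, PiLp.smul_apply, lameOp_apply hc, PiLp.zero_apply, Complex.real_smul]
  have hl := lap_planeWave A k hd b j x
  rw [dv_planeWave, pd_const_mul_phase]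
  rw [planeWave_apply] at hl ⊢
  push_cast
  rcases h with ⟨rfl, hk⟩ | ⟨hb, hk⟩
  · have : inner ℝ b b = (1 : ℝ) := by rw [real_inner_self_eq_norm_sq, hd]; norm_num
    rw [this]
    push_cast
    linear_combination mu * hl - A * b j * phase k b x * hk +
      (lam + mu) * A * k ^ 2 * b j * phase k b x * Complex.I_sq
  · rw [hb]
    push_cast
    linear_combination mu * hl - A * b j * phase k d x * hk

/-- A plane wave carries no net energy through a sphere. -/
lemma radialFlux_planeWave (A : ℂ) (k : ℝ) (d b : Space) {r : ℝ} (hr : 0 < r) :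
    ∑ j, radialFlux (fun x => planeWave A k d b x j) r = 0 := by
  have hC : ∀ i, ContDiffOn ℝ 1 (fun x => planeWave A k d b x i) {x | 0 < ‖x‖} := fun i =>
    contDiffOn_comp ((contDiff_planeWave A k d b).of_le (by simp)).contDiffOn i
  have h1 := sphereFlux_current (a := 1) le_rfl hr hC
  rw [one_mul] at h1
  rw [← h1]
  have hJ : ∀ i, current 1 0 (planeWave A k d b) i = fun _ =>
      ∑ j, A * b j * (Complex.I * k * d i) * (starRingEnd ℂ) (A * b j) := by
    intro i
    funext x
    have hp : phase k d x * (starRingEnd ℂ) (phase k d x) = 1 := by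
      rw [Complex.mul_conj, Complex.normSq_eq_norm_sq, norm_phase]; norm_num
    simp only [current, pd_planeWave]
    simp only [planeWave_apply, map_mul, Complex.ofReal_one,
      Complex.ofReal_zero, one_mul, zero_mul, add_zero]
    refine Finset.sum_congr rfl fun j _ => ?_
    linear_combination A * b j * (Complex.I * k * d i) * ((starRingEnd ℂ) A *
      (starRingEnd ℂ) (b j : ℂ)) * hp
  refine sphereFlux_eq_zero le_rfl (fun i => by rw [hJ]; exact continuousOn_const)
    (fun χ h1 h2 h3 => ?_) r hr
  have h4 : ∀ i, Integrable fun x => ((pd i χ x : ℝ) : ℂ) := fun i => by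
    simpa using integrable_pd_mul isOpen_univ h1 h2 (subset_univ (tsupport (pd i χ)))
      (f := fun _ => (1 : ℂ)) continuousOn_const
  have h5 : ∀ i, ∫ x, ((pd i χ x : ℝ) : ℂ) = 0 := by
    intro i
    have := integral_pd_eq_zero (f := fun x => (χ x : ℂ))
      (Complex.ofRealCLM.contDiff.comp (h1.of_le (by simp)))
      (h2.comp_left (g := fun t : ℝ => (t : ℂ)) (by simp)) i
    rw [← this]
    congr 1
    funext x
    exact (pd_ofReal (h1.differentiable (by simp) x) i).symm
  simp only [hJ]
  rw [integral_finsetSum _ fun i _ => (h4 i).mul_const _]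
  simp only [integral_mul_const, h5, zero_mul, Finset.sum_const_zero, Complex.zero_im]

/-! ### Stability of the vanishing trace -/

lemma MemH10.congr {Ω : Set Space} (hΩ : IsOpen Ω) {u v : Space → CVec} (h : MemH10 Ω u)
    (huv : ∀ x ∈ Ω, u x = v x) : MemH10 Ω v := by
  intro ε hε
  obtain ⟨φ, h1, h2, h3, h4, h5⟩ := h ε hε
  refine ⟨φ, h1, h2, h3, ?_, ?_⟩
  · refine (eLpNorm_congr_ae ?_).trans_le h4
    exact (ae_restrict_iff' hΩ.measurableSet).2 (Eventually.of_forall fun x hx => by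
      simp [huv x hx])
  · refine (eLpNorm_congr_ae ?_).trans_le h5
    refine (ae_restrict_iff' hΩ.measurableSet).2 (Eventually.of_forall fun x hx => ?_)
    have : v =ᶠ[𝓝 x] u := by
      filter_upwards [hΩ.mem_nhds hx] with y hy using (huv y hy).symm
    simp only [this.fderiv_eq]

lemma HasZeroTrace.congr {Ω : Set Space} (hΩ : IsOpen Ω) {u v : Space → CVec}
    (h : HasZeroTrace Ω u) (huv : ∀ x ∈ Ω, u x = v x) : HasZeroTrace Ω v := fun χ h1 h2 =>
  (h χ h1 h2).congr hΩ fun x hx => by rw [huv x hx]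

lemma MemH10.sub {Ω : Set Space} (hΩ : IsOpen Ω) {u v : Space → CVec} (hu : ContDiffOn ℝ 1 u Ω)
    (hv : ContDiffOn ℝ 1 v Ω) (h : MemH10 Ω u) (h' : MemH10 Ω v) :
    MemH10 Ω (fun x => u x - v x) := by
  intro ε hε
  obtain ⟨φ, h1, h2, h3, h4, h5⟩ := h (ε / 2) (ENNReal.half_pos hε.ne')
  obtain ⟨ψ, k1, k2, k3, k4, k5⟩ := h' (ε / 2) (ENNReal.half_pos hε.ne')
  have d1 : ∀ {f : Space → CVec}, ContDiffOn ℝ 1 f Ω → ∀ x ∈ Ω, DifferentiableAt ℝ f x :=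
    fun hf x hx => (hf.contDiffAt (hΩ.mem_nhds hx)).differentiableAt (by norm_num)
  have m1 : ∀ {f g : Space → CVec}, ContDiffOn ℝ 1 f Ω → ContDiff ℝ ∞ g →
      AEStronglyMeasurable (fun x => f x - g x) (volume.restrict Ω) := fun hf hg =>
    (hf.continuousOn.sub hg.continuous.continuousOn).aestronglyMeasurable hΩ.measurableSet
  have m2 : ∀ {f g : Space → CVec}, ContDiffOn ℝ 1 f Ω → ContDiff ℝ ∞ g →
      AEStronglyMeasurable (fun x => fderiv ℝ f x - fderiv ℝ g x) (volume.restrict Ω) :=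
    fun hf hg => ((hf.continuousOn_fderiv_of_isOpen hΩ (by norm_num)).sub
      (hg.continuous_fderiv (by simp)).continuousOn).aestronglyMeasurable hΩ.measurableSet
  refine ⟨fun x => φ x - ψ x, h1.sub k1, h2.sub k2, ?_, ?_, ?_⟩
  · exact (tsupport_sub φ ψ).trans (union_subset h3 k3)
  · have e : (fun x => u x - v x - (φ x - ψ x)) = (fun x => u x - φ x) - fun x => v x - ψ x := by
      funext x; simp only [Pi.sub_apply]; abel
    rw [e, ← ENNReal.add_halves ε]
    exact (eLpNorm_sub_le (m1 hu h1) (m1 hv k1) (by norm_num)).trans (add_le_add h4 k4)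
  · have e : (fun x => fderiv ℝ (fun x => u x - v x) x - fderiv ℝ (fun x => φ x - ψ x) x)
        =ᵐ[volume.restrict Ω] (fun x => fderiv ℝ u x - fderiv ℝ φ x) -
          fun x => fderiv ℝ v x - fderiv ℝ ψ x := by
      refine (ae_restrict_iff' hΩ.measurableSet).2 (Eventually.of_forall fun x hx => ?_)
      change fderiv ℝ (fun x => u x - v x) x - fderiv ℝ (fun x => φ x - ψ x) x =
        (fderiv ℝ u x - fderiv ℝ φ x) - (fderiv ℝ v x - fderiv ℝ ψ x)
      rw [fderiv_fun_sub (d1 hu x hx) (d1 hv x hx), fderiv_fun_sub (h1.differentiable (by simp) x)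
        (k1.differentiable (by simp) x)]
      abel
    rw [eLpNorm_congr_ae e, ← ENNReal.add_halves ε]
    exact (eLpNorm_sub_le (m2 hu h1) (m2 hv k1) (by norm_num)).trans (add_le_add h5 k5)

lemma MemH10.clm {Ω : Set Space} (hΩ : IsOpen Ω) {u : Space → CVec} (hu : ContDiffOn ℝ 1 u Ω)
    (h : MemH10 Ω u) (L : CVec →L[ℝ] CVec) : MemH10 Ω (fun x => L (u x)) := by
  intro ε hε
  set c : ℝ := ‖L‖ + 1 with hc
  have hc0 : 0 < c := by positivity
  have hcE : ENNReal.ofReal c ≠ 0 := (ENNReal.ofReal_pos.2 hc0).ne'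
  obtain ⟨φ, h1, h2, h3, h4, h5⟩ := h (ε / ENNReal.ofReal c)
    (ENNReal.div_pos hε.ne' ENNReal.ofReal_ne_top)
  have d1 : ∀ x ∈ Ω, DifferentiableAt ℝ u x :=
    fun x hx => (hu.contDiffAt (hΩ.mem_nhds hx)).differentiableAt (by norm_num)
  refine ⟨fun x => L (φ x), L.contDiff.comp h1, h2.comp_left (map_zero L), ?_, ?_, ?_⟩
  · exact (tsupport_comp_subset (map_zero L) φ).trans h3
  · refine (eLpNorm_le_mul_eLpNorm_of_ae_le_mul (c := c) (g := fun x => u x - φ x)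
      (Eventually.of_forall fun x => ?_) 2).trans
      ((mul_le_mul_right h4 _).trans ENNReal.mul_div_le)
    rw [← map_sub]
    refine (L.le_opNorm _).trans ?_
    gcongr
    linarith
  · refine (eLpNorm_le_mul_eLpNorm_of_ae_le_mul (c := c) (g := fun x => fderiv ℝ u x - fderiv ℝ φ x)
      ((ae_restrict_iff' hΩ.measurableSet).2 (Eventually.of_forall fun x hx => ?_)) 2).trans
      ((mul_le_mul_right h5 _).trans ENNReal.mul_div_le)
    have e1 : fderiv ℝ (fun x => L (u x)) x = L ∘L fderiv ℝ u x :=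
      (L.hasFDerivAt.comp x (d1 x hx).hasFDerivAt).fderiv
    have e2 : fderiv ℝ (fun x => L (φ x)) x = L ∘L fderiv ℝ φ x :=
      (L.hasFDerivAt.comp x (h1.differentiable (by simp) x).hasFDerivAt).fderiv
    rw [e1, e2, ← ContinuousLinearMap.comp_sub]
    refine (ContinuousLinearMap.opNorm_comp_le _ _).trans ?_
    gcongr
    linarith

lemma HasZeroTrace.sub {Ω : Set Space} (hΩ : IsOpen Ω) {u v : Space → CVec}
    (hu : ContDiffOn ℝ 1 u Ω) (hv : ContDiffOn ℝ 1 v Ω) (h : HasZeroTrace Ω u)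
    (h' : HasZeroTrace Ω v) : HasZeroTrace Ω (fun x => u x - v x) := fun χ h1 h2 => by
  have hχ : ContDiffOn ℝ 1 χ Ω := (h1.of_le (by simp)).contDiffOn
  have h3 : ContDiffOn ℝ 1 (fun x => χ x • u x) Ω := hχ.smul hu
  have h4 : ContDiffOn ℝ 1 (fun x => χ x • v x) Ω := hχ.smul hv
  simpa only [smul_sub] using (h χ h1 h2).sub hΩ h3 h4 (h' χ h1 h2)

lemma HasZeroTrace.clm {Ω : Set Space} (hΩ : IsOpen Ω) {u : Space → CVec}
    (hu : ContDiffOn ℝ 1 u Ω) (h : HasZeroTrace Ω u) (L : CVec →L[ℝ] CVec) :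
    HasZeroTrace Ω (fun x => L (u x)) := fun χ h1 h2 => by
  have hχ : ContDiffOn ℝ 1 χ Ω := (h1.of_le (by simp)).contDiffOn
  have h3 : ContDiffOn ℝ 1 (fun x => χ x • u x) Ω := hχ.smul hu
  simpa only [map_smul] using (h χ h1 h2).clm hΩ h3 L

lemma HasZeroTrace.comp_add {Ω : Set Space} (hΩ : IsOpen Ω) {u : Space → CVec}
    (hu : ContDiffOn ℝ 1 u Ω) (h : HasZeroTrace Ω u) (a : Space) :
    HasZeroTrace ((fun x => x + a) ⁻¹' Ω) (fun x => u (x + a)) := by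
  intro χ h1 h2 ε hε
  have hχ : ContDiff ℝ ∞ fun x => χ (x + -a) := h1.comp (contDiff_id.add contDiff_const)
  obtain ⟨φ, k1, k2, k3, k4, k5⟩ := h (fun x => χ (x + -a)) hχ
    (h2.comp_homeomorph (Homeomorph.addRight (-a))) ε hε
  have hmp : MeasurePreserving (fun x => x + a) (volume.restrict ((fun x => x + a) ⁻¹' Ω))
      (volume.restrict Ω) :=
    (measurePreserving_add_right volume a).restrict_preimage hΩ.measurableSet
  have hc : ContDiffOn ℝ 1 (fun x => χ (x + -a) • u x) Ω :=
    (hχ.of_le (by simp)).contDiffOn.smul hu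
  have m1 : AEStronglyMeasurable (fun x => χ (x + -a) • u x - φ x) (volume.restrict Ω) :=
    (hc.continuousOn.sub k1.continuous.continuousOn).aestronglyMeasurable hΩ.measurableSet
  have m2 : AEStronglyMeasurable (fun x => fderiv ℝ (fun x => χ (x + -a) • u x) x - fderiv ℝ φ x)
      (volume.restrict Ω) := ((hc.continuousOn_fderiv_of_isOpen hΩ (by norm_num)).sub
      (k1.continuous_fderiv (by simp)).continuousOn).aestronglyMeasurable hΩ.measurableSet
  refine ⟨fun x => φ (x + a), k1.comp (contDiff_id.add contDiff_const),
    k2.comp_homeomorph (Homeomorph.addRight a), ?_, ?_, ?_⟩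
  · rw [show tsupport (fun x => φ (x + a)) = (fun x => x + a) ⁻¹' tsupport φ from
      tsupport_comp_eq_preimage φ (Homeomorph.addRight a)]
    exact preimage_mono k3
  · rw [← eLpNorm_comp_measurePreserving m1 hmp] at k4
    simpa [Function.comp_def] using k4
  · rw [← eLpNorm_comp_measurePreserving m2 hmp] at k5
    have e : ∀ x, fderiv ℝ (fun x => χ x • u (x + a)) x =
        fderiv ℝ (fun x => χ (x + -a) • u x) (x + a) := by
      intro x
      rw [← fderiv_comp_add_right]
      simp
    simpa [Function.comp_def, e, fderiv_comp_add_right] using k5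

/-- A plane wave cannot have vanishing trace on the boundary of a bounded set with interior:
testing would give that the set has measure zero. -/
lemma not_hasZeroTrace_planeWave {A : ℂ} (hA : A ≠ 0) (k : ℝ) (d : Space) {b : Space} (hb : b ≠ 0)
    {D : Set Space} (hDo : IsOpen D) (hDb : Bornology.IsBounded D) (hDn : D.Nonempty) :
    ¬ HasZeroTrace (closure D)ᶜ (planeWave A k d b) := by
  intro h
  have hΩ : IsOpen (closure D)ᶜ := isClosed_closure.isOpen_compl
  obtain ⟨j, hj⟩ : ∃ j, b j ≠ 0 := by
    by_contra hn
    push Not at hn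
    exact hb (by ext j; simpa using hn j)
  have hjc : (b j : ℂ) ≠ 0 := by exact_mod_cast hj
  obtain ⟨R, hR⟩ := hDb.closure.subset_ball (0 : Space)
  obtain ⟨η, e1, e2, e3⟩ := exists_cutoff R
  have hηc : ContDiff ℝ ∞ fun x => (η x : ℂ) := Complex.ofRealCLM.contDiff.comp e1
  have hηs : HasCompactSupport fun x => (η x : ℂ) :=
    e2.comp_left (g := fun t : ℝ => (t : ℂ)) (by simp)
  set w : Space → CVec := fun x => η x • planeWave A k d b x with hw
  have hwC : ContDiff ℝ ∞ w := e1.smul (contDiff_planeWave A k d b)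
  -- `ψ` is chosen such that `ψ wⱼ = x₀` near the closure of `D`
  set ψ : Space → ℂ := fun x => (A * b j)⁻¹ * ((x 0 : ℂ) * (phase (-k) d x * η x)) with hψ
  have hψC : ContDiff ℝ ∞ ψ := contDiff_const.mul
    ((Homog.coord 0).contDiff.mul ((contDiff_phase _ _).mul hηc))
  have hψs : HasCompactSupport ψ := (hηs.mul_left.mul_left).mul_left
  have hψw : ∀ x, ψ x * w x j = (x 0 : ℂ) * (η x : ℂ) ^ 2 := by
    intro x
    have hp : phase (-k) d x * phase k d x = 1 := by
      rw [phase, phase, ← Complex.exp_add]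
      simp
    simp only [hψ, hw, PiLp.smul_apply, planeWave_apply, Complex.real_smul]
    field_simp
    linear_combination (x 0 : ℂ) * (η x : ℂ) ^ 2 * hp
  have hψp : Continuous (pd 0 ψ) := (contDiff_pd hψC 0).continuous
  have hψps : HasCompactSupport (pd 0 ψ) := hasCompactSupport_pd hψs 0
  have hprod : ∀ {f : Space → ℂ}, ContDiff ℝ ∞ f → ∀ x,
      pd 0 (fun x => ψ x * f x) x = pd 0 ψ x * f x + ψ x * pd 0 f x := fun hf x =>
    pd_mul (hψC.differentiable (by simp) x) (hf.differentiable (by simp) x) 0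
  have hconj : ∀ {f : Space → ℂ}, Continuous f → HasCompactSupport f →
      MemLp (fun x => (starRingEnd ℂ) (f x)) 2 (volume.restrict (closure D)ᶜ) := fun h1 h2 =>
    memLp_test (Complex.continuous_conj.comp h1) (h2.comp_left (map_zero _)) _
  set g : Fin 3 → Space → ℂ := fun l x => if l = j then (starRingEnd ℂ) (pd 0 ψ x) else 0 with hg
  set G : Fin 3 → Fin 3 → Space → ℂ := fun i l x =>
    if i = 0 then (if l = j then (starRingEnd ℂ) (ψ x) else 0) else 0 with hG
  have hwj : ContDiff ℝ ∞ fun x => w x j := (contDiff_piLp 2).1 hwC j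
  have key := ((h η e1 e2).integral_eq_zero hΩ (hwC.of_le (by simp)).contDiffOn (g := g) (G := G)
    (fun l => by
      by_cases hl : l = j
      · simpa [hg, hl] using hconj hψp hψps
      · simp [hg, hl])
    (fun i l => by
      by_cases hi : i = 0
      · by_cases hl : l = j
        · simpa [hG, hi, hl] using hconj hψC.continuous hψs
        · simp [hG, hl]
      · simp [hG, hi])
    (fun φ p1 p2 p3 => by
      simp only [hg, hG, ite_mul, zero_mul, Finset.sum_ite_eq', Finset.sum_ite_irrel,
        Finset.sum_const_zero, Finset.mem_univ, if_true]
      have h0 := integral_pd_eq_zero (f := fun x => ψ x * φ j x) ((hψC.mul (p1 j)).of_le (by simp))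
        (p2 j).mul_left 0
      rw [← setIntegral_eq_integral_of_forall_compl_eq_zero (s := (closure D)ᶜ)] at h0
      · have h1 := congrArg (starRingEnd ℂ) h0
        rw [← integral_conj, map_zero] at h1
        rw [← h1]
        congr 1
        funext x
        rw [hprod (p1 j)]
        simp
      · intro x hx
        have h1 : x ∉ tsupport (φ j) := fun h => hx (p3 j h)
        rw [hprod (p1 j), image_eq_zero_of_notMem_tsupport h1,
          image_eq_zero_of_notMem_tsupport fun h => h1 (tsupport_pd_subset _ 0 h)]
        simp)).2
  simp only [hg, hG, ite_mul, zero_mul, Finset.sum_ite_eq', Finset.sum_ite_irrel,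
    Finset.sum_const_zero, Finset.mem_univ, if_true] at key
  set F : Space → ℂ := fun x => ψ x * w x j with hF
  have hFC : ContDiff ℝ ∞ F := hψC.mul hwj
  have hFs : HasCompactSupport F := hψs.mul_right
  have h1 : ∫ x in (closure D)ᶜ, pd 0 F x = 0 := by
    have h2 := congrArg (starRingEnd ℂ) key
    rw [← integral_conj, map_zero] at h2
    rw [← h2]
    congr 1
    funext x
    rw [hF, hprod hwj]
    simp [hw]
  have hint : Integrable (pd 0 F) :=
    (contDiff_pd hFC 0).continuous.integrable_of_hasCompactSupport (hasCompactSupport_pd hFs 0)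
  have h2 : ∫ x in closure D, pd 0 F x = 0 := by
    have h3 := integral_add_compl (isClosed_closure (s := D)).measurableSet hint
    rw [h1, add_zero] at h3
    rw [h3]
    exact integral_pd_eq_zero (hFC.of_le (by simp)) hFs 0
  have h3 : ∀ x ∈ closure D, pd 0 F x = 1 := by
    intro x hx
    have : F =ᶠ[𝓝 x] fun y => (y 0 : ℂ) := by
      filter_upwards [isOpen_ball.mem_nhds (hR hx)] with y hy
      rw [hF]
      simp only [hψw, e3 y hy]
      simp
    rw [pd_congr this]
    have h4 := pd_ofReal (χ := fun y : Space => y 0) (x := x) (by fun_prop) 0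
    rw [h4]
    have h5 : HasFDerivAt (fun y : Space => y 0) (EuclideanSpace.proj 0 : Space →L[ℝ] ℝ) x :=
      (EuclideanSpace.proj 0 : Space →L[ℝ] ℝ).hasFDerivAt
    rw [pd, h5.fderiv]
    simp
  rw [setIntegral_congr_fun isClosed_closure.measurableSet h3, setIntegral_const,
      smul_eq_zero] at h2
  have hvol : 0 < volume.real (closure D) := by
    rw [measureReal_def, ENNReal.toReal_pos_iff]
    exact ⟨(hDo.measure_pos volume hDn).trans_le (measure_mono subset_closure),
      hDb.closure.measure_lt_top⟩
  rcases h2 with h2 | h2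
  · exact hvol.ne' h2
  · exact one_ne_zero h2

/-! ### Far field patterns of the pressure part and the shear part -/

lemma eventually_cobounded_lt (R : ℝ) : ∀ᶠ x in Bornology.cobounded Space, R < ‖x‖ :=
  tendsto_norm_cobounded_atTop.eventually (eventually_gt_atTop R)

lemma exists_forall_of_eventually_cobounded {p : Space → Prop}
    (h : ∀ᶠ x in Bornology.cobounded Space, p x) (R : ℝ) : ∃ R' > R, ∀ x, R' ≤ ‖x‖ → p x := by
  obtain ⟨R₁, -, hR₁⟩ := (hasBasis_cobounded_norm (E := Space)).eventually_iff.1 h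
  exact ⟨max R₁ (R + 1), lt_max_of_lt_right (by linarith), fun x hx =>
    hR₁ ((le_max_left _ _).trans hx)⟩

lemma IsRadiating.radCond {k R : ℝ} {v : Space → CVec} (h : IsRadiating k v)
    (hd : ∀ x, R < ‖x‖ → DifferentiableAt ℝ v x) (j : Fin 3) : RadCond k (fun x => v x j) := by
  have h0 := tendsto_zero_iff_norm_tendsto_zero.1 h
  refine squeeze_zero' (Eventually.of_forall fun x => by positivity) ?_ h0
  filter_upwards [eventually_cobounded_lt R] with x hx
  rw [norm_smul, norm_norm]
  refine mul_le_mul_of_nonneg_left ?_ (norm_nonneg x)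
  rw [fderiv_comp_apply (hd x hx)]
  exact norm_comp_le (radialDeriv v x - (Complex.I * (k : ℂ)) • v x) j

/-- The radial shift by `h`: the point `(r + h)θ` for `x = rθ`. -/
def radialShift (h : ℝ) (x : Space) : Space := (1 + h / ‖x‖) • x

lemma norm_radialShift {h : ℝ} (hh : 0 < h) {x : Space} (hx : x ≠ 0) :
    ‖radialShift h x‖ = ‖x‖ + h := by
  have h0 : 0 < ‖x‖ := norm_pos_iff.2 hx
  rw [radialShift, norm_smul, Real.norm_of_nonneg (by positivity)]
  field_simp

lemma normalize_radialShift {h : ℝ} (hh : 0 < h) {x : Space} (hx : x ≠ 0) :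
    ‖radialShift h x‖⁻¹ • radialShift h x = ‖x‖⁻¹ • x := by
  have h0 : 0 < ‖x‖ := norm_pos_iff.2 hx
  rw [norm_radialShift hh hx, radialShift, smul_smul]
  congr 1
  field_simp

lemma tendsto_radialShift {h : ℝ} (hh : 0 < h) :
    Tendsto (radialShift h) (Bornology.cobounded Space) (Bornology.cobounded Space) := by
  rw [← tendsto_norm_atTop_iff_cobounded]
  refine tendsto_atTop_mono' _ ?_ tendsto_norm_cobounded_atTop
  filter_upwards [eventually_cobounded_lt 0] with x hx
  rw [norm_radialShift hh (norm_pos_iff.1 hx)]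
  linarith

/-- Along rays an outgoing wave behaves like `e^{ikr}/r`. -/
lemma RadCond.tendsto_shift {k R h : ℝ} (hh : 0 < h) {v : Space → ℂ} (hv : RadCond k v)
    (hd : ∀ x, R < ‖x‖ → DifferentiableAt ℝ v x) :
    Tendsto (fun x : Space => (‖x‖ : ℂ) * (v (radialShift h x) -
      Complex.exp (Complex.I * (k * h : ℝ)) * v x)) (Bornology.cobounded Space) (𝓝 0) := by
  rw [Metric.tendsto_nhds]
  intro ε hε
  obtain ⟨R₁, hR₁, hb⟩ := exists_forall_of_eventually_cobounded
    (hv.eventually (ge_mem_nhds (show (0 : ℝ) < ε / (2 * h) by positivity))) (max R 0)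
  filter_upwards [eventually_cobounded_lt R₁] with x hx
  have hr : 0 < ‖x‖ := (le_max_right R 0).trans_lt (hR₁.trans hx)
  set r := ‖x‖ with hrdef
  set θ : Space := r⁻¹ • x with hθ
  have hθ1 : ‖θ‖ = 1 := by
    rw [hθ, norm_smul, norm_inv, norm_norm, ← hrdef, inv_mul_cancel₀ hr.ne']
  have hx1 : radialShift h x = (r + h) • θ := by
    rw [radialShift, ← hrdef, hθ, smul_smul]
    congr 1
    field_simp
  have hx2 : x = r • θ := by rw [hθ, smul_smul, mul_inv_cancel₀ hr.ne', one_smul]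
  clear_value θ
  set g : ℝ → ℂ := fun t => Complex.exp (-(Complex.I * (k * t : ℝ))) * v (t • θ) with hg
  set g' : ℝ → ℂ := fun t => Complex.exp (-(Complex.I * (k * t : ℝ))) *
    (fderiv ℝ v (t • θ) θ - Complex.I * k * v (t • θ)) with hg'
  have hn : ∀ t, r ≤ t → ‖t • θ‖ = t := fun t ht => by
    rw [norm_smul, hθ1, mul_one, Real.norm_of_nonneg (hr.le.trans ht)]
  have hder : ∀ t ∈ Icc r (r + h), HasDerivWithinAt g (g' t) (Icc r (r + h)) t := by
    intro t ht
    have h1 : R < ‖t • θ‖ := by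
      rw [hn t ht.1]
      exact (le_max_left R 0).trans_lt ((hR₁.trans hx).trans_le ht.1)
    have h2 : HasDerivAt (fun t : ℝ => v (t • θ)) (fderiv ℝ v (t • θ) θ) t := by
      have := (hd _ h1).hasFDerivAt.comp_hasDerivAt t ((hasDerivAt_id t).smul_const θ)
      rw [one_smul] at this
      exact this
    have h3 : HasDerivAt (fun t : ℝ => Complex.exp (-(Complex.I * (k * t : ℝ))))
        (Complex.exp (-(Complex.I * (k * t : ℝ))) * (-(Complex.I * k))) t := by
      have h4 : HasDerivAt (fun t : ℝ => ((k * t : ℝ) : ℂ)) (k : ℂ) t := by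
        have := ((hasDerivAt_id t).const_mul k).ofReal_comp
        simpa using this
      exact ((h4.const_mul Complex.I).neg).cexp
    refine ((h3.mul h2).congr_deriv ?_).hasDerivWithinAt
    rw [hg']; ring
  have hnorm : ∀ t : ℝ, ‖Complex.exp (-(Complex.I * (k * t : ℝ)))‖ = 1 := fun t => by
    rw [show -(Complex.I * ((k * t : ℝ) : ℂ)) = ((-(k * t) : ℝ) : ℂ) * Complex.I by push_cast; ring,
      Complex.norm_exp_ofReal_mul_I]
  have hbd : ∀ t ∈ Ico r (r + h), ‖g' t‖ ≤ ε / (2 * h) / r := by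
    intro t ht
    have h1 := hb (t • θ) (by rw [hn t ht.1]; exact hx.le.trans ht.1)
    have ht0 : 0 < t := hr.trans_le ht.1
    rw [hn t ht.1, smul_smul, inv_mul_cancel₀ ht0.ne', one_smul] at h1
    rw [hg', norm_mul, hnorm, one_mul, le_div_iff₀ hr]
    refine le_trans ?_ h1
    rw [mul_comm]
    exact mul_le_mul_of_nonneg_right ht.1 (norm_nonneg _)
  have key := norm_image_sub_le_of_norm_deriv_le_segment' hder hbd (r + h) ⟨by linarith, le_rfl⟩
  have e : v (radialShift h x) - Complex.exp (Complex.I * (k * h : ℝ)) * v x =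
      Complex.exp (Complex.I * (k * (r + h) : ℝ)) * (g (r + h) - g r) := by
    rw [hx1, hg, mul_sub, ← mul_assoc, ← mul_assoc, ← Complex.exp_add, ← Complex.exp_add]
    have hvx : v x = v (r • θ) := congrArg v hx2
    rw [hvx]
    have e1 : Complex.I * ((k * (r + h) : ℝ) : ℂ) + -(Complex.I * ((k * (r + h) : ℝ) : ℂ)) = 0 := by
      ring
    have e2 : Complex.I * ((k * (r + h) : ℝ) : ℂ) + -(Complex.I * ((k * r : ℝ) : ℂ)) =
        Complex.I * ((k * h : ℝ) : ℂ) := by push_cast; ring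
    rw [e1, e2, Complex.exp_zero, one_mul]
  have hn2 : ‖Complex.exp (Complex.I * (k * (r + h) : ℝ))‖ = 1 := by
    rw [mul_comm, Complex.norm_exp_ofReal_mul_I]
  rw [dist_zero_right, norm_mul, e, norm_mul, hn2, one_mul, Complex.norm_real,
    Real.norm_of_nonneg hr.le]
  have h5 : r * ‖g (r + h) - g r‖ ≤ r * (ε / (2 * h) / r * (r + h - r)) :=
    mul_le_mul_of_nonneg_left key hr.le
  have h6 : r * (ε / (2 * h) / r * (r + h - r)) = ε / 2 := by field_simp; ring
  linarith

/-- If a sum of two outgoing waves with different wave numbers has a far field expansion, the two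
terms of the expansion belong to the two waves, and the patterns are bounded. -/
lemma RadCond.tendsto_farField {k₁ k₂ R : ℝ} (hk : k₁ < k₂) (hR : 0 ≤ R) {f v w p s : Space → ℂ}
    (hv : RadCond k₁ v) (hw : RadCond k₂ w) (hvd : ∀ x, R < ‖x‖ → DifferentiableAt ℝ v x)
    (hwd : ∀ x, R < ‖x‖ → DifferentiableAt ℝ w x) (hf : ∀ x, R < ‖x‖ → f x = v x + w x)
    (hE : Tendsto (fun x : Space => ‖x‖ * f x -
      (Complex.exp (Complex.I * (k₁ * ‖x‖ : ℝ)) * p (‖x‖⁻¹ • x) +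
        Complex.exp (Complex.I * (k₂ * ‖x‖ : ℝ)) * s (‖x‖⁻¹ • x)))
            (Bornology.cobounded Space) (𝓝 0)) :
    Tendsto (fun x : Space => ‖x‖ * v x - Complex.exp (Complex.I * (k₁ * ‖x‖ : ℝ)) * p (‖x‖⁻¹ • x))
      (Bornology.cobounded Space) (𝓝 0) ∧
    Tendsto (fun x : Space => ‖x‖ * w x - Complex.exp (Complex.I * (k₂ * ‖x‖ : ℝ)) * s (‖x‖⁻¹ • x))
      (Bornology.cobounded Space) (𝓝 0) ∧
    (∃ C, ∀ θ : Space, ‖θ‖ = 1 → ‖p θ‖ ≤ C) ∧ ∃ C, ∀ θ : Space, ‖θ‖ = 1 → ‖s θ‖ ≤ C := by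
  -- with this shift the two exponentials get opposite signs
  set h : ℝ := Real.pi / (k₂ - k₁) with hh
  have hh0 : 0 < h := div_pos Real.pi_pos (sub_pos.2 hk)
  set c₁ := Complex.exp (Complex.I * (k₁ * h : ℝ)) with hc₁
  set c₂ := Complex.exp (Complex.I * (k₂ * h : ℝ)) with hc₂
  have hc : c₂ = -c₁ := by
    have : Complex.I * ((k₂ * h : ℝ) : ℂ) = Complex.I * ((k₁ * h : ℝ) : ℂ) +
        Real.pi * Complex.I := by
      have h1 : k₂ * h = k₁ * h + Real.pi := by
        rw [hh]
        have : k₂ - k₁ ≠ 0 := (sub_pos.2 hk).ne'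
        field_simp
        ring
      rw [h1]; push_cast; ring
    rw [hc₂, this, Complex.exp_add, Complex.exp_pi_mul_I]; ring
  have hδ : c₁ - c₂ ≠ 0 := by
    rw [hc, sub_neg_eq_add, ← two_mul]
    exact mul_ne_zero two_ne_zero (Complex.exp_ne_zero _)
  set E : Space → ℂ := fun x => ‖x‖ * f x -
    (Complex.exp (Complex.I * (k₁ * ‖x‖ : ℝ)) * p (‖x‖⁻¹ • x) +
      Complex.exp (Complex.I * (k₂ * ‖x‖ : ℝ)) * s (‖x‖⁻¹ • x)) with hEdef
  have hexp : ∀ k t : ℝ, Complex.exp (Complex.I * (k * (t + h) : ℝ)) =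
      Complex.exp (Complex.I * (k * h : ℝ)) * Complex.exp (Complex.I * (k * t : ℝ)) := by
    intro k t
    rw [← Complex.exp_add]; congr 1; push_cast; ring
  have hshift : ∀ x : Space, x ≠ 0 → (c₁ - c₂) * (Complex.exp (Complex.I * (k₁ * ‖x‖ : ℝ)) *
      p (‖x‖⁻¹ • x)) = (‖x‖ + h : ℝ) * f (radialShift h x) - c₂ * (‖x‖ * f x) -
        (E (radialShift h x) - c₂ * E x) := by
    intro x hx
    simp only [hEdef]
    rw [normalize_radialShift hh0 hx, norm_radialShift hh0 hx, hexp, hexp, ← hc₁, ← hc₂]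
    ring
  clear_value E
  have hfc : ContinuousOn f {x | R < ‖x‖} := by
    have : ContinuousOn (fun x => v x + w x) {x | R < ‖x‖} := fun x hx =>
      ((hvd x hx).continuousAt.add (hwd x hx).continuousAt).continuousWithinAt
    exact this.congr hf
  have hnexp : ∀ k t : ℝ, ‖Complex.exp (Complex.I * (k * t : ℝ))‖ = 1 := fun k t => by
    rw [mul_comm, Complex.norm_exp_ofReal_mul_I]
  obtain ⟨R₁, hR₁, hb⟩ := exists_forall_of_eventually_cobounded
    ((tendsto_zero_iff_norm_tendsto_zero.1 hE).eventually (ge_mem_nhds one_pos)) R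
  have hR₁0 : 0 < R₁ := hR.trans_lt hR₁
  obtain ⟨M, hM⟩ := (isCompact_sphere (0 : Space) R₁).exists_bound_of_continuousOn
    (hfc.mono fun x hx => by
      rw [mem_sphere_zero_iff_norm] at hx
      exact hR₁.trans_eq hx.symm)
  obtain ⟨M', hM'⟩ := (isCompact_sphere (0 : Space) (R₁ + h)).exists_bound_of_continuousOn
    (hfc.mono fun x hx => by
      rw [mem_sphere_zero_iff_norm] at hx
      exact (hR₁.trans (by linarith)).trans_eq hx.symm)
  have hunit : ∀ θ : Space, ‖θ‖ = 1 → ‖R₁ • θ‖ = R₁ ∧ ‖R₁ • θ‖⁻¹ • (R₁ • θ) = θ := by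
    intro θ hθ
    have h1 : ‖R₁ • θ‖ = R₁ := by rw [norm_smul, hθ, mul_one, Real.norm_of_nonneg hR₁0.le]
    exact ⟨h1, by rw [h1, smul_smul, inv_mul_cancel₀ hR₁0.ne', one_smul]⟩
  have hp : ∃ C, ∀ θ : Space, ‖θ‖ = 1 → ‖p θ‖ ≤ C := by
    refine ⟨((R₁ + h) * M' + R₁ * M + 2) / ‖c₁ - c₂‖, fun θ hθ => ?_⟩
    obtain ⟨h1, h2⟩ := hunit θ hθ
    have hx0 : R₁ • θ ≠ 0 := norm_pos_iff.1 (by rw [h1]; exact hR₁0)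
    have h3 := hshift _ hx0
    rw [h2] at h3
    have h4 : ‖radialShift h (R₁ • θ)‖ = R₁ + h := by rw [norm_radialShift hh0 hx0, h1]
    rw [le_div_iff₀ (norm_pos_iff.2 hδ)]
    have h5 := congrArg norm h3
    rw [norm_mul, norm_mul, hnexp, one_mul] at h5
    rw [mul_comm, h5, h1]
    have b1 : ‖((R₁ + h : ℝ) : ℂ) * f (radialShift h (R₁ • θ))‖ ≤ (R₁ + h) * M' := by
      rw [norm_mul, Complex.norm_real, Real.norm_of_nonneg (by positivity)]
      exact mul_le_mul_of_nonneg_left (hM' _ (by simpa using h4)) (by positivity)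
    have b2 : ‖c₂ * (R₁ * f (R₁ • θ))‖ ≤ R₁ * M := by
      rw [norm_mul, hnexp, one_mul, norm_mul, Complex.norm_real, Real.norm_of_nonneg hR₁0.le]
      exact mul_le_mul_of_nonneg_left (hM _ (by simpa using h1)) hR₁0.le
    have b3 : ‖E (radialShift h (R₁ • θ))‖ ≤ 1 := hb _ (by rw [h4]; linarith)
    have b4 : ‖c₂ * E (R₁ • θ)‖ ≤ 1 := by
      rw [norm_mul, hnexp, one_mul]; exact hb _ h1.ge
    refine (norm_sub_le _ _).trans ((add_le_add (norm_sub_le _ _) (norm_sub_le _ _)).trans ?_)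
    linarith
  obtain ⟨Cp, hCp⟩ := hp
  have hs : ∃ C, ∀ θ : Space, ‖θ‖ = 1 → ‖s θ‖ ≤ C := by
    refine ⟨R₁ * M + Cp + 1, fun θ hθ => ?_⟩
    obtain ⟨h1, h2⟩ := hunit θ hθ
    have h3 : Complex.exp (Complex.I * (k₂ * R₁ : ℝ)) * s θ = R₁ * f (R₁ • θ) -
        Complex.exp (Complex.I * (k₁ * R₁ : ℝ)) * p θ - E (R₁ • θ) := by
      simp only [hEdef, h1]
      have h4 : R₁⁻¹ • R₁ • θ = θ := by rw [smul_smul, inv_mul_cancel₀ hR₁0.ne', one_smul]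
      rw [h4]
      ring
    have h5 := congrArg norm h3
    rw [norm_mul, hnexp, one_mul] at h5
    rw [h5]
    have b1 : ‖(R₁ : ℂ) * f (R₁ • θ)‖ ≤ R₁ * M := by
      rw [norm_mul, Complex.norm_real, Real.norm_of_nonneg hR₁0.le]
      exact mul_le_mul_of_nonneg_left (hM _ (by simpa using h1)) hR₁0.le
    have b2 : ‖Complex.exp (Complex.I * (k₁ * R₁ : ℝ)) * p θ‖ ≤ Cp := by
      rw [norm_mul, hnexp, one_mul]; exact hCp θ hθ
    have b3 : ‖E (R₁ • θ)‖ ≤ 1 := hb _ h1.ge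
    refine (norm_sub_le _ _).trans ((add_le_add (norm_sub_le _ _) le_rfl).trans ?_)
    linarith
  obtain ⟨Cs, hCs⟩ := hs
  have hT := tendsto_radialShift hh0
  -- the field itself tends to zero
  have hf0 : Tendsto f (Bornology.cobounded Space) (𝓝 0) := by
    rw [tendsto_zero_iff_norm_tendsto_zero]
    have h1 : Tendsto (fun x : Space => (Cp + Cs + 1) * ‖x‖⁻¹)
        (Bornology.cobounded Space) (𝓝 0) := by
      simpa using tendsto_norm_cobounded_atTop.inv_tendsto_atTop.const_mul (Cp + Cs + 1)
    refine squeeze_zero' (Eventually.of_forall fun x => norm_nonneg _) ?_ h1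
    filter_upwards [eventually_cobounded_lt R₁] with x hx
    have hx0 : 0 < ‖x‖ := hR₁0.trans hx
    have hu : ‖‖x‖⁻¹ • x‖ = 1 := by rw [norm_smul, norm_inv, norm_norm, inv_mul_cancel₀ hx0.ne']
    rw [← div_eq_mul_inv, le_div_iff₀ hx0]
    have h2 : (‖x‖ : ℂ) * f x = E x + (Complex.exp (Complex.I * (k₁ * ‖x‖ : ℝ)) * p (‖x‖⁻¹ • x) +
        Complex.exp (Complex.I * (k₂ * ‖x‖ : ℝ)) * s (‖x‖⁻¹ • x)) := by
      simp only [hEdef]; ring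
    have h3 := congrArg norm h2
    rw [norm_mul, Complex.norm_real, norm_norm, mul_comm] at h3
    rw [h3]
    refine (norm_add_le _ _).trans ((add_le_add (hb x hx.le) (norm_add_le _ _)).trans ?_)
    rw [norm_mul, norm_mul, hnexp, hnexp, one_mul, one_mul]
    linarith [hCp _ hu, hCs _ hu]
  have hv1 := hv.tendsto_shift hh0 hvd
  have hw1 := hw.tendsto_shift hh0 hwd
  have hvlim : Tendsto (fun x : Space => ‖x‖ * v x -
      Complex.exp (Complex.I * (k₁ * ‖x‖ : ℝ)) * p (‖x‖⁻¹ • x))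
          (Bornology.cobounded Space) (𝓝 0) := by
    have h1 : Tendsto (fun x : Space => (c₁ - c₂)⁻¹ * ((E (radialShift h x) - c₂ * E x) -
        h * f (radialShift h x) -
        (‖x‖ : ℂ) * (v (radialShift h x) - c₁ * v x) -
        (‖x‖ : ℂ) * (w (radialShift h x) - c₂ * w x))) (Bornology.cobounded Space) (𝓝 0) := by
      have := (((((hE.comp hT).sub (hE.const_mul c₂)).sub ((hf0.comp hT).const_mul (h : ℂ))).sub
        hv1).sub hw1).const_mul (c₁ - c₂)⁻¹
      simp only [mul_zero, sub_zero] at this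
      exact this
    refine h1.congr' ?_
    filter_upwards [eventually_cobounded_lt R] with x hx
    have hx0 : x ≠ 0 := norm_pos_iff.1 (hR.trans_lt hx)
    have hTx : R < ‖radialShift h x‖ := by
      rw [norm_radialShift hh0 hx0]; linarith
    have h2 := hshift x hx0
    rw [inv_mul_eq_iff_eq_mul₀ hδ]
    have h3 := hf x hx
    have h4 := hf _ hTx
    rw [Complex.ofReal_add] at h2
    linear_combination h2 - c₂ * (‖x‖ : ℂ) * h3 + (‖x‖ : ℂ) * h4
  refine ⟨hvlim, ?_, ⟨Cp, hCp⟩, ⟨Cs, hCs⟩⟩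
  have h1 := hE.sub hvlim
  rw [sub_zero] at h1
  refine h1.congr' ?_
  filter_upwards [eventually_cobounded_lt R] with x hx
  simp only [hEdef, hf x hx]
  ring

/-- The components of a far field expansion. -/
lemma IsFarFieldPattern.tendsto_comp {lam mu om : ℝ} {usc up us : Space → CVec}
    (h : IsFarFieldPattern lam mu om usc up us) (j : Fin 3) :
    Tendsto (fun x : Space => ‖x‖ * usc x j -
      (Complex.exp (Complex.I * (kP lam mu om * ‖x‖ : ℝ)) *
        (up (‖x‖⁻¹ • x) j / ((4 * Real.pi * (lam + mu) : ℝ) : ℂ)) +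
        Complex.exp (Complex.I * (kS mu om * ‖x‖ : ℝ)) *
          (us (‖x‖⁻¹ • x) j / ((4 * Real.pi * mu : ℝ) : ℂ))))
              (Bornology.cobounded Space) (𝓝 0) := by
  obtain ⟨C, hC⟩ := h.bound
  rw [tendsto_zero_iff_norm_tendsto_zero]
  have h1 : Tendsto (fun x : Space => C * ‖x‖⁻¹) (Bornology.cobounded Space) (𝓝 0) := by
    simpa using tendsto_norm_cobounded_atTop.inv_tendsto_atTop.const_mul C
  refine squeeze_zero' (Eventually.of_forall fun x => norm_nonneg _) ?_ h1
  filter_upwards [hC, eventually_cobounded_lt 0] with x hx hx0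
  have h2 := (norm_comp_le _ j).trans hx
  rw [Real.norm_of_nonneg (by positivity)] at h2
  have h3 : ‖x‖ * (C * (1 / ‖x‖ ^ 2)) = C * ‖x‖⁻¹ := by field_simp
  rw [← h3]
  refine le_trans (le_of_eq ?_) (mul_le_mul_of_nonneg_left h2 hx0.le)
  have hxc : (‖x‖ : ℂ) ≠ 0 := by exact_mod_cast hx0.ne'
  have hn : ∀ z : ℂ, ‖x‖ * ‖z‖ = ‖(‖x‖ : ℂ) * z‖ := fun z => by
    rw [norm_mul, Complex.norm_real, norm_norm]
  have hdiv : ∀ (e z : ℂ) (c : ℝ), (‖x‖ : ℂ) * (e / ((c * ‖x‖ : ℝ) : ℂ) * z) =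
      e * (z / (c : ℂ)) := by
    intro e z c
    rcases eq_or_ne (c : ℂ) 0 with hc | hc
    · push_cast; simp [hc]
    · push_cast; field_simp
  rw [hn]
  congr 1
  simp only [PiLp.sub_apply, PiLp.add_apply, PiLp.smul_apply, smul_eq_mul, mul_sub, mul_add, hdiv]

/-! ### Linear combinations and translates of waves -/

lemma pd_sum_mul {ι : Type*} [Fintype ι] {f : ι → Space → ℂ} {x : Space}
    (hf : ∀ l, DifferentiableAt ℝ (f l) x) (c : ι → ℂ) (i : Fin 3) :
    pd i (fun y => ∑ l, c l * f l y) x = ∑ l, c l * pd i (f l) x := by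
  rw [pd_sum fun l _ => (hf l).const_mul _]
  exact Finset.sum_congr rfl fun l _ => pd_const_mul (hf l) _ _

lemma lap_sum_mul {ι : Type*} [Fintype ι] {f : ι → Space → ℂ} {x : Space}
    (hf : ∀ l, ContDiffAt ℝ 2 (f l) x) (c : ι → ℂ) :
    lap (fun y => ∑ l, c l * f l y) x = ∑ l, c l * lap (f l) x := by
  simp only [lap, Finset.mul_sum]
  rw [Finset.sum_comm]
  refine Finset.sum_congr rfl fun i _ => ?_
  have h1 : pd i (fun y => ∑ l, c l * f l y) =ᶠ[𝓝 x] fun y => ∑ l, c l * pd i (f l) y := by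
    have : ∀ᶠ y in 𝓝 x, ∀ l, ContDiffAt ℝ 2 (f l) y :=
      eventually_all.2 fun l => (hf l).eventually (by simp)
    filter_upwards [this] with y hy
    exact pd_sum_mul (fun l => (hy l).differentiableAt (by norm_num)) c i
  rw [pd_congr h1]
  exact pd_sum_mul (fun l => (contDiffAt_pd (hf l) (m := 1) (by norm_num) i).differentiableAt
    (by norm_num)) c i

lemma pd_sub_mul {f g : Space → ℂ} {x : Space} (hf : DifferentiableAt ℝ f x)
    (hg : DifferentiableAt ℝ g x) (c : ℂ) (i : Fin 3) :
    pd i (fun y => f y - c * g y) x = pd i f x - c * pd i g x := by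
  rw [pd_sub hf (hg.const_mul c), pd_const_mul hg]

lemma lap_sub_mul {f g : Space → ℂ} {x : Space} (hf : ContDiffAt ℝ 2 f x)
    (hg : ContDiffAt ℝ 2 g x) (c : ℂ) :
    lap (fun y => f y - c * g y) x = lap f x - c * lap g x := by
  have := lap_sum_mul (f := ![f, g]) (x := x)
    (by intro l; fin_cases l; exacts [hf, hg]) ![1, -c]
  simpa [Fin.sum_univ_two, sub_eq_add_neg] using this

lemma dv_sub_smul {u v : Space → CVec} {x : Space} (hu : ∀ i, DifferentiableAt ℝ (fun y => u y i) x)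
    (hv : ∀ i, DifferentiableAt ℝ (fun y => v y i) x) (c : ℂ) :
    dv (fun y => u y - c • v y) x = dv u x - c * dv v x := by
  rw [dv, dv, dv, Finset.mul_sum, ← Finset.sum_sub_distrib]
  exact Finset.sum_congr rfl fun i _ => pd_sub_mul (hu i) (hv i) c i

lemma lameOp_sub_smul {lam mu : ℝ} {u v : Space → CVec} {x : Space} (hu : ContDiffAt ℝ 2 u x)
    (hv : ContDiffAt ℝ 2 v x) (c : ℂ) :
    lameOp lam mu (fun y => u y - c • v y) x = lameOp lam mu u x - c • lameOp lam mu v x := by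
  ext j
  have hw : ContDiffAt ℝ 2 (fun y => u y - c • v y) x := hu.sub (hv.const_smul c)
  have h1 : dv (fun y => u y - c • v y) =ᶠ[𝓝 x] fun y => dv u y - c * dv v y := by
    filter_upwards [hu.eventually (by simp), hv.eventually (by simp)] with y hy hy'
    exact dv_sub_smul (fun i => (contDiffAt_comp hy i).differentiableAt (by norm_num))
      (fun i => (contDiffAt_comp hy' i).differentiableAt (by norm_num)) c
  have h2 : pd j (dv fun y => u y - c • v y) x = pd j (dv u) x - c * pd j (dv v) x := by
    rw [pd_congr h1]
    exact pd_sub_mul ((contDiffAt_dv hu (m := 1) (by norm_num)).differentiableAt (by norm_num))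
      ((contDiffAt_dv hv (m := 1) (by norm_num)).differentiableAt (by norm_num)) c j
  have h3 : lap (fun y => (u y - c • v y) j) x = lap (fun y => u y j) x
      - c * lap (fun y => v y j) x :=
    lap_sub_mul (contDiffAt_comp hu j) (contDiffAt_comp hv j) c
  rw [lameOp_apply hw, PiLp.sub_apply, PiLp.smul_apply, lameOp_apply hu, lameOp_apply hv, h2, h3,
    smul_eq_mul]
  ring

lemma navier_sub_smul {lam mu om : ℝ} {u v : Space → CVec} {x : Space} (hu : ContDiffAt ℝ 2 u x)
    (hv : ContDiffAt ℝ 2 v x) (hNu : lameOp lam mu u x + om ^ 2 • u x = 0)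
    (hNv : lameOp lam mu v x + om ^ 2 • v x = 0) (c : ℂ) :
    lameOp lam mu (fun y => u y - c • v y) x + om ^ 2 • (u x - c • v x) = 0 := by
  rw [lameOp_sub_smul hu hv, eq_neg_of_add_eq_zero_left hNu, eq_neg_of_add_eq_zero_left hNv,
    smul_sub, smul_comm (om ^ 2) c, smul_neg]
  abel

lemma lameOp_comp_add {lam mu : ℝ} {u : Space → CVec} {x a : Space}
    (hu : ContDiffAt ℝ 2 u (x + a)) :
    lameOp lam mu (fun y => u (y + a)) x = lameOp lam mu u (x + a) := by
  ext j
  have hw : ContDiffAt ℝ 2 (fun y => u (y + a)) x :=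
    ContDiffAt.comp x hu (contDiffAt_id.add contDiffAt_const)
  rw [lameOp_apply hw, lameOp_apply hu]
  have h1 : (dv fun y => u (y + a)) = fun y => dv u (y + a) := by
    funext y
    exact Finset.sum_congr rfl fun i _ => pd_comp_add (fun y => u y i) a y i
  rw [h1, pd_comp_add, lap_comp_add (fun y => u y j)]

lemma PSDecomp.comp_add {k₁ k₂ : ℝ} {U : Set Space} {u v w : Space → CVec}
    (h : PSDecomp k₁ k₂ U u v w) (a : Space) :
    PSDecomp k₁ k₂ ((fun x => x + a) ⁻¹' U) (fun x => u (x + a)) (fun x => v (x + a))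
      (fun x => w (x + a)) := by
  have ht : ContDiff ℝ 2 fun x : Space => x + a := contDiff_id.add contDiff_const
  refine ⟨fun x hx => h.sum _ hx, fun i => (h.contDiff_p i).comp ht.contDiffOn fun x hx => hx,
    fun i => (h.contDiff_s i).comp ht.contDiffOn fun x hx => hx, fun x hx i => ?_,
    fun x hx i => ?_, fun x hx i j => ?_, fun x hx => ?_⟩
  · rw [lap_comp_add (fun y => v y i)]; exact h.helm_p _ hx i
  · rw [lap_comp_add (fun y => w y i)]; exact h.helm_s _ hx i
  · rw [pd_comp_add (fun y => v y j), pd_comp_add (fun y => v y i)]; exact h.curl_p _ hx i j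
  · rw [← h.div_s _ hx]
    exact Finset.sum_congr rfl fun i _ => pd_comp_add (fun y => w y i) a x i

lemma PSDecomp.sub_smul {k₁ k₂ : ℝ} {U : Set Space} (hU : IsOpen U)
    {u v w u' v' w' : Space → CVec} (h : PSDecomp k₁ k₂ U u v w) (h' : PSDecomp k₁ k₂ U u' v' w')
    (c : ℂ) : PSDecomp k₁ k₂ U (fun x => u x - c • u' x) (fun x => v x - c • v' x)
      (fun x => w x - c • w' x) := by
  have c2 : ∀ {f : Space → ℂ}, ContDiffOn ℝ 2 f U → ∀ x ∈ U, ContDiffAt ℝ 2 f x :=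
    fun hf x hx => hf.contDiffAt (hU.mem_nhds hx)
  have dd : ∀ {f : Space → ℂ}, ContDiffOn ℝ 2 f U → ∀ x ∈ U, DifferentiableAt ℝ f x :=
    fun hf x hx => (c2 hf x hx).differentiableAt (by norm_num)
  refine ⟨fun x hx i => ?_, fun i => (h.contDiff_p i).sub (contDiffOn_const.mul (h'.contDiff_p i)),
    fun i => (h.contDiff_s i).sub (contDiffOn_const.mul (h'.contDiff_s i)), fun x hx i => ?_,
    fun x hx i => ?_, fun x hx i j => ?_, fun x hx => ?_⟩
  · simp only [PiLp.sub_apply, PiLp.smul_apply, smul_eq_mul, h.sum x hx, h'.sum x hx]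
    ring
  · have := lap_sub_mul (c2 (h.contDiff_p i) x hx) (c2 (h'.contDiff_p i) x hx) c
    simp only [PiLp.sub_apply, PiLp.smul_apply, smul_eq_mul, this]
    linear_combination h.helm_p x hx i - c * h'.helm_p x hx i
  · have := lap_sub_mul (c2 (h.contDiff_s i) x hx) (c2 (h'.contDiff_s i) x hx) c
    simp only [PiLp.sub_apply, PiLp.smul_apply, smul_eq_mul, this]
    linear_combination h.helm_s x hx i - c * h'.helm_s x hx i
  · have := fun i j => pd_sub_mul (dd (h.contDiff_p j) x hx) (dd (h'.contDiff_p j) x hx) c i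
    simp only [PiLp.sub_apply, PiLp.smul_apply, smul_eq_mul, this]
    rw [h.curl_p x hx, h'.curl_p x hx]
  · rw [dv_sub_smul (fun i => dd (h.contDiff_s i) x hx) (fun i => dd (h'.contDiff_s i) x hx),
      h.div_s x hx, h'.div_s x hx]
    ring

/-! ### Outgoing waves form a translation invariant space -/

lemma Radiates.differentiableAt {k R : ℝ} (hk : 0 < k) {f : Space → ℂ} (h : Radiates k R f)
    {x : Space} (hx : R < ‖x‖) : DifferentiableAt ℝ f x :=
  ((h.helm.contDiffOn hk (isOpen_exterior R)).contDiffAt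
    ((isOpen_exterior R).mem_nhds hx)).differentiableAt (by simp)

lemma Radiates.sum {ι : Type*} [Fintype ι] {k R : ℝ} (hk : 0 < k) {f : ι → Space → ℂ}
    (h : ∀ l, Radiates k R (f l)) (c : ι → ℂ) : Radiates k R (fun x => ∑ l, c l * f l x) := by
  refine ⟨⟨continuousOn_finsetSum _ fun l _ => continuousOn_const.mul (h l).helm.continuousOn,
    fun φ p1 p2 p3 => ?_⟩, ?_, ?_⟩
  · have hi : ∀ l, Integrable fun x => f l x * (lap φ x + (k : ℂ) ^ 2 * φ x) := by
      intro l
      have i1 := integrable_mul_of_tsupport_subset (isOpen_exterior R) (h l).helm.continuousOn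
        (contDiff_lap p1).continuous (hasCompactSupport_lap p2) ((tsupport_lap_subset φ).trans p3)
      have i2 := integrable_mul_of_tsupport_subset (isOpen_exterior R) (h l).helm.continuousOn
        p1.continuous p2 p3
      refine (i1.add (i2.const_mul ((k : ℂ) ^ 2))).congr (Eventually.of_forall fun x => ?_)
      simp only [Pi.add_apply]; ring
    have e : ∀ x, (∑ l, c l * f l x) * (lap φ x + (k : ℂ) ^ 2 * φ x) =
        ∑ l, c l * (f l x * (lap φ x + (k : ℂ) ^ 2 * φ x)) := fun x => by
      rw [Finset.sum_mul]; exact Finset.sum_congr rfl fun l _ => mul_assoc _ _ _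
    simp_rw [e]
    rw [integral_finsetSum _ fun l _ => (hi l).const_mul _]
    refine Finset.sum_eq_zero fun l _ => ?_
    rw [integral_const_mul, (h l).helm.weak φ p1 p2 p3, mul_zero]
  · have h1 : Tendsto (fun x : Space => ∑ l, ‖c l‖ * (‖x‖ * ‖fderiv ℝ (f l) x (‖x‖⁻¹ • x) -
        Complex.I * k * f l x‖)) (Bornology.cobounded Space) (𝓝 0) := by
      have := tendsto_finsetSum Finset.univ fun l _ => (h l).rad.const_mul ‖c l‖
      simpa using this
    refine squeeze_zero' (Eventually.of_forall fun x => by positivity) ?_ h1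
    filter_upwards [eventually_cobounded_lt R] with x hx
    have hd := fun l => (h l).differentiableAt hk hx
    have e : fderiv ℝ (fun x => ∑ l, c l * f l x) x (‖x‖⁻¹ • x) - Complex.I * k * ∑ l, c l * f l x =
        ∑ l, c l * (fderiv ℝ (f l) x (‖x‖⁻¹ • x) - Complex.I * k * f l x) := by
      simp only [fderiv_apply_eq_sum _ x, pd_sum_mul hd, mul_sub, Finset.sum_sub_distrib,
        Finset.smul_sum, Finset.mul_sum, Complex.real_smul]
      rw [Finset.sum_comm]
      congr 1 <;> refine Finset.sum_congr rfl fun l _ => ?_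
      · exact Finset.sum_congr rfl fun i _ => by ring
      · ring
    rw [e]
    refine (mul_le_mul_of_nonneg_left (norm_sum_le _ _) (norm_nonneg x)).trans (le_of_eq ?_)
    rw [Finset.mul_sum]
    refine Finset.sum_congr rfl fun l _ => ?_
    rw [norm_mul]; ring
  · choose C hC using fun l => (h l).bdd
    refine ⟨∑ l, ‖c l‖ * C l, ?_⟩
    filter_upwards [eventually_all.2 hC] with x hx
    refine (mul_le_mul_of_nonneg_left (norm_sum_le _ _) (norm_nonneg x)).trans ?_
    rw [Finset.mul_sum]
    refine Finset.sum_le_sum fun l _ => ?_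
    rw [norm_mul]
    calc ‖x‖ * (‖c l‖ * ‖f l x‖) = ‖c l‖ * (‖x‖ * ‖f l x‖) := by ring
      _ ≤ _ := mul_le_mul_of_nonneg_left (hx l) (norm_nonneg _)

lemma tendsto_add_cobounded (a : Space) :
    Tendsto (fun x : Space => x + a) (Bornology.cobounded Space) (Bornology.cobounded Space) := by
  rw [← tendsto_norm_atTop_iff_cobounded]
  refine tendsto_atTop_mono (fun x => ?_)
    (tendsto_atTop_add_const_right _ (-‖a‖) tendsto_norm_cobounded_atTop)
  have := norm_sub_le (x + a) a
  rw [add_sub_cancel_right] at this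
  linarith

lemma Radiates.tendsto_zero {k R : ℝ} {f : Space → ℂ} (h : Radiates k R f) :
    Tendsto f (Bornology.cobounded Space) (𝓝 0) := by
  obtain ⟨C, hC⟩ := h.bdd
  rw [tendsto_zero_iff_norm_tendsto_zero]
  have h1 : Tendsto (fun x : Space => C * ‖x‖⁻¹) (Bornology.cobounded Space) (𝓝 0) := by
    simpa using tendsto_norm_cobounded_atTop.inv_tendsto_atTop.const_mul C
  refine squeeze_zero' (Eventually.of_forall fun x => norm_nonneg _) ?_ h1
  filter_upwards [hC, eventually_cobounded_lt 0] with x hx hx0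
  rw [← div_eq_mul_inv, le_div_iff₀ hx0, mul_comm]
  exact hx

/-- The gradient of an outgoing wave tends to zero at infinity. -/
lemma Radiates.tendsto_fderiv {k R : ℝ} (hk : 0 < k) {f : Space → ℂ} (h : Radiates k R f) :
    Tendsto (fun x => ‖fderiv ℝ f x‖) (Bornology.cobounded Space) (𝓝 0) := by
  obtain ⟨C, hC0, hC⟩ := exists_gradient_bound hk one_pos
  rw [Metric.tendsto_nhds]
  intro ε hε
  have hη : 0 < ε / (2 * (C + 1)) := by positivity
  obtain ⟨R', hR', hb⟩ := exists_forall_of_eventually_cobounded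
    ((tendsto_zero_iff_norm_tendsto_zero.1 h.tendsto_zero).eventually (ge_mem_nhds hη)) R
  filter_upwards [eventually_cobounded_lt (R' + 1)] with x hx
  have hball : ∀ y ∈ ball x 1, R' ≤ ‖y‖ := by
    intro y hy
    have h1 := norm_sub_norm_le x y
    rw [mem_ball, dist_comm, dist_eq_norm] at hy
    linarith
  have h1 := hC f x _ (h.helm.mono fun y hy => hR'.trans_le (hball y hy)) fun y hy =>
      hb y (hball y hy)
  rw [dist_zero_right, norm_norm]
  refine h1.trans_lt ?_
  rw [mul_div_assoc', div_lt_iff₀ (by positivity)]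
  nlinarith

/-- Translates of outgoing waves are outgoing. The change of the radial direction is `O(1/r)` and is
compensated by the decay of the gradient. -/
lemma Radiates.comp_add {k R R' : ℝ} (hk : 0 < k) {f : Space → ℂ} (h : Radiates k R f) (a : Space)
    (hR : R + ‖a‖ ≤ R') : Radiates k R' (fun x => f (x + a)) := by
  have hT := tendsto_add_cobounded a
  have hxy : ∀ x : Space, ‖x‖ ≤ ‖x + a‖ + ‖a‖ := fun x => by
    have := norm_sub_le (x + a) a
    rwa [add_sub_cancel_right] at this
  refine ⟨(h.helm.comp_add a).mono fun x hx => ?_, ?_, ?_⟩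
  · have h1 := hxy x
    have h2 : R' < ‖x‖ := hx
    change R < ‖x + a‖
    linarith
  · have h1 : Tendsto (fun x : Space => 2 * (‖x + a‖ * ‖fderiv ℝ f (x + a) (‖x + a‖⁻¹ • (x + a)) -
        Complex.I * k * f (x + a)‖) + ‖fderiv ℝ f (x + a)‖ * (2 * ‖a‖))
        (Bornology.cobounded Space) (𝓝 0) := by
      have := ((h.rad.comp hT).const_mul 2).add (((h.tendsto_fderiv hk).comp hT).mul_const
          (2 * ‖a‖))
      simp only [mul_zero, zero_mul, add_zero] at this
      exact this
    refine squeeze_zero' (Eventually.of_forall fun x => by positivity) ?_ h1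
    filter_upwards [eventually_cobounded_lt (2 * ‖a‖)] with x hx
    have hx0 : 0 < ‖x‖ := (by positivity : (0 : ℝ) ≤ 2 * ‖a‖).trans_lt hx
    set y := x + a with hy
    have hy1 : ‖x‖ ≤ 2 * ‖y‖ := by linarith [hxy x]
    have hy0 : 0 < ‖y‖ := by linarith
    rw [fderiv_comp_add_right]
    have e : ‖x‖ • (‖x‖⁻¹ • x - ‖y‖⁻¹ • y) = -a + ((‖y‖ - ‖x‖) * ‖y‖⁻¹) • y := by
      rw [smul_sub, smul_smul, smul_smul, mul_inv_cancel₀ hx0.ne', one_smul, sub_mul,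
        mul_inv_cancel₀ hy0.ne', sub_smul, one_smul, hy]
      abel
    have hdir : ‖x‖ * ‖‖x‖⁻¹ • x - ‖y‖⁻¹ • y‖ ≤ 2 * ‖a‖ := by
      rw [← norm_norm x, ← norm_smul, norm_norm, e]
      refine (norm_add_le _ _).trans ?_
      rw [norm_neg, norm_smul, norm_mul, norm_inv, norm_norm, mul_assoc, inv_mul_cancel₀ hy0.ne',
        mul_one, two_mul]
      gcongr
      have := abs_norm_sub_norm_le y x
      rwa [hy, add_sub_cancel_left] at this
    have e2 : fderiv ℝ f y (‖x‖⁻¹ • x) - Complex.I * k * f y =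
        (fderiv ℝ f y (‖y‖⁻¹ • y) - Complex.I * k * f y) +
          fderiv ℝ f y (‖x‖⁻¹ • x - ‖y‖⁻¹ • y) := by
      rw [map_sub]; ring
    rw [e2]
    refine (mul_le_mul_of_nonneg_left (norm_add_le _ _) hx0.le).trans ?_
    rw [mul_add]
    refine add_le_add ?_ ?_
    · rw [← mul_assoc]
      exact mul_le_mul_of_nonneg_right hy1 (norm_nonneg _)
    · calc ‖x‖ * ‖fderiv ℝ f y (‖x‖⁻¹ • x - ‖y‖⁻¹ • y)‖ ≤
          ‖x‖ * (‖fderiv ℝ f y‖ * ‖‖x‖⁻¹ • x - ‖y‖⁻¹ • y‖) :=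
            mul_le_mul_of_nonneg_left ((fderiv ℝ f y).le_opNorm _) hx0.le
        _ = ‖fderiv ℝ f y‖ * (‖x‖ * ‖‖x‖⁻¹ • x - ‖y‖⁻¹ • y‖) := by ring
        _ ≤ _ := mul_le_mul_of_nonneg_left hdir (norm_nonneg _)
  · obtain ⟨C, hC⟩ := h.bdd
    refine ⟨2 * C, ?_⟩
    filter_upwards [hT.eventually hC, eventually_cobounded_lt (2 * ‖a‖)] with x hx hx'
    have h1 := hxy x
    calc ‖x‖ * ‖f (x + a)‖ ≤ (2 * ‖x + a‖) * ‖f (x + a)‖ :=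
          mul_le_mul_of_nonneg_right (by linarith) (norm_nonneg _)
      _ = 2 * (‖x + a‖ * ‖f (x + a)‖) := by ring
      _ ≤ 2 * C := by linarith

/-! ### Uniqueness -/

/-- Uniqueness for the exterior problem of elasticity: an outgoing elastic field with vanishing
trace is zero. -/
lemma HasZeroTrace.ps_eq_zero {lam mu om k₁ k₂ : ℝ} (hmu : 0 < mu) (hlm : 0 < lam + 2 * mu)
    {Ω : Set Space} (hΩ : IsOpen Ω) {R : ℝ} (hR : 0 ≤ R) (hRΩ : {x | R < ‖x‖} ⊆ Ω)
    {u v w : Space → CVec} (hu : ContDiffOn ℝ 2 u Ω)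
    (hN : ∀ x ∈ Ω, lameOp lam mu u x + om ^ 2 • u x = 0)
    (hk₁ : 0 < k₁) (hk₂ : 0 < k₂) (hk : (lam + 2 * mu) * k₁ ^ 2 = mu * k₂ ^ 2)
    (h : PSDecomp k₁ k₂ {x | R < ‖x‖} u v w) (hz : HasZeroTrace Ω u)
    (hv : ∀ j, Radiates k₁ R fun x => v x j) (hw : ∀ j, Radiates k₂ R fun x => w x j) :
    ∀ x, R < ‖x‖ → ∀ j, v x j = 0 ∧ w x j = 0 := by
  have key := Radiates.eq_zero_of_flux (ι := Fin 3 ⊕ Fin 3)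
      (k := Sum.elim (fun _ => k₁) fun _ => k₂)
    (c := Sum.elim (fun _ => lam + 2 * mu) fun _ => mu) (R := R)
    (by rintro (j | j); exacts [hk₁, hk₂]) (by rintro (j | j); exacts [hlm, hmu]) hR
    (f := Sum.elim (fun j x => v x j) fun j x => w x j) (by rintro (j | j); exacts [hv j, hw j])
    (fun r hr => by
      have := hz.radialFlux_elastic hΩ hR hRΩ hu hN hk₁ hk₂ hk h hr
      simpa [Fintype.sum_sum_type, Finset.mul_sum] using this)
  exact fun x hx j => ⟨key (Sum.inl j) x hx, key (Sum.inr j) x hx⟩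

/-- A solution of the Helmholtz equation that is `o(1/r)` at infinity vanishes. -/
lemma WeakHelm.eq_zero_of_tendsto {k R : ℝ} (hk : 0 < k) (hR : 0 ≤ R) {f : Space → ℂ}
    (h : WeakHelm k {x | R < ‖x‖} f)
    (h0 : Tendsto (fun x : Space => (‖x‖ : ℂ) * f x) (Bornology.cobounded Space) (𝓝 0)) :
    ∀ x, R < ‖x‖ → f x = 0 := by
  refine h.eq_zero_of_rellich hk hR ?_
  rw [Metric.tendsto_atTop]
  intro ε hε
  have hη : 0 < ε / (2 * (sph.real univ + 1)) :=
    div_pos hε (mul_pos two_pos (by linarith [measureReal_nonneg (μ := sph) (s := univ)]))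
  obtain ⟨R', hR', hb⟩ := exists_forall_of_eventually_cobounded
    ((tendsto_zero_iff_norm_tendsto_zero.1 h0).eventually (ge_mem_nhds hη)) R
  refine ⟨R', fun r hr => ?_⟩
  have hr0 : 0 < r := hR.trans_lt (hR'.trans_le hr)
  rw [dist_zero_right, ← integral_const_mul]
  have h1 := norm_integral_le_of_norm_le_const (μ := sph) (C := ε / (2 * (sph.real univ + 1)))
    (f := fun θ : sphere (0 : Space) 1 => r * ‖f (r • (θ : Space))‖)
    (Eventually.of_forall fun θ => by
      have hn := norm_smul_sphere hr0.le θ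
      have h2 := hb (r • (θ : Space)) (by rw [hn]; exact hr)
      rw [norm_mul, Complex.norm_real, norm_norm, hn] at h2
      rwa [norm_mul, norm_norm, Real.norm_of_nonneg hr0.le])
  refine h1.trans_lt ?_
  have hS : 0 ≤ sph.real univ := measureReal_nonneg
  rw [div_mul_eq_mul_div, div_lt_iff₀ (by positivity)]
  nlinarith

/-! ### Far field patterns of outgoing waves -/

/-- `p` is the far field pattern of the scalar field `f` with wave number `k`. -/
def HasPattern (k : ℝ) (f p : Space → ℂ) : Prop :=
  Tendsto (fun x : Space => ‖x‖ * f x - Complex.exp (Complex.I * (k * ‖x‖ : ℝ)) * p (‖x‖⁻¹ • x))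
    (Bornology.cobounded Space) (𝓝 0)

lemma exp_neg_mul_exp (t : ℝ) :
    Complex.exp (-(Complex.I * (t : ℂ))) * Complex.exp (Complex.I * (t : ℂ)) = 1 := by
  rw [← Complex.exp_add, neg_add_cancel, Complex.exp_zero]

lemma HasPattern.tendsto_exp_mul {k : ℝ} {f p : Space → ℂ} (h : HasPattern k f p) :
    Tendsto (fun x : Space => Complex.exp (-(Complex.I * (k * ‖x‖ : ℝ))) * (‖x‖ * f x) -
      p (‖x‖⁻¹ • x)) (Bornology.cobounded Space) (𝓝 0) := by
  rw [tendsto_zero_iff_norm_tendsto_zero]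
  refine (tendsto_zero_iff_norm_tendsto_zero.1 h).congr fun x => ?_
  have h1 : ‖Complex.exp (-(Complex.I * (k * ‖x‖ : ℝ)))‖ = 1 := by
    rw [show -(Complex.I * ((k * ‖x‖ : ℝ) : ℂ)) = ((-(k * ‖x‖) : ℝ) : ℂ) * Complex.I by
      push_cast; ring, Complex.norm_exp_ofReal_mul_I]
  rw [← one_mul ‖_‖, ← h1, ← norm_mul, mul_sub, ← mul_assoc _ _ (p _), exp_neg_mul_exp, one_mul]

/-- The pattern is the uniform limit of `e^{-ikr} r f(rθ)`, hence continuous on the sphere. -/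
lemma HasPattern.continuousOn {k R : ℝ} (hR : 0 ≤ R) {f p : Space → ℂ} (h : HasPattern k f p)
    (hf : ContinuousOn f {x | R < ‖x‖}) : ContinuousOn p (sphere (0 : Space) 1) := by
  rw [continuousOn_iff_continuous_domRestrict]
  have hu : TendstoUniformly (fun (r : ℝ) (θ : sphere (0 : Space) 1) =>
      Complex.exp (-(Complex.I * (k * r : ℝ))) * (r * f (r • (θ : Space))))
      ((sphere (0 : Space) 1).domRestrict p) atTop := by
    rw [Metric.tendstoUniformly_iff]
    intro ε hε
    obtain ⟨R', hR', hb⟩ := exists_forall_of_eventually_cobounded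
      ((tendsto_zero_iff_norm_tendsto_zero.1 h.tendsto_exp_mul).eventually (gt_mem_nhds hε)) R
    filter_upwards [eventually_ge_atTop R'] with r hr θ
    have hr0 : 0 < r := hR.trans_lt (hR'.trans_le hr)
    have hn := norm_smul_sphere hr0.le θ
    have h1 := hb (r • (θ : Space)) (by rw [hn]; exact hr)
    rw [hn, smul_smul, inv_mul_cancel₀ hr0.ne', one_smul] at h1
    rwa [dist_comm, dist_eq_norm]
  refine hu.continuous (Eventually.frequently ?_)
  filter_upwards [eventually_gt_atTop R] with r hr
  exact continuous_const.mul (continuous_const.mul (continuous_sphere_of_exterior hR hr hf))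

/-- A translation by `a` multiplies the pattern by `e^{-ik a·θ}`. -/
lemma HasPattern.translate {k R : ℝ} {f p fa pa : Space → ℂ} (h : HasPattern k f p)
    (ha : HasPattern k fa pa) (hpa : ContinuousOn pa (sphere (0 : Space) 1)) {a : Space} {c : ℂ}
    (heq : ∀ x, R < ‖x‖ → fa (x + a) = c * f x) {θ : Space} (hθ : ‖θ‖ = 1) :
    pa θ * phase k θ a = c * p θ := by
  have hinv : Tendsto (fun r : ℝ => r⁻¹) atTop (𝓝 0) := tendsto_inv_atTop_zero
  have hz : Tendsto (fun r : ℝ => θ + r⁻¹ • a) atTop (𝓝 θ) := by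
    simpa using (hinv.smul_const a).const_add θ
  have hzn : Tendsto (fun r : ℝ => ‖θ + r⁻¹ • a‖) atTop (𝓝 1) := by
    simpa [hθ] using hz.norm
  have hray : Tendsto (fun r : ℝ => r • θ) atTop (Bornology.cobounded Space) := by
    rw [← tendsto_norm_atTop_iff_cobounded]
    refine tendsto_id.congr' ?_
    filter_upwards [eventually_ge_atTop 0] with r hr
    rw [norm_smul, hθ, mul_one, Real.norm_of_nonneg hr, id]
  have hray' := (tendsto_add_cobounded a).comp hray
  have hy : ∀ r : ℝ, 0 < r → r • θ + a = r • (θ + r⁻¹ • a) := fun r hr => by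
    rw [smul_add, smul_smul, mul_inv_cancel₀ hr.ne', one_smul]
  have hyn : ∀ r : ℝ, 0 < r → ‖r • θ + a‖ = r * ‖θ + r⁻¹ • a‖ := fun r hr => by
    rw [hy r hr, norm_smul, Real.norm_of_nonneg hr.le]
  -- the path difference `|rθ + a| - r` tends to `a·θ`
  have hpath : Tendsto (fun r : ℝ => ‖r • θ + a‖ - r) atTop (𝓝 (inner ℝ a θ)) := by
    have h1 : Tendsto (fun r : ℝ => (2 * inner ℝ a θ + ‖a‖ ^ 2 * r⁻¹) / (‖θ + r⁻¹ • a‖ + 1)) atTop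
        (𝓝 ((2 * inner ℝ a θ + ‖a‖ ^ 2 * 0) / (1 + 1))) :=
      ((hinv.const_mul _).const_add _).div (hzn.add_const 1) (by norm_num)
    rw [show (2 * inner ℝ a θ + ‖a‖ ^ 2 * 0) / (1 + 1) = inner ℝ a θ by ring] at h1
    refine h1.congr' ?_
    filter_upwards [eventually_gt_atTop 0] with r hr
    rw [hyn r hr, div_eq_iff (by positivity)]
    have h2 : ‖θ + r⁻¹ • a‖ ^ 2 = 1 + 2 * (r⁻¹ * inner ℝ a θ) + (r⁻¹) ^ 2 * ‖a‖ ^ 2 := by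
      rw [norm_add_sq_real, hθ, inner_smul_right, norm_smul, mul_pow, real_inner_comm,
        Real.norm_eq_abs, sq_abs]
      ring
    have h3 : r * r⁻¹ = 1 := mul_inv_cancel₀ hr.ne'
    linear_combination (-r) * h2 - (2 * inner ℝ a θ + r⁻¹ * ‖a‖ ^ 2) * h3
  have l1 : Tendsto (fun r : ℝ => Complex.exp (-(Complex.I * (k * r : ℝ))) * (r * f (r • θ))) atTop
      (𝓝 (p θ)) := by
    have := (h.tendsto_exp_mul.comp hray).add_const (p θ)
    rw [zero_add] at this
    refine this.congr' ?_
    filter_upwards [eventually_gt_atTop 0] with r hr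
    have hn : ‖r • θ‖ = r := by rw [norm_smul, hθ, mul_one, Real.norm_of_nonneg hr.le]
    simp only [Function.comp_apply]
    rw [hn, smul_smul, inv_mul_cancel₀ hr.ne', one_smul, sub_add_cancel]
  have l2 : Tendsto (fun r : ℝ => Complex.exp (-(Complex.I * (k * ‖r • θ + a‖ : ℝ))) *
      (‖r • θ + a‖ * fa (r • θ + a))) atTop (𝓝 (pa θ)) := by
    have hq : Tendsto (fun r : ℝ => pa (‖r • θ + a‖⁻¹ • (r • θ + a))) atTop (𝓝 (pa θ)) := by
      refine (hpa θ (by simpa using hθ)).tendsto.comp (tendsto_nhdsWithin_iff.2 ⟨?_, ?_⟩)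
      · have h1 := (hzn.inv₀ one_ne_zero).smul hz
        rw [inv_one, one_smul] at h1
        refine h1.congr' ?_
        filter_upwards [eventually_gt_atTop 0] with r hr
        rw [hyn r hr, hy r hr, smul_smul, mul_inv, mul_assoc, mul_comm, mul_assoc,
          mul_inv_cancel₀ hr.ne', mul_one]
      · filter_upwards [hray'.eventually (eventually_cobounded_lt 0)] with r hr
        have hr' : 0 < ‖r • θ + a‖ := hr
        rw [mem_sphere_zero_iff_norm, norm_smul, norm_inv, norm_norm, inv_mul_cancel₀ hr'.ne']
    have := (ha.tendsto_exp_mul.comp hray').add hq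
    rw [zero_add] at this
    refine this.congr fun r => ?_
    simp only [Function.comp_apply]
    rw [sub_add_cancel]
  have l3 : Tendsto (fun r : ℝ => Complex.exp (-(Complex.I * (k * (‖r • θ + a‖ - r) : ℝ))) *
      (‖θ + r⁻¹ • a‖ : ℂ) * (c * (Complex.exp (-(Complex.I * (k * r : ℝ))) * (r * f (r • θ)))))
          atTop
      (𝓝 (Complex.exp (-(Complex.I * (k * inner ℝ a θ : ℝ))) * ((1 : ℝ) : ℂ) * (c * p θ))) := by
    refine Tendsto.mul (Tendsto.mul ?_ ?_) (l1.const_mul c)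
    · have hc : Continuous fun t : ℝ => Complex.exp (-(Complex.I * (k * t : ℝ))) := by fun_prop
      exact (hc.tendsto _).comp hpath
    · exact (Complex.continuous_ofReal.tendsto 1).comp hzn
  have l4 := tendsto_nhds_unique l2 (l3.congr' (by
    filter_upwards [eventually_gt_atTop (max R 0)] with r hr
    have hr0 : 0 < r := (le_max_right _ _).trans_lt hr
    have hn : ‖r • θ‖ = r := by rw [norm_smul, hθ, mul_one, Real.norm_of_nonneg hr0.le]
    rw [heq _ (by rw [hn]; exact (le_max_left _ _).trans_lt hr)]
    have e : Complex.exp (-(Complex.I * (k * ‖r • θ + a‖ : ℝ))) =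
        Complex.exp (-(Complex.I * (k * (‖r • θ + a‖ - r) : ℝ))) *
          Complex.exp (-(Complex.I * (k * r : ℝ))) := by
      rw [← Complex.exp_add]; congr 1; push_cast; ring
    have e2 : ((‖r • θ + a‖ : ℝ) : ℂ) = r * (‖θ + r⁻¹ • a‖ : ℂ) := by
      rw [hyn r hr0]; push_cast; rfl
    rw [e, e2]
    ring))
  rw [l4, phase, Complex.ofReal_one, mul_one]
  linear_combination (c * p θ) * exp_neg_mul_exp (k * inner ℝ a θ)

/-- If the phase `e^{ik a·θ}` is constant on the support of a continuous pattern that does not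
vanish identically, then `a = 0`: the linear function `a·x` would be a multiple of the norm in an
open cone. -/
lemma eq_zero_of_mul_phase_eq {k : ℝ} (hk : 0 < k) {p : Space → ℂ}
    (hp : ContinuousOn p (sphere (0 : Space) 1)) {θ₀ : Space} (hθ₀ : ‖θ₀‖ = 1) (hp0 : p θ₀ ≠ 0)
    {a : Space} {c : ℂ} (h : ∀ θ : Space, ‖θ‖ = 1 → p θ * phase k θ a = c * p θ) : a = 0 := by
  have hθ0 : θ₀ ≠ 0 := norm_pos_iff.1 (by rw [hθ₀]; exact one_pos)
  set A : ℝ := inner ℝ a θ₀ with hA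
  have hnorm : Tendsto (fun x : Space => ‖x‖⁻¹ • x) (𝓝 θ₀) (𝓝[sphere 0 1] θ₀) := by
    refine tendsto_nhdsWithin_iff.2 ⟨?_, ?_⟩
    · have h1 : ContinuousAt (fun x : Space => ‖x‖⁻¹ • x) θ₀ :=
        (continuousAt_id.norm.inv₀ (norm_ne_zero_iff.2 hθ0)).smul continuousAt_id
      have := h1.tendsto
      rwa [hθ₀, inv_one, one_smul] at this
    · filter_upwards [isOpen_ne.mem_nhds hθ0] with x hx
      rw [mem_sphere_zero_iff_norm, norm_smul, norm_inv, norm_norm,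
        inv_mul_cancel₀ (norm_ne_zero_iff.2 hx)]
  have hin : Tendsto (fun x : Space => k * (inner ℝ a (‖x‖⁻¹ • x) - A)) (𝓝 θ₀) (𝓝 0) := by
    have h1 : Continuous fun y : Space => k * (inner ℝ a y - A) := by fun_prop
    have h2 := (h1.tendsto θ₀).comp (tendsto_nhds_of_tendsto_nhdsWithin hnorm)
    rwa [← hA, sub_self, mul_zero] at h2
  -- near `θ₀` the linear function `a·x` is a multiple of the norm
  have hev : ∀ᶠ x in 𝓝 θ₀, inner ℝ a x = A * ‖x‖ := by
    filter_upwards [hnorm.eventually ((hp θ₀ (by simpa using hθ₀)).eventually_ne hp0),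
      hnorm.eventually self_mem_nhdsWithin, hin.eventually (Metric.ball_mem_nhds 0 Real.pi_pos),
      isOpen_ne.mem_nhds hθ0] with x h1 h2 h3 h4
    set y := ‖x‖⁻¹ • x with hy
    have hy1 : ‖y‖ = 1 := by simpa using h2
    have e1 : phase k y a = c := by
      have := h y hy1
      rw [mul_comm c] at this
      exact mul_left_cancel₀ h1 this
    have e2 : phase k θ₀ a = c := by
      have := h θ₀ hθ₀
      rw [mul_comm c] at this
      exact mul_left_cancel₀ hp0 this
    have e3 : Complex.exp (((k * (inner ℝ a y - A) : ℝ) : ℂ) * Complex.I) = 1 := by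
      have e4 : ((k * (inner ℝ a y - A) : ℝ) : ℂ) * Complex.I =
          Complex.I * ((k * inner ℝ a y : ℝ) : ℂ) - Complex.I * ((k * inner ℝ a θ₀ : ℝ) : ℂ) := by
        rw [hA]; push_cast; ring
      have e5 : Complex.exp (Complex.I * ((k * inner ℝ a y : ℝ) : ℂ)) =
        Complex.exp (Complex.I * ((k * inner ℝ a θ₀ : ℝ) : ℂ)) := e1.trans e2.symm
      rw [e4, Complex.exp_sub, e5, div_self (Complex.exp_ne_zero _)]
    obtain ⟨n, hn⟩ := Complex.exp_eq_one_iff.1 e3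
    have e6 : k * (inner ℝ a y - A) = n * (2 * Real.pi) := by
      have h5 : (((k * (inner ℝ a y - A) : ℝ) : ℂ) - n * (2 * Real.pi)) * Complex.I = 0 := by
        rw [sub_mul, hn]; ring
      have h6 := (mul_eq_zero.1 h5).resolve_right Complex.I_ne_zero
      exact_mod_cast sub_eq_zero.1 h6
    have hn0 : n = 0 := by
      rw [dist_zero_right, e6, norm_mul, Real.norm_of_nonneg Real.two_pi_pos.le] at h3
      have h7 : ‖(n : ℝ)‖ < 1 := by nlinarith [Real.pi_pos]
      rw [Real.norm_eq_abs] at h7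
      exact Int.abs_lt_one_iff.1 (by exact_mod_cast h7)
    rw [hn0, Int.cast_zero, zero_mul] at e6
    have h8 : inner ℝ a y = A := sub_eq_zero.1 ((mul_eq_zero.1 e6).resolve_left hk.ne')
    rw [hy, inner_smul_right] at h8
    rw [← h8]
    field_simp [norm_ne_zero_iff.2 h4]
  -- second order comparison in the direction `v`
  have hv : ∀ v : Space, (inner ℝ a v) ^ 2 = A ^ 2 * ‖v‖ ^ 2 := by
    intro v
    have hc : Continuous fun t : ℝ => θ₀ + t • v := by fun_prop
    have ht : Tendsto (fun t : ℝ => θ₀ + t • v) (𝓝 0) (𝓝 θ₀) := by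
      simpa using hc.tendsto 0
    obtain ⟨ε, hε, hb⟩ := Metric.eventually_nhds_iff.1 (ht.eventually hev)
    have hsq : ∀ t : ℝ, |t| < ε → (A + t * inner ℝ a v) ^ 2 =
        A ^ 2 * (1 + 2 * (t * inner ℝ θ₀ v) + t ^ 2 * ‖v‖ ^ 2) := by
      intro t ht
      have h1 := hb (y := t) (by simpa using ht)
      rw [inner_add_right, inner_smul_right] at h1
      rw [hA, h1, mul_pow, norm_add_sq_real, hθ₀, inner_smul_right, norm_smul, mul_pow,
        Real.norm_eq_abs, sq_abs]
      ring
    have h1 := hsq (ε / 2) (by rw [abs_of_pos (by positivity)]; linarith)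
    have h2 := hsq (-(ε / 2)) (by rw [abs_neg, abs_of_pos (by positivity)]; linarith)
    have h3 : (ε / 2) ^ 2 * ((inner ℝ a v) ^ 2 - A ^ 2 * ‖v‖ ^ 2) = 0 := by
      linear_combination (h1 + h2) / 2
    have h4 : (ε / 2) ^ 2 ≠ 0 := by positivity
    exact sub_eq_zero.1 ((mul_eq_zero.1 h3).resolve_left h4)
  -- summation over an orthonormal basis, compared with the case `v = a`
  have h1 : ‖a‖ ^ 2 = 3 * A ^ 2 := by
    rw [EuclideanSpace.norm_sq_eq]
    have : ∀ i : Fin 3, ‖a i‖ ^ 2 = A ^ 2 := fun i => by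
      have := hv (EuclideanSpace.single i 1)
      simpa [EuclideanSpace.inner_single_right] using this
    rw [Finset.sum_congr rfl fun i _ => this i]
    simp
  have h2 := hv a
  rw [real_inner_self_eq_norm_sq, h1] at h2
  have h3 : A ^ 2 * A ^ 2 = 0 := by linear_combination h2 / 6
  rw [mul_self_eq_zero.1 h3, mul_zero] at h1
  exact norm_eq_zero.1 (pow_eq_zero_iff (two_ne_zero)|>.1 h1)

lemma Radiates.congr {k R : ℝ} {f g : Space → ℂ} (h : Radiates k R f)
    (hfg : ∀ x, R < ‖x‖ → f x = g x) : Radiates k R g := by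
  have hev : ∀ x, R < ‖x‖ → f =ᶠ[𝓝 x] g := fun x hx => by
    filter_upwards [(isOpen_exterior R).mem_nhds hx] with y hy using hfg y hy
  refine ⟨⟨h.helm.continuousOn.congr fun x hx => (hfg x hx).symm, fun φ p1 p2 p3 => ?_⟩,
    h.rad.congr' ?_, ?_⟩
  · rw [← h.helm.weak φ p1 p2 p3]
    refine integral_congr_ae (Eventually.of_forall fun x => ?_)
    by_cases hx : R < ‖x‖
    · simp only [hfg x hx]
    · have h1 : φ x = 0 := image_eq_zero_of_notMem_tsupport fun h => hx (p3 h)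
      have h2 : lap φ x = 0 := image_eq_zero_of_notMem_tsupport fun h =>
        hx (p3 (tsupport_lap_subset φ h))
      simp only [h1, h2, mul_zero, add_zero]
  · filter_upwards [eventually_cobounded_lt R] with x hx
    rw [(hev x hx).fderiv_eq, hfg x hx]
  · obtain ⟨C, hC⟩ := h.bdd
    refine ⟨C, ?_⟩
    filter_upwards [hC, eventually_cobounded_lt R] with x hx hx'
    rwa [← hfg x hx']

lemma Radiates.sub_mul {k R : ℝ} (hk : 0 < k) {f g : Space → ℂ} (hf : Radiates k R f)
    (hg : Radiates k R g) (c : ℂ) : Radiates k R (fun x => f x - c * g x) := by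
  have := Radiates.sum (ι := Fin 2) hk (f := ![f, g]) (by intro l; fin_cases l; exacts [hf, hg])
    ![1, -c]
  simpa [Fin.sum_univ_two, sub_eq_add_neg] using this

lemma Radiates.mono {k R R' : ℝ} {f : Space → ℂ} (h : Radiates k R f) (hR : R ≤ R') :
    Radiates k R' f :=
  ⟨h.helm.mono fun _ hx => hR.trans_lt hx, h.rad, h.bdd⟩

lemma norm_normalize {x : Space} (hx : 0 < ‖x‖) : ‖‖x‖⁻¹ • x‖ = 1 := by
  rw [norm_smul, norm_inv, norm_norm, inv_mul_cancel₀ hx.ne']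

lemma HasPattern.bounded {k C : ℝ} {f p : Space → ℂ} (h : HasPattern k f p)
    (hC : ∀ θ : Space, ‖θ‖ = 1 → ‖p θ‖ ≤ C) :
    ∃ C, ∀ᶠ x in Bornology.cobounded Space, ‖x‖ * ‖f x‖ ≤ C := by
  refine ⟨1 + C, ?_⟩
  filter_upwards [(tendsto_zero_iff_norm_tendsto_zero.1 h).eventually (ge_mem_nhds one_pos),
    eventually_cobounded_lt 0] with x hx hx0
  have h1 : ‖Complex.exp (Complex.I * (k * ‖x‖ : ℝ)) * p (‖x‖⁻¹ • x)‖ ≤ C := by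
    rw [norm_mul, mul_comm Complex.I, Complex.norm_exp_ofReal_mul_I, one_mul]
    exact hC _ (norm_normalize hx0)
  have h2 : ‖x‖ * ‖f x‖ = ‖(‖x‖ : ℂ) * f x‖ := by rw [norm_mul, Complex.norm_real, norm_norm]
  rw [h2, ← sub_add_cancel ((‖x‖ : ℂ) * f x) (Complex.exp (Complex.I * (k * ‖x‖ : ℝ)) *
    p (‖x‖⁻¹ • x))]
  exact (norm_add_le _ _).trans (add_le_add hx h1)

/-- An outgoing wave with vanishing pattern vanishes. -/
lemma HasPattern.eq_zero {k R : ℝ} (hk : 0 < k) (hR : 0 ≤ R) {f p : Space → ℂ}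
    (h : HasPattern k f p) (hf : WeakHelm k {x | R < ‖x‖} f)
    (h0 : ∀ θ : Space, ‖θ‖ = 1 → p θ = 0) : ∀ x, R < ‖x‖ → f x = 0 := by
  refine hf.eq_zero_of_tendsto hk hR (h.congr' ?_)
  filter_upwards [eventually_cobounded_lt 0] with x hx
  rw [h0 _ (norm_normalize hx), mul_zero, sub_zero]

/-! ### The scattered field -/

/-- The field `u` scattered from the incident field `uin` in the exterior domain `Ω`, with its
pressure part `v` and shear part `w`, which are outgoing outside the ball of radius `R` and whose
components have the far field patterns `p` and `s`. -/
structure Scattering (lam mu om R : ℝ) (Ω : Set Space) (uin u v w : Space → CVec)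
    (p s : Fin 3 → Space → ℂ) : Prop where
  isOpen : IsOpen Ω
  exterior : {x | R < ‖x‖} ⊆ Ω
  contDiffOn : ContDiffOn ℝ 2 u Ω
  navier : ∀ x ∈ Ω, lameOp lam mu u x + om ^ 2 • u x = 0
  trace : HasZeroTrace Ω (fun x => uin x + u x)
  decomp : PSDecomp (kP lam mu om) (kS mu om) Ω u v w
  rad_p : ∀ j, Radiates (kP lam mu om) R fun x => v x j
  rad_s : ∀ j, Radiates (kS mu om) R fun x => w x j
  pattern_p : ∀ j, HasPattern (kP lam mu om) (fun x => v x j) (p j)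
  pattern_s : ∀ j, HasPattern (kS mu om) (fun x => w x j) (s j)

lemma kP_lt_kS {lam mu om : ℝ} (hmu : 0 < mu) (hlm : 0 < lam + mu) (hom : 0 < om) :
    kP lam mu om < kS mu om :=
  div_lt_div_of_pos_left hom (Real.sqrt_pos.2 hmu) (Real.sqrt_lt_sqrt hmu.le (by linarith))

lemma mul_kP_sq_eq {lam mu om : ℝ} (hmu : 0 < mu) (hlm : 0 < lam + 2 * mu) :
    (lam + 2 * mu) * kP lam mu om ^ 2 = mu * kS mu om ^ 2 := by
  have h1 := kP_sq (om := om) hlm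
  have h2 := kS_sq (om := om) hmu
  have h3 : ((lam : ℂ) + 2 * mu) * kP lam mu om ^ 2 = mu * kS mu om ^ 2 := by
    linear_combination h1 - h2
  exact_mod_cast h3

lemma IsScatteredField.scattering {lam mu om : ℝ} (hmu : 0 < mu) (hlam : 0 < 3 * lam + 2 * mu)
    (hom : 0 < om) {α β : ℂ} {d dp : Space} {D : Set Space} {R : ℝ} (hR : 0 ≤ R)
    (hRD : ∀ x, R < ‖x‖ → x ∉ closure D) {usc up us : Space → CVec}
    (hinc : ContDiff ℝ 2 (incident lam mu om α β d dp))
    (hNinc : ∀ x, lameOp lam mu (incident lam mu om α β d dp) x +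
      om ^ 2 • incident lam mu om α β d dp x = 0)
    (h : IsScatteredField lam mu om α β d dp D usc) (hff : IsFarFieldPattern lam mu om usc up us) :
    Scattering lam mu om R (closure D)ᶜ (incident lam mu om α β d dp) usc
      (pressurePart lam mu om usc) (shearPart mu om usc)
      (fun j θ => up θ j / ((4 * Real.pi * (lam + mu) : ℝ) : ℂ))
      (fun j θ => us θ j / ((4 * Real.pi * mu : ℝ) : ℂ)) := by
  have hlm : 0 < lam + mu := by linarith
  have hlm2 : 0 < lam + 2 * mu := by linarith
  have hΩ : IsOpen (closure D)ᶜ := isClosed_closure.isOpen_compl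
  have hsub : {x | R < ‖x‖} ⊆ (closure D)ᶜ := fun x hx => hRD x hx
  have hkp := kP_pos hlm2 hom
  have hks := kS_pos hmu hom
  have hat : ∀ x ∈ (closure D)ᶜ, ContDiffAt ℝ 2 usc x := fun x hx =>
    h.contDiffOn.contDiffAt (hΩ.mem_nhds hx)
  have hN : ∀ x ∈ (closure D)ᶜ, lameOp lam mu usc x + om ^ 2 • usc x = 0 := by
    intro x hx
    have := navier_sub_smul (hinc.contDiffAt.add (hat x hx)) hinc.contDiffAt (h.navier x hx)
      (hNinc x) 1
    simpa using this
  have hdec := psDecomp_of_navier hmu hlm2 hom hΩ h.contDiffOn hN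
  have hd : ∀ {f : Space → CVec}, (∀ i, ContDiffOn ℝ 2 (fun x => f x i) (closure D)ᶜ) →
      ∀ x, R < ‖x‖ → DifferentiableAt ℝ f x := fun hf x hx =>
    (differentiableAt_piLp 2).2 fun i =>
      ((hf i).contDiffAt (hΩ.mem_nhds (hsub hx))).differentiableAt (by norm_num)
  have hpart : ∀ j, _ := fun j => RadCond.tendsto_farField (kP_lt_kS hmu hlm hom) hR
    (h.radiating_p.radCond (hd hdec.contDiff_p) j) (h.radiating_s.radCond (hd hdec.contDiff_s) j)
    (fun x hx => differentiableAt_comp (hd hdec.contDiff_p x hx) j)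
    (fun x hx => differentiableAt_comp (hd hdec.contDiff_s x hx) j)
    (fun x hx => hdec.sum x (hsub hx) j)
    (p := fun θ => up θ j / ((4 * Real.pi * (lam + mu) : ℝ) : ℂ))
    (s := fun θ => us θ j / ((4 * Real.pi * mu : ℝ) : ℂ)) (hff.tendsto_comp j)
  have hP : ∀ j, HasPattern (kP lam mu om) (fun x => pressurePart lam mu om usc x j)
    (fun θ => up θ j / ((4 * Real.pi * (lam + mu) : ℝ) : ℂ)) := fun j => (hpart j).1
  have hS : ∀ j, HasPattern (kS mu om) (fun x => shearPart mu om usc x j)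
    (fun θ => us θ j / ((4 * Real.pi * mu : ℝ) : ℂ)) := fun j => (hpart j).2.1
  refine ⟨hΩ, hsub, h.contDiffOn, hN, h.dirichlet, hdec, fun j => ⟨?_, ?_, ?_⟩,
    fun j => ⟨?_, ?_, ?_⟩, hP, hS⟩
  · exact weakHelm_of_contDiffOn (isOpen_exterior R) ((hdec.contDiff_p j).mono hsub)
      fun x hx => hdec.helm_p x (hsub hx) j
  · exact h.radiating_p.radCond (hd hdec.contDiff_p) j
  · obtain ⟨C, hC⟩ := (hpart j).2.2.1
    exact (hP j).bounded hC
  · exact weakHelm_of_contDiffOn (isOpen_exterior R) ((hdec.contDiff_s j).mono hsub)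
      fun x hx => hdec.helm_s x (hsub hx) j
  · exact h.radiating_s.radCond (hd hdec.contDiff_s) j
  · obtain ⟨C, hC⟩ := (hpart j).2.2.2
    exact (hS j).bounded hC

section

variable {lam mu om R : ℝ} {Ω : Set Space} {uin u v w : Space → CVec} {p s : Fin 3 → Space → ℂ}

/-- If a translate of the incident field is a multiple of it, then the field scattered from the
translated obstacle is far away the same multiple of the translated scattered field. -/
lemma Scattering.translate (hmu : 0 < mu) (hlm : 0 < lam + 2 * mu) (hom : 0 < om) (hR : 0 ≤ R)
    (h : Scattering lam mu om R Ω uin u v w p s) {Ra : ℝ} {Ωa : Set Space}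
    {ua va wa : Space → CVec} {pa sa : Fin 3 → Space → ℂ}
    (ha : Scattering lam mu om Ra Ωa uin ua va wa pa sa) (huin : ContDiff ℝ 1 uin)
    {a : Space} (hΩa : (fun x => x + a) ⁻¹' Ωa = Ω) {c : ℂ} (hc : ∀ x, uin (x + a) = c • uin x) :
    ∃ R', ∀ x, R' < ‖x‖ → ∀ j, va (x + a) j = c * v x j ∧ wa (x + a) j = c * w x j := by
  set R' := max R (Ra + ‖a‖) with hR'
  have hkp := kP_pos hlm hom
  have hks := kS_pos hmu hom
  have hsub : {x | R' < ‖x‖} ⊆ Ω := fun x hx =>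
    h.exterior (show R < ‖x‖ from (le_max_left R _).trans_lt hx)
  have ht : ContDiff ℝ 2 fun x : Space => x + a := contDiff_id.add contDiff_const
  have hua : ContDiffOn ℝ 2 (fun x => ua (x + a)) Ω := by
    rw [← hΩa]; exact ha.contDiffOn.comp ht.contDiffOn fun x hx => hx
  have hmem : ∀ x ∈ Ω, x + a ∈ Ωa := fun x hx => by rwa [← hΩa] at hx
  have hNa : ∀ x ∈ Ω, lameOp lam mu (fun y => ua (y + a)) x + om ^ 2 • ua (x + a) = 0 := by
    intro x hx
    rw [lameOp_comp_add (ha.contDiffOn.contDiffAt (ha.isOpen.mem_nhds (hmem x hx)))]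
    exact ha.navier _ (hmem x hx)
  have hua1 : ContDiffOn ℝ 1 (fun x => uin x + ua x) Ωa :=
    huin.contDiffOn.add (ha.contDiffOn.of_le (by norm_num))
  have hu1 : ContDiffOn ℝ 1 (fun x => uin x + u x) Ω :=
    huin.contDiffOn.add (h.contDiffOn.of_le (by norm_num))
  have htr1 := ha.trace.comp_add ha.isOpen hua1 a
  rw [hΩa] at htr1
  have hua1' : ContDiffOn ℝ 1 (fun x => uin (x + a) + ua (x + a)) Ω := by
    rw [← hΩa]; exact hua1.comp (ht.of_le (by norm_num)).contDiffOn fun x hx => hx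
  set L : CVec →L[ℝ] CVec := (c • ContinuousLinearMap.id ℂ CVec).restrictScalars ℝ with hL
  have htr : HasZeroTrace Ω (fun x => ua (x + a) - c • u x) := by
    refine (htr1.sub h.isOpen hua1' (L.contDiff.comp_contDiffOn hu1)
      (h.trace.clm h.isOpen hu1 L)).congr h.isOpen fun x _ => ?_
    change uin (x + a) + ua (x + a) - c • (uin x + u x) = _
    rw [hc, smul_add]
    abel
  have hda := ha.decomp.comp_add a
  rw [hΩa] at hda
  have hR1 : R ≤ R' := le_max_left _ _
  have hR2 : Ra + ‖a‖ ≤ R' := le_max_right _ _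
  clear_value R'
  have hN : ∀ x ∈ Ω, lameOp lam mu (fun x => ua (x + a) - c • u x) x +
      om ^ 2 • (ua (x + a) - c • u x) = 0 := fun x hx =>
    navier_sub_smul (hua.contDiffAt (h.isOpen.mem_nhds hx))
      (h.contDiffOn.contDiffAt (h.isOpen.mem_nhds hx)) (hNa x hx) (h.navier x hx) c
  have hu2 : ContDiffOn ℝ 2 (fun x => ua (x + a) - c • u x) Ω :=
    hua.sub (h.contDiffOn.const_smul c)
  have hdec : PSDecomp (kP lam mu om) (kS mu om) {x | R' < ‖x‖} (fun x => ua (x + a) - c • u x)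
      (fun x => va (x + a) - c • v x) (fun x => wa (x + a) - c • w x) :=
    (hda.sub_smul h.isOpen h.decomp c).mono hsub
  have hradP : ∀ j, Radiates (kP lam mu om) R' fun x => (va (x + a) - c • v x) j := fun j =>
    ((ha.rad_p j).comp_add hkp a hR2).sub_mul hkp ((h.rad_p j).mono hR1) c
  have hradS : ∀ j, Radiates (kS mu om) R' fun x => (wa (x + a) - c • w x) j := fun j =>
    ((ha.rad_s j).comp_add hks a hR2).sub_mul hks ((h.rad_s j).mono hR1) c
  refine ⟨R', fun x hx j => ?_⟩
  have key := htr.ps_eq_zero hmu hlm h.isOpen (hR.trans hR1) hsub hu2 hN hkp hks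
    (mul_kP_sq_eq hmu hlm) hdec hradP hradS x hx j
  exact ⟨sub_eq_zero.1 key.1, sub_eq_zero.1 key.2⟩

/-- Unique continuation. -/
lemma Scattering.eq_zero_of_isPreconnected
    (h : Scattering lam mu om R Ω uin u v w p s) (hc : IsPreconnected Ω)
    (h0 : ∀ x, R < ‖x‖ → ∀ j, v x j = 0 ∧ w x j = 0) : ∀ x ∈ Ω, u x = 0 := by
  have hn : {x : Space | R < ‖x‖}.Nonempty := NormedSpace.exists_lt_norm ℝ Space R
  intro x hx
  ext j
  rw [h.decomp.sum x hx j, (weakHelm_of_contDiffOn h.isOpen (h.decomp.contDiff_p j)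
      fun x hx => h.decomp.helm_p x hx j).eq_zero_of_isPreconnected h.isOpen hc (isOpen_exterior R)
      h.exterior hn (fun x hx => (h0 x hx j).1) x hx,
    (weakHelm_of_contDiffOn h.isOpen (h.decomp.contDiff_s j)
      fun x hx => h.decomp.helm_s x hx j).eq_zero_of_isPreconnected h.isOpen hc (isOpen_exterior R)
      h.exterior hn (fun x hx => (h0 x hx j).2) x hx]
  simp

end

/-! ### Fields with a vanishing pressure or shear pattern -/

section

variable {lam mu om R : ℝ} {Ω : Set Space} {u v w : Space → CVec} {p s : Fin 3 → Space → ℂ}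
  {A : ℂ} {d b : Space}

/-- If an incident pressure wave produces a vanishing pressure pattern, the scattered field is zero:
in the energy balance of the total field, to which the incident wave does not contribute, only the
shear part is left, so it vanishes as well. -/
lemma Scattering.eq_zero_of_pattern_p (hmu : 0 < mu) (hlm : 0 < lam + 2 * mu) (hom : 0 < om)
    (hR : 0 ≤ R) (hd : ‖d‖ = 1)
    (h : Scattering lam mu om R Ω (planeWave A (kP lam mu om) d d) u v w p s)
    (hc : IsPreconnected Ω) (h0 : ∀ j, ∀ θ : Space, ‖θ‖ = 1 → p j θ = 0) : ∀ x ∈ Ω, u x = 0 := by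
  have hkp := kP_pos hlm hom
  have hks := kS_pos hmu hom
  have hv : ∀ j x, R < ‖x‖ → v x j = 0 := fun j =>
    (h.pattern_p j).eq_zero hkp hR (h.rad_p j).helm (h0 j)
  have hP := contDiff_planeWave A (kP lam mu om) d d
  have hP2 : ContDiff ℝ 2 (planeWave A (kP lam mu om) d d) := hP.of_le two_le_infty
  have hdec : PSDecomp (kP lam mu om) (kS mu om) {x | R < ‖x‖}
      (fun x => planeWave A (kP lam mu om) d d x + u x) (planeWave A (kP lam mu om) d d) w := by
    have h' := h.decomp.mono h.exterior
    refine ⟨fun x hx i => ?_, fun i => contDiffOn_comp hP2.contDiffOn i, h'.contDiff_s,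
      fun x _ i => lap_planeWave A _ hd d i x, h'.helm_s, fun x _ i j => ?_, h'.div_s⟩
    · rw [PiLp.add_apply, h'.sum x hx, hv i x hx, zero_add]
    · simp only [pd_planeWave]; ring
  have hN : ∀ x ∈ Ω, lameOp lam mu (fun x => planeWave A (kP lam mu om) d d x + u x) x +
      om ^ 2 • (planeWave A (kP lam mu om) d d x + u x) = 0 := by
    intro x hx
    have := navier_sub_smul hP2.contDiffAt (h.contDiffOn.contDiffAt (h.isOpen.mem_nhds hx))
      (navier_planeWave hd (Or.inl ⟨rfl, kP_sq hlm⟩) x) (h.navier x hx) (-1)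
    simpa using this
  have hw : ∀ j x, R < ‖x‖ → w x j = 0 :=
    Radiates.eq_zero_of_flux (c := fun _ => 1) (fun _ => hks) (fun _ => one_pos) hR h.rad_s
      fun r hr => by
        have h1 := h.trace.radialFlux_elastic h.isOpen hR h.exterior
          (hP2.contDiffOn.add h.contDiffOn) hN hkp hks (mul_kP_sq_eq hmu hlm) hdec hr
        rw [radialFlux_planeWave _ _ _ _ (hR.trans_lt hr), mul_zero, zero_add] at h1
        simpa using (mul_eq_zero.1 h1).resolve_left hmu.ne'
  exact h.eq_zero_of_isPreconnected hc fun x hx j => ⟨hv j x hx, hw j x hx⟩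

/-- The counterpart of `Scattering.eq_zero_of_pattern_p` for shear waves. -/
lemma Scattering.eq_zero_of_pattern_s (hmu : 0 < mu) (hlm : 0 < lam + 2 * mu) (hom : 0 < om)
    (hR : 0 ≤ R) (hd : ‖d‖ = 1) (hb : inner ℝ b d = 0)
    (h : Scattering lam mu om R Ω (planeWave A (kS mu om) d b) u v w p s)
    (hc : IsPreconnected Ω) (h0 : ∀ j, ∀ θ : Space, ‖θ‖ = 1 → s j θ = 0) : ∀ x ∈ Ω, u x = 0 := by
  have hkp := kP_pos hlm hom
  have hks := kS_pos hmu hom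
  have hw : ∀ j x, R < ‖x‖ → w x j = 0 := fun j =>
    (h.pattern_s j).eq_zero hks hR (h.rad_s j).helm (h0 j)
  have hP := contDiff_planeWave A (kS mu om) d b
  have hP2 : ContDiff ℝ 2 (planeWave A (kS mu om) d b) := hP.of_le two_le_infty
  have hdec : PSDecomp (kP lam mu om) (kS mu om) {x | R < ‖x‖}
      (fun x => planeWave A (kS mu om) d b x + u x) v (planeWave A (kS mu om) d b) := by
    have h' := h.decomp.mono h.exterior
    refine ⟨fun x hx i => ?_, h'.contDiff_p, fun i => contDiffOn_comp hP2.contDiffOn i,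
      h'.helm_p, fun x _ i => lap_planeWave A _ hd b i x, h'.curl_p, fun x _ => ?_⟩
    · rw [PiLp.add_apply, h'.sum x hx, hw i x hx, add_zero, add_comm]
    · rw [dv_planeWave, hb]; simp
  have hN : ∀ x ∈ Ω, lameOp lam mu (fun x => planeWave A (kS mu om) d b x + u x) x +
      om ^ 2 • (planeWave A (kS mu om) d b x + u x) = 0 := by
    intro x hx
    have := navier_sub_smul hP2.contDiffAt (h.contDiffOn.contDiffAt (h.isOpen.mem_nhds hx))
      (navier_planeWave hd (Or.inr ⟨hb, kS_sq hmu⟩) x) (h.navier x hx) (-1)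
    simpa using this
  have hv : ∀ j x, R < ‖x‖ → v x j = 0 :=
    Radiates.eq_zero_of_flux (c := fun _ => 1) (fun _ => hkp) (fun _ => one_pos) hR h.rad_p
      fun r hr => by
        have h1 := h.trace.radialFlux_elastic h.isOpen hR h.exterior
          (hP2.contDiffOn.add h.contDiffOn) hN hkp hks (mul_kP_sq_eq hmu hlm) hdec hr
        rw [radialFlux_planeWave _ _ _ _ (hR.trans_lt hr), mul_zero, add_zero] at h1
        simpa using (mul_eq_zero.1 h1).resolve_left hlm.ne'
  exact h.eq_zero_of_isPreconnected hc fun x hx j => ⟨hv j x hx, hw j x hx⟩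

/-- If the components of a field scattered from a plane wave with polarization `b` solve the
Helmholtz equation, then the field is parallel to `b` far away: the part of the total field
orthogonal to `b` is outgoing and has zero trace. -/
lemma HasZeroTrace.exists_eq_mul {k : ℝ} (hk : 0 < k) (hΩ : IsOpen Ω) (hR : 0 ≤ R)
    (hRΩ : {x | R < ‖x‖} ⊆ Ω) (hb : ‖b‖ = 1) (hu : ContDiffOn ℝ 2 u Ω)
    (hH : ∀ x ∈ Ω, ∀ j, lap (fun y => u y j) x + (k : ℂ) ^ 2 * u x j = 0)
    (hrad : ∀ j, Radiates k R fun x => u x j)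
    (hz : HasZeroTrace Ω (fun x => planeWave A k d b x + u x)) :
    ∃ f : Space → ℂ, Radiates k R f ∧ ∀ x, R < ‖x‖ → ∀ j, u x j = b j * f x := by
  have hb2 : (b 0 : ℂ) ^ 2 + (b 1 : ℂ) ^ 2 + (b 2 : ℂ) ^ 2 = 1 := by
    have : ‖b‖ ^ 2 = 1 := by rw [hb]; norm_num
    rw [EuclideanSpace.norm_sq_eq, Fin.sum_univ_three] at this
    simp only [Real.norm_eq_abs, sq_abs] at this
    exact_mod_cast this
  -- the matrix of the orthogonal projection along `b`
  set c : Fin 3 → Fin 3 → ℂ := fun j l => (if l = j then 1 else 0) - b j * b l with hc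
  set L₀ : CVec →ₗ[ℝ] CVec :=
    { toFun := fun z => WithLp.toLp 2 fun j => ∑ l, c j l * z l
      map_add' := fun y z => by
        ext j
        simp [mul_add, Finset.sum_add_distrib]
      map_smul' := fun t z => by
        ext j
        simp only [PiLp.smul_apply, Complex.real_smul, RingHom.id_apply, Finset.mul_sum]
        exact Finset.sum_congr rfl fun l _ => by ring } with hL₀
  set L : CVec →L[ℝ] CVec := LinearMap.toContinuousLinearMap L₀ with hL
  have hLapp : ∀ z j, L z j = ∑ l, c j l * z l := fun z j => rfl
  have hLP : ∀ x, L (planeWave A k d b x) = 0 := by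
    intro x
    ext j
    rw [hLapp]
    simp only [planeWave_apply, hc, sub_mul, Finset.sum_sub_distrib, ite_mul, one_mul, zero_mul,
      Finset.sum_ite_eq', Finset.mem_univ, if_true, Fin.sum_univ_three, PiLp.zero_apply]
    linear_combination -(A * b j * phase k d x) * hb2
  have hu1 : ContDiffOn ℝ 1 (fun x => planeWave A k d b x + u x) Ω :=
    ((contDiff_planeWave A k d b).of_le (by simp)).contDiffOn.add (hu.of_le (by norm_num))
  have htr : HasZeroTrace Ω (fun x => L (u x)) :=
    (hz.clm hΩ hu1 L).congr hΩ fun x _ => by rw [map_add, hLP, zero_add]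
  have hLu : ContDiffOn ℝ 2 (fun x => L (u x)) Ω := L.contDiff.comp_contDiffOn hu
  have hat : ∀ x ∈ Ω, ∀ l, ContDiffAt ℝ 2 (fun y => u y l) x := fun x hx l =>
    contDiffAt_comp (hu.contDiffAt (hΩ.mem_nhds hx)) l
  have hLH : ∀ x ∈ Ω, ∀ j, lap (fun y => L (u y) j) x + (k : ℂ) ^ 2 * L (u x) j = 0 := by
    intro x hx j
    simp only [hLapp]
    rw [lap_sum_mul (hat x hx), Finset.mul_sum, ← Finset.sum_add_distrib]
    refine Finset.sum_eq_zero fun l _ => ?_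
    linear_combination c j l * hH x hx l
  have hLrad : ∀ j, Radiates k R fun x => L (u x) j := fun j => Radiates.sum hk hrad (c j)
  have h0 : ∀ j x, R < ‖x‖ → L (u x) j = 0 :=
    Radiates.eq_zero_of_flux (c := fun _ => 1) (fun _ => hk) (fun _ => one_pos) hR hLrad
      fun r hr => by simpa using htr.radialFlux_helm hΩ hR hRΩ hLu hLH hr
  refine ⟨fun x => ∑ l, (b l : ℂ) * u x l, Radiates.sum hk hrad _, fun x hx j => ?_⟩
  have := h0 j x hx
  simp only [hLapp, hc, sub_mul, Finset.sum_sub_distrib, ite_mul, one_mul, zero_mul,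
    Finset.sum_ite_eq', Finset.mem_univ, if_true, mul_assoc, ← Finset.mul_sum] at this
  exact sub_eq_zero.1 this

/-- An outgoing wave that is constant in the direction `e` vanishes in a half space, since it
tends to zero along the lines with direction `e`. -/
lemma Radiates.eq_zero_of_fderiv {k : ℝ} (hk : 0 < k) {f : Space → ℂ} (hf : Radiates k R f)
    {e : Space} (he : ‖e‖ = 1) (h0 : ∀ x, R < ‖x‖ → fderiv ℝ f x e = 0) :
    ∀ x, R < inner ℝ x e → f x = 0 := by
  intro x hx
  have hcs : ∀ y : Space, inner ℝ y e ≤ ‖y‖ := fun y => by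
    simpa [he] using real_inner_le_norm y e
  have hin : ∀ t : ℝ, inner ℝ (x + t • e) e = inner ℝ x e + t := fun t => by
    rw [inner_add_left, inner_smul_left, real_inner_self_eq_norm_sq, he]; simp
  have hder : ∀ t : ℝ, 0 ≤ t → HasDerivAt (fun t : ℝ => f (x + t • e)) 0 t := by
    intro t ht
    have hlt : R < ‖x + t • e‖ := by
      refine lt_of_lt_of_le ?_ (hcs _)
      rw [hin]; linarith
    have h1 : HasDerivAt (fun t : ℝ => x + t • e) e t := by
      simpa using ((hasDerivAt_id t).smul_const e).const_add x
    have := (hf.differentiableAt hk hlt).hasFDerivAt.comp_hasDerivAt t h1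
    rw [h0 _ hlt] at this
    exact this
  have hconst : ∀ t : ℝ, 0 ≤ t → f (x + t • e) = f x := by
    intro t ht
    have := constant_of_has_deriv_right_zero (f := fun t : ℝ => f (x + t • e)) (a := 0) (b := t)
      (fun τ hτ => (hder τ hτ.1).continuousAt.continuousWithinAt)
      (fun τ hτ => (hder τ hτ.1).hasDerivWithinAt) t ⟨ht, le_rfl⟩
    simpa using this
  have hT : Tendsto (fun t : ℝ => x + t • e) atTop (Bornology.cobounded Space) := by
    rw [← tendsto_norm_atTop_iff_cobounded]
    refine tendsto_atTop_mono
        (fun t => ?_) (tendsto_atTop_add_const_left _ (inner ℝ x e) tendsto_id)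
    rw [id, ← hin]
    exact hcs _
  refine tendsto_nhds_unique (tendsto_const_nhds.congr' ?_) (hf.tendsto_zero.comp hT)
  filter_upwards [eventually_ge_atTop 0] with t ht using (hconst t ht).symm

/-- A field scattered from a plane wave vanishes if its components solve the Helmholtz equation and
if, where it is a multiple `b f` of the polarization, it is constant in some direction. -/
lemma HasZeroTrace.eq_zero_of_polarized {k : ℝ} (hk : 0 < k) (hΩ : IsOpen Ω) (hR : 0 ≤ R)
    (hRΩ : {x | R < ‖x‖} ⊆ Ω) (hb : ‖b‖ = 1) (hu : ContDiffOn ℝ 2 u Ω)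
    (hH : ∀ x ∈ Ω, ∀ j, lap (fun y => u y j) x + (k : ℂ) ^ 2 * u x j = 0)
    (hrad : ∀ j, Radiates k R fun x => u x j)
    (hz : HasZeroTrace Ω (fun x => planeWave A k d b x + u x)) (hc : IsPreconnected Ω)
    {e : Space} (he : ‖e‖ = 1)
    (hdir : ∀ (f : Space → ℂ) (x : Space), R < ‖x‖ →
      (∀ i j, pd i (fun y => u y j) x = b j * pd i f x) → fderiv ℝ f x e = 0) :
    ∀ x ∈ Ω, u x = 0 := by
  obtain ⟨f, hf, hfu⟩ := hz.exists_eq_mul hk hΩ hR hRΩ hb hu hH hrad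
  have h0 := hf.eq_zero_of_fderiv hk he fun x hx => hdir f x hx fun i j => by
    have : (fun y => u y j) =ᶠ[𝓝 x] fun y => b j * f y := by
      filter_upwards [(isOpen_exterior R).mem_nhds hx] with y hy using hfu y hy j
    rw [pd_congr this, pd_const_mul (hf.differentiableAt hk hx)]
  have hV : IsOpen {x : Space | R < inner ℝ x e} :=
    isOpen_lt continuous_const (continuous_id.inner continuous_const)
  have hVR : ∀ x : Space, R < inner ℝ x e → R < ‖x‖ := fun x hx =>
    hx.trans_le (by simpa [he] using real_inner_le_norm x e)
  have hVn : {x : Space | R < inner ℝ x e}.Nonempty := ⟨(R + 1) • e, by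
    change R < inner ℝ ((R + 1) • e) e
    rw [inner_smul_left, real_inner_self_eq_norm_sq, he]
    simp⟩
  intro x hx
  ext j
  exact (weakHelm_of_contDiffOn hΩ (contDiffOn_comp hu j)
    fun x hx => hH x hx j).eq_zero_of_isPreconnected hΩ hc hV (fun y hy => hRΩ (hVR y hy)) hVn
    (fun y hy => by rw [hfu y (hVR y hy), h0 y hy, mul_zero]) x hx

end

/-! ### Determination of the translation -/

section

variable {lam mu om R : ℝ} {Ω : Set Space} {uin u v w : Space → CVec} {p s : Fin 3 → Space → ℂ}
  {A : ℂ} {d b : Space}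

/-- For an incident pressure wave with vanishing shear pattern the scattered field is curl-free and
parallel to `d`, hence constant in the directions orthogonal to `d`. -/
lemma Scattering.eq_zero_of_pattern_ps (hmu : 0 < mu) (hlm : 0 < lam + 2 * mu) (hom : 0 < om)
    (hR : 0 ≤ R) (hd : ‖d‖ = 1) {e : Space} (he : ‖e‖ = 1) (hed : inner ℝ e d = 0)
    (h : Scattering lam mu om R Ω (planeWave A (kP lam mu om) d d) u v w p s)
    (hc : IsPreconnected Ω) (h0 : ∀ j, ∀ θ : Space, ‖θ‖ = 1 → s j θ = 0) : ∀ x ∈ Ω, u x = 0 := by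
  have hw : ∀ j, ∀ x ∈ Ω, w x j = 0 := fun j =>
    (weakHelm_of_contDiffOn h.isOpen (h.decomp.contDiff_s j) fun x hx =>
      h.decomp.helm_s x hx j).eq_zero_of_isPreconnected h.isOpen hc (isOpen_exterior R)
      h.exterior (NormedSpace.exists_lt_norm ℝ Space R)
      ((h.pattern_s j).eq_zero (kS_pos hmu hom) hR (h.rad_s j).helm (h0 j))
  have huv : ∀ x ∈ Ω, ∀ j, u x j = v x j := fun x hx j => by
    rw [h.decomp.sum x hx, hw j x hx, add_zero]
  have hev : ∀ x ∈ Ω, ∀ j, (fun y => u y j) =ᶠ[𝓝 x] fun y => v y j := fun x hx j => by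
    filter_upwards [h.isOpen.mem_nhds hx] with y hy using huv y hy j
  refine h.trace.eq_zero_of_polarized (kP_pos hlm hom) h.isOpen hR h.exterior hd h.contDiffOn
    (fun x hx j => ?_) (fun j => (h.rad_p j).congr fun x hx => (huv x (h.exterior hx) j).symm) hc he
    fun f x hx hf => ?_
  · rw [lap_congr (hev x hx j), huv x hx]
    exact h.decomp.helm_p x hx j
  · have hx' := h.exterior hx
    have hcurl : ∀ i j, (d j : ℂ) * pd i f x = d i * pd j f x := fun i j => by
      rw [← hf i j, ← hf j i, pd_congr (hev x hx' j), pd_congr (hev x hx' i)]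
      exact h.decomp.curl_p x hx' i j
    have hd2 : (d 0 : ℂ) ^ 2 + (d 1 : ℂ) ^ 2 + (d 2 : ℂ) ^ 2 = 1 := by
      have : ‖d‖ ^ 2 = 1 := by rw [hd]; norm_num
      rw [EuclideanSpace.norm_sq_eq, Fin.sum_univ_three] at this
      simp only [Real.norm_eq_abs, sq_abs] at this
      exact_mod_cast this
    have hed' : (e 0 : ℂ) * d 0 + e 1 * d 1 + e 2 * d 2 = 0 := by
      rw [PiLp.inner_apply, Fin.sum_univ_three] at hed
      have : e 0 * d 0 + e 1 * d 1 + e 2 * d 2 = 0 := by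
        rw [← hed]; simp; ring
      simpa using congrArg (fun t : ℝ => (t : ℂ)) this
    rw [fderiv_apply_eq_sum]
    simp only [Fin.sum_univ_three, Complex.real_smul]
    set q0 := pd 0 f x
    set q1 := pd 1 f x
    set q2 := pd 2 f x
    have h1 : ∀ i, (pd i f x) = d i * (d 0 * q0 + d 1 * q1 + d 2 * q2) := fun i => by
      linear_combination -(pd i f x) * hd2 + d 0 * hcurl i 0 + d 1 * hcurl i 1 + d 2 * hcurl i 2
    linear_combination e 0 * h1 0 + e 1 * h1 1 + e 2 * h1 2 +
      (d 0 * q0 + d 1 * q1 + d 2 * q2) * hed'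

/-- For an incident shear wave with vanishing pressure pattern the scattered field is
divergence-free and parallel to `b`, hence constant in the direction `b`. -/
lemma Scattering.eq_zero_of_pattern_sp (hmu : 0 < mu) (hlm : 0 < lam + 2 * mu) (hom : 0 < om)
    (hR : 0 ≤ R) (hb : ‖b‖ = 1)
    (h : Scattering lam mu om R Ω (planeWave A (kS mu om) d b) u v w p s)
    (hc : IsPreconnected Ω) (h0 : ∀ j, ∀ θ : Space, ‖θ‖ = 1 → p j θ = 0) : ∀ x ∈ Ω, u x = 0 := by
  have hv : ∀ j, ∀ x ∈ Ω, v x j = 0 := fun j =>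
    (weakHelm_of_contDiffOn h.isOpen (h.decomp.contDiff_p j) fun x hx =>
      h.decomp.helm_p x hx j).eq_zero_of_isPreconnected h.isOpen hc (isOpen_exterior R)
      h.exterior (NormedSpace.exists_lt_norm ℝ Space R)
      ((h.pattern_p j).eq_zero (kP_pos hlm hom) hR (h.rad_p j).helm (h0 j))
  have huw : ∀ x ∈ Ω, ∀ j, u x j = w x j := fun x hx j => by
    rw [h.decomp.sum x hx, hv j x hx, zero_add]
  have hev : ∀ x ∈ Ω, ∀ j, (fun y => u y j) =ᶠ[𝓝 x] fun y => w y j := fun x hx j => by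
    filter_upwards [h.isOpen.mem_nhds hx] with y hy using huw y hy j
  refine h.trace.eq_zero_of_polarized (kS_pos hmu hom) h.isOpen hR h.exterior hb h.contDiffOn
    (fun x hx j => ?_) (fun j => (h.rad_s j).congr fun x hx => (huw x (h.exterior hx) j).symm) hc hb
    fun f x hx hf => ?_
  · rw [lap_congr (hev x hx j), huw x hx]
    exact h.decomp.helm_s x hx j
  · have hx' := h.exterior hx
    rw [fderiv_apply_eq_sum, ← h.decomp.div_s x hx', dv]
    refine Finset.sum_congr rfl fun i _ => ?_
    rw [← pd_congr (hev x hx' i), hf, Complex.real_smul]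

/-- If the fields scattered from an obstacle and from its translate have a common pattern that does
not vanish identically, the translation is trivial. -/
lemma eq_zero_of_pattern_eq {k R Ra R' : ℝ} (hk : 0 < k) (hR : 0 ≤ R) (hRa : 0 ≤ Ra)
    {f fa p pa : Space → ℂ} (hf : Radiates k R f) (hfa : Radiates k Ra fa) (hp : HasPattern k f p)
    (hpa : HasPattern k fa pa) (hpp : ∀ θ : Space, ‖θ‖ = 1 → pa θ = p θ) {a : Space} {c : ℂ}
    (h : ∀ x, R' < ‖x‖ → fa (x + a) = c * f x) {θ₀ : Space} (hθ₀ : ‖θ₀‖ = 1) (hp0 : p θ₀ ≠ 0) :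
    a = 0 :=
  eq_zero_of_mul_phase_eq hk (hp.continuousOn hR hf.helm.continuousOn) hθ₀ hp0 fun θ hθ => by
    rw [← hpp θ hθ]
    have := hp.translate hpa (hpa.continuousOn hRa hfa.helm.continuousOn) h hθ
    rwa [hpp θ hθ] at this ⊢

/-- The translation is determined by either of the two patterns, as soon as the vanishing of one of
them implies the vanishing of the scattered field. -/
lemma Scattering.translation_eq_zero (hmu : 0 < mu) (hlm : 0 < lam + 2 * mu) (hom : 0 < om)
    (hR : 0 ≤ R) (h : Scattering lam mu om R Ω uin u v w p s) {Ra : ℝ} (hRa : 0 ≤ Ra)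
    {Ωa : Set Space} {ua va wa : Space → CVec} {pa sa : Fin 3 → Space → ℂ}
    (ha : Scattering lam mu om Ra Ωa uin ua va wa pa sa) (huin : ContDiff ℝ 1 uin)
    {a : Space} (hΩa : (fun x => x + a) ⁻¹' Ωa = Ω) {c : ℂ} (hc : ∀ x, uin (x + a) = c • uin x)
    (heq : (∀ j, ∀ θ : Space, ‖θ‖ = 1 → pa j θ = p j θ) ∨
      ∀ j, ∀ θ : Space, ‖θ‖ = 1 → sa j θ = s j θ)
    (hu : ¬ ∀ x ∈ Ω, u x = 0)
    (hp : (∀ j, ∀ θ : Space, ‖θ‖ = 1 → p j θ = 0) → ∀ x ∈ Ω, u x = 0)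
    (hs : (∀ j, ∀ θ : Space, ‖θ‖ = 1 → s j θ = 0) → ∀ x ∈ Ω, u x = 0) : a = 0 := by
  obtain ⟨R', hR'⟩ := h.translate hmu hlm hom hR ha huin hΩa hc
  rcases heq with heq | heq
  · have hn : ¬ ∀ j, ∀ θ : Space, ‖θ‖ = 1 → p j θ = 0 := fun h0 => hu (hp h0)
    push Not at hn
    obtain ⟨j, θ, hθ, h0⟩ := hn
    exact eq_zero_of_pattern_eq (kP_pos hlm hom) hR hRa (h.rad_p j) (ha.rad_p j) (h.pattern_p j)
      (ha.pattern_p j) (heq j) (fun x hx => (hR' x hx j).1) hθ h0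
  · have hn : ¬ ∀ j, ∀ θ : Space, ‖θ‖ = 1 → s j θ = 0 := fun h0 => hu (hs h0)
    push Not at hn
    obtain ⟨j, θ, hθ, h0⟩ := hn
    exact eq_zero_of_pattern_eq (kS_pos hmu hom) hR hRa (h.rad_s j) (ha.rad_s j) (h.pattern_s j)
      (ha.pattern_s j) (heq j) (fun x hx => (hR' x hx j).2) hθ h0

lemma planeWave_add (A : ℂ) (k : ℝ) (d b x a : Space) :
    planeWave A k d b (x + a) = phase k d a • planeWave A k d b x := by
  rw [planeWave, planeWave, phase_add, smul_smul]
  congr 1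
  ring

end

lemma exists_norm_lt_of_isBounded {D : Set Space} (hD : Bornology.IsBounded D) :
    ∃ R, 0 ≤ R ∧ ∀ x, R < ‖x‖ → x ∉ closure D := by
  obtain ⟨R, hR⟩ := hD.closure.subset_closedBall (0 : Space)
  refine ⟨max R 0, le_max_right _ _, fun x hx hxD => ?_⟩
  have h1 := hR hxD
  rw [mem_closedBall_zero_iff] at h1
  exact absurd ((le_max_left R 0).trans_lt hx) (not_lt.2 h1)

lemma preimage_exterior_image_add (a : Space) (D : Set Space) :
    (fun x => x + a) ⁻¹' (closure ((fun x => a + x) '' D))ᶜ = (closure D)ᶜ := by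
  have h1 : closure ((fun x => a + x) '' D) = (fun x => a + x) '' closure D :=
    ((Homeomorph.addLeft a).image_closure D).symm
  ext x
  rw [h1, mem_preimage, mem_compl_iff, mem_compl_iff, add_comm x a]
  exact not_congr (add_right_injective a).mem_set_image

end

end ElasticScattering

/-- A single P-part or S-part far-field pattern of a pure plane pressure or shear wave determines
the position of a translated rigid elastic body. -/
theorem mainTheorem3 (lam mu om : ℝ) (hmu : 0 < mu) (hlam : 0 < 3 * lam + 2 * mu) (hom : 0 < om)
    (d dp : Space) (hd : ‖d‖ = 1) (hdp : ‖dp‖ = 1) (hddp : inner ℝ dp d = 0)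
    (α β : ℂ) (hαβ : α * β = 0) (hne : α ≠ 0 ∨ β ≠ 0)
    (D : Set Space) (hDo : IsOpen D) (hDb : Bornology.IsBounded D) (hDn : D.Nonempty)
    (hDc : IsConnected (closure D)ᶜ) (a : Space)
    (usc up us : Space → CVec)
    (husc : IsScatteredField lam mu om α β d dp D usc)
    (hff : IsFarFieldPattern lam mu om usc up us)
    (usca upa usa : Space → CVec)
    (husca : IsScatteredField lam mu om α β d dp ((fun x => a + x) '' D) usca)
    (hffa : IsFarFieldPattern lam mu om usca upa usa)
    (heq : (∀ θ : Space, ‖θ‖ = 1 → upa θ = up θ) ∨ (∀ θ : Space, ‖θ‖ = 1 → usa θ = us θ)) :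
    a = 0 := by
  have hlm : 0 < lam + 2 * mu := by linarith
  have hDab : Bornology.IsBounded ((fun x => a + x) '' D) :=
    (isometry_add_left a : Isometry fun x : Space => a + x).lipschitz.isBounded_image hDb
  obtain ⟨R, hR, hRD⟩ := exists_norm_lt_of_isBounded hDb
  obtain ⟨Ra, hRa, hRDa⟩ := exists_norm_lt_of_isBounded hDab
  have hd0 : d ≠ 0 := norm_pos_iff.1 (by rw [hd]; exact one_pos)
  have hdp0 : dp ≠ 0 := norm_pos_iff.1 (by rw [hdp]; exact one_pos)
  have hC : ∀ A k b, ContDiff ℝ 2 (planeWave A k d b) := fun A k b =>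
    (contDiff_planeWave A k d b).of_le two_le_infty
  -- otherwise the incident field itself would have zero trace
  have hu : ∀ {A : ℂ} {k : ℝ} {b : Space}, A ≠ 0 → b ≠ 0 →
      HasZeroTrace (closure D)ᶜ (fun x => planeWave A k d b x + usc x) →
      ¬ ∀ x ∈ (closure D)ᶜ, usc x = 0 := fun hA hb hz h0 =>
    not_hasZeroTrace_planeWave hA _ d hb hDo hDb hDn
      (hz.congr isClosed_closure.isOpen_compl fun x hx => by rw [h0 x hx, add_zero])
  rcases mul_eq_zero.1 hαβ with rfl | rfl
  · have hβ : β ≠ 0 := hne.resolve_left fun h => h rfl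
    have hinc := incident_eq_planeWave_s lam mu om β d dp
    have hN : ∀ x, lameOp lam mu (incident lam mu om 0 β d dp) x +
        om ^ 2 • incident lam mu om 0 β d dp x = 0 := by
      rw [hinc]; exact navier_planeWave hd (Or.inr ⟨hddp, kS_sq hmu⟩)
    have hI : ContDiff ℝ 2 (incident lam mu om 0 β d dp) := by rw [hinc]; exact hC _ _ _
    have h := husc.scattering hmu hlam hom hR hRD hI hN hff
    have ha := husca.scattering hmu hlam hom hRa hRDa hI hN hffa
    rw [hinc] at h ha
    exact h.translation_eq_zero hmu hlm hom hR hRa ha ((hC _ _ _).of_le (by norm_num))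
      (preimage_exterior_image_add a D) (fun x => planeWave_add _ _ _ _ x a)
      (heq.imp (fun h j θ hθ => by rw [h θ hθ]) fun h j θ hθ => by rw [h θ hθ])
      (hu hβ hdp0 h.trace) (h.eq_zero_of_pattern_sp hmu hlm hom hR hdp hDc.isPreconnected)
      (h.eq_zero_of_pattern_s hmu hlm hom hR hd hddp hDc.isPreconnected)
  · have hα : α ≠ 0 := hne.resolve_right fun h => h rfl
    have hinc := incident_eq_planeWave_p lam mu om α d dp
    have hN : ∀ x, lameOp lam mu (incident lam mu om α 0 d dp) x +
        om ^ 2 • incident lam mu om α 0 d dp x = 0 := by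
      rw [hinc]; exact navier_planeWave hd (Or.inl ⟨rfl, kP_sq hlm⟩)
    have hI : ContDiff ℝ 2 (incident lam mu om α 0 d dp) := by rw [hinc]; exact hC _ _ _
    have h := husc.scattering hmu hlam hom hR hRD hI hN hff
    have ha := husca.scattering hmu hlam hom hRa hRDa hI hN hffa
    rw [hinc] at h ha
    exact h.translation_eq_zero hmu hlm hom hR hRa ha ((hC _ _ _).of_le (by norm_num))
      (preimage_exterior_image_add a D) (fun x => planeWave_add _ _ _ _ x a)
      (heq.imp (fun h j θ hθ => by rw [h θ hθ]) fun h j θ hθ => by rw [h θ hθ])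
      (hu hα hd0 h.trace) (h.eq_zero_of_pattern_p hmu hlm hom hR hd hDc.isPreconnected)
      (h.eq_zero_of_pattern_ps hmu hlm hom hR hd hdp hddp hDc.isPreconnected)
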